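/- Let $m,n\ge 1$, let $\Omega\subseteq\mathbb C^m$ and $\Omega'\subseteq\mathbb C^{m-1}$ be open sets (for instance domains) such that the hypersurface $Z=\{(0,z_2,\dots,z_m): (z_2,\dots,z_m)\in\Omega'\}$ is contained in $\Omega$. Let $E$ and $\widetilde E$ be holomorphic vector bundles of finite rank over $\Omega$ with smooth Hermitian metrics. *Notation.* For a holomorphic frame $\mathbf s=(s_1,\dots,s_l)^T$ of $E$ over an open set let $H=[\langle s_p,s_q\rangle]_{p,q}$ be its Gram matrix. A matrix $A$ represents a linear map $T$ with respect to $\mathbf s$ if $Ts_p=\sum_q A_{pq}s_q$. For $1\le i,j\le m$ the component $\mathcal K_{i\bar j}$ of the curvature of the canonical (Chern) connection is the bundle endomorphism of $E$ represented by $\partial_{\bar z_j}(\partial_{z_i}H\cdot H^{-1})$. If a bundle endomorphism $\Theta$ is represented by $A$, its covariant derivatives $\Theta_{z_i}$ and $\Theta_{\bar z_i}$ are represented by $\partial_{z_i}A-\partial_{z_i}H\,H^{-1}A+A\,\partial_{z_i}H\,H^{-1}$ and $\partial_{\bar z_i}A$. $\Theta_{z_1^r\bar z_1^t}$ denotes the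 result of differentiating $\Theta$ covariantly $r$ times in the direction $z_1$ and then $t$ times in the direction $\bar z_1$, and $\Theta_{z_1^r}=\Theta_{z_1^r\bar z_1^0}$. The $n$-jet bundle $E^n_{z_1}$ of $E$ with respect to $z_1$ is the holomorphic vector bundle that has, for every holomorphic frame $\mathbf s$ of $E$, a local holomorphic frame written $(\partial_{z_1}^k s_p)_{0\le k\le n,\,1\le p\le l}$; if $\mathbf s=A\mathbf t$ with $A$ holomorphic, then $\partial_{z_1}^j\mathbf s=\sum_{k=0}^{j}\binom jk(\partial_{z_1}^{j-k}A)\,\partial_{z_1}^k\mathbf t$. It carries the Hermitian form (possibly degenerate or indefinite) with $\langle\partial_{z_1}^j s_p,\partial_{z_1}^k s_q\rangle=\partial_{z_1}^j\partial_{\bar z_1}^k H_{pq}$ and the Pascal map $P_1$, the bundle endomorphism with $P_1(\partial_{z_1}^k s_p)=k\,\partial_{z_1}^{k-1}s_p$ for $k\ge1$ and $P_1s_p=0$. All of this does not depend on the choice of frames. A holomorphic isometric bundle map is an isomorphism on each fibre that is represented by holomorphic matrix functions with respect to holomorphic frames and preserves the Hermitian forms. $E$ and $\widetilde E$ *have contact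 of order $n$ along $Z$* if there is a holomorphic isometric bundle map $\Phi:E^n_{z_1}|_Z\to\widetilde E^n_{z_1}|_Z$ with $\Phi P_1=\widetilde P_1\Phi$. **Theorem.** $E$ and $\widetilde E$ have contact of order $n$ along $Z$ if and only if there is a holomorphic isometric bundle map $\Psi:E|_Z\to\widetilde E|_Z$ such that (i) $\Psi(\mathcal K_{1\bar1})_{z_1^r\bar z_1^t}=(\widetilde{\mathcal K}_{1\bar1})_{z_1^r\bar z_1^t}\Psi$ on $Z$ for all integers $0\le r,t\le n-1$, and (ii) $\Psi(\mathcal K_{1\bar j})_{z_1^r}=(\widetilde{\mathcal K}_{1\bar j})_{z_1^r}\Psi$ on $Z$ for all integers $0\le r\le n-1$ and $2\le j\le m$. -/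

import Mathlib

open Bundle Manifold Matrix TopologicalSpace
open scoped ContDiff ComplexConjugate

noncomputable section

/-! ### Differential operators on functions on open subsets of `ℂ^d` -/

section Calculus

variable {d : ℕ} {Ω : Opens (Fin d → ℂ)}

/-- Extension by zero of a function on the open set `Ω` to all of `ℂ^d`. Derivatives at points of
the open set `Ω` do not depend on the extension. -/
def extendZero (f : Ω → ℂ) : (Fin d → ℂ) → ℂ :=
  Function.extend Subtype.val f 0

/-- The Wirtinger derivative `∂f/∂z_i = (∂f/∂x_i - i ∂f/∂y_i) / 2`. -/
def dz (i : Fin d) (f : Ω → ℂ) (x : Ω) : ℂ :=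
  (1 / 2) * (fderiv ℝ (extendZero f) x.1 (Pi.single i 1)
    - Complex.I * fderiv ℝ (extendZero f) x.1 (Pi.single i Complex.I))

/-- The Wirtinger derivative `∂f/∂z̄_i = (∂f/∂x_i + i ∂f/∂y_i) / 2`. -/
def dzbar (i : Fin d) (f : Ω → ℂ) (x : Ω) : ℂ :=
  (1 / 2) * (fderiv ℝ (extendZero f) x.1 (Pi.single i 1)
    + Complex.I * fderiv ℝ (extendZero f) x.1 (Pi.single i Complex.I))

/-- Entrywise `∂/∂z_i` of a matrix-valued function. -/
def dzMat {l : ℕ} (i : Fin d) (M : Ω → Matrix (Fin l) (Fin l) ℂ) (x : Ω) :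
    Matrix (Fin l) (Fin l) ℂ :=
  Matrix.of fun p q => dz i (fun y => M y p q) x

/-- Entrywise `∂/∂z̄_i` of a matrix-valued function. -/
def dzbarMat {l : ℕ} (i : Fin d) (M : Ω → Matrix (Fin l) (Fin l) ℂ) (x : Ω) :
    Matrix (Fin l) (Fin l) ℂ :=
  Matrix.of fun p q => dzbar i (fun y => M y p q) x

/-- The complex-valued function `f` is holomorphic on the (open) subset `U` of `Ω ⊆ ℂ^d`. -/
def HolomorphicOn (f : Ω → ℂ) (U : Set Ω) : Prop :=
  DifferentiableOn ℂ (extendZero f) (Subtype.val '' U)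

/-- The complex-valued function `f` is smooth (`C^∞` in the real sense) on the (open) subset `U`
of `Ω ⊆ ℂ^d`. -/
def SmoothOn (f : Ω → ℂ) (U : Set Ω) : Prop :=
  ContDiffOn ℝ ∞ (extendZero f) (Subtype.val '' U)

end Calculus

section Bundles

/-! ### Holomorphic frames, Hermitian metrics, curvature

A holomorphic vector bundle of rank `l` over the open set `Ω ⊆ ℂ^(m+1)` is a vector bundle over `Ω`
with model fibre `ℂ^l` whose transition functions are complex analytic. The coordinates of
`ℂ^(m+1)` are numbered `0, 1, …, m`. -/

variable {m : ℕ} {Ω : Opens (Fin (m + 1) → ℂ)} (l : ℕ) (E : Ω → Type*)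
  [TopologicalSpace (TotalSpace (Fin l → ℂ) E)] [∀ x, TopologicalSpace (E x)]
  [∀ x, AddCommGroup (E x)] [∀ x, Module ℂ (E x)]
  [FiberBundle (Fin l → ℂ) E]

/-- A holomorphic frame `(s_1, …, s_l)` of `E` over an open subset `dom` of `Ω`. -/
structure HolFrame where
  /-- the domain of the frame -/
  dom : Set Ω
  isOpen_dom : IsOpen dom
  /-- the sections that form the frame (only their values on `dom` matter) -/
  sec : Fin l → ∀ x, E x
  isFrame : IsLocalFrameOn 𝓘(ℂ, Fin (m + 1) → ℂ) (Fin l → ℂ) ω sec dom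

/-- A (smooth) Hermitian metric on `E`: a positive definite Hermitian form on each fibre, linear in
the first and conjugate linear in the second variable, such that the Gram matrices of holomorphic
frames are smooth. -/
structure HermMetric where
  /-- the form on the fibres -/
  form : ∀ x, E x →ₗ[ℂ] E x →ₗ⋆[ℂ] ℂ
  conj_symm : ∀ x (u v : E x), form x v u = conj (form x u v)
  pos : ∀ x (u : E x), u ≠ 0 → 0 < (form x u u).re
  smooth : ∀ (s : HolFrame l E) (p q : Fin l),
    SmoothOn (fun x => form x (s.sec p x) (s.sec q x)) s.dom

variable {l E}

/-- The linear map on the fibre `E x` that is represented by the matrix `M` with respect to the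
frame `s`, with the left action convention `s_p ↦ ∑ q, M_pq s_q`. -/
def HolFrame.toEnd (s : HolFrame l E) {x : Ω} (hx : x ∈ s.dom) (M : Matrix (Fin l) (Fin l) ℂ) :
    E x →ₗ[ℂ] E x :=
  (s.isFrame.toBasisAt hx).constr ℂ fun p => ∑ q, M p q • s.sec q x

/-- The Gram matrix `H = [⟨s_p, s_q⟩]` of the frame `s`. -/
def HermMetric.gram (h : HermMetric l E) (s : HolFrame l E) (x : Ω) :
    Matrix (Fin l) (Fin l) ℂ :=
  Matrix.of fun p q => h.form x (s.sec p x) (s.sec q x)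

/-- The `dz_i`-component `∂_{z_i} H · H⁻¹` of the matrix, with respect to the holomorphic frame
`s`, of the canonical (Chern) connection. -/
def HermMetric.connMat (h : HermMetric l E) (s : HolFrame l E) (i : Fin (m + 1)) (x : Ω) :
    Matrix (Fin l) (Fin l) ℂ :=
  dzMat i (h.gram s) x * (h.gram s x)⁻¹

/-- The matrix `∂_{z̄_j}(∂_{z_i} H · H⁻¹)`, with respect to the holomorphic frame `s`, of the
component `K_{i j̄}` of the curvature of the canonical connection. -/
def HermMetric.curvMat (h : HermMetric l E) (s : HolFrame l E) (i j : Fin (m + 1)) :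
    Ω → Matrix (Fin l) (Fin l) ℂ :=
  dzbarMat j (h.connMat s i)

/-- Covariant derivative in the direction `z_i` of a bundle map, on matrices with respect to the
holomorphic frame `s`: `A ↦ ∂_{z_i} A - (∂_{z_i} H · H⁻¹) A + A (∂_{z_i} H · H⁻¹)`. -/
def HermMetric.covZ (h : HermMetric l E) (s : HolFrame l E) (i : Fin (m + 1))
    (A : Ω → Matrix (Fin l) (Fin l) ℂ) (x : Ω) : Matrix (Fin l) (Fin l) ℂ :=
  dzMat i A x - h.connMat s i x * A x + A x * h.connMat s i x

/-- The matrix, with respect to the holomorphic frame `s`, of the covariant derivative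
`(K_{1 j̄})_{z_1^r z̄_1^t}` of the curvature component `K_{1 j̄}`: first `r` times in the direction
`z_1`, then `t` times in the direction `z̄_1`. Covariant differentiation in the direction `z̄_1`
acts on matrices with respect to a holomorphic frame as `∂_{z̄_1}`. The first coordinate has
index `0`. -/
def HermMetric.covCurvMat (h : HermMetric l E) (s : HolFrame l E) (j : Fin (m + 1)) (r t : ℕ) :
    Ω → Matrix (Fin l) (Fin l) ℂ :=
  (dzbarMat 0)^[t] ((h.covZ s 0)^[r] (h.curvMat s 0 j))

/-- The endomorphism `(K_{1 j̄})_{z_1^r z̄_1^t}` of the fibre `E x`, computed in the frame `s`. -/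
def HermMetric.covCurv (h : HermMetric l E) (s : HolFrame l E) (j : Fin (m + 1)) (r t : ℕ)
    {x : Ω} (hx : x ∈ s.dom) : E x →ₗ[ℂ] E x :=
  s.toEnd hx (h.covCurvMat s j r t x)

/-! ### The jet bundle in the direction of the first coordinate -/

/-- The transition matrix `A` with `s = A t`, that is `s_p = ∑ q, A_pq t_q`. -/
def HolFrame.trans (s t : HolFrame l E) (x : Ω) : Matrix (Fin l) (Fin l) ℂ :=
  Matrix.of fun p q => t.isFrame.coeff q x (s.sec p x)

/-- The block matrix with `(j, k)` block `binom(j, k) ∂_{z_1}^{j-k} A`, `0 ≤ j, k ≤ n`, (zero for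
`k > j`) where `s = A t`. It expresses the frame `(∂_{z_1}^j s_p)` through `(∂_{z_1}^k t_q)`. -/
def HolFrame.jetTrans (n : ℕ) (s t : HolFrame l E) (x : Ω) :
    Matrix (Fin (n + 1) × Fin l) (Fin (n + 1) × Fin l) ℂ :=
  Matrix.of fun a b => ((a.1 : ℕ).choose b.1 : ℂ) *
    (dz 0)^[(a.1 : ℕ) - b.1] (fun y => s.trans t y a.2 b.2) x

variable (l) in
/-- The matrix of the Pascal map: `(k, p) ↦ k (k - 1, p)`. -/
def pascalMat (n : ℕ) : Matrix (Fin (n + 1) × Fin l) (Fin (n + 1) × Fin l) ℂ :=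
  Matrix.of fun a b => if (a.1 : ℕ) = b.1 + 1 ∧ a.2 = b.2 then ((a.1 : ℕ) : ℂ) else 0

variable (l E) in
/-- The fibre at `x` of the `n`-jet bundle of `E` with respect to `z_1`, glued from the
transition matrices `jetTrans`. A vector `v` is given by its row `v s` of coordinates with respect
to the frame `(∂_{z_1}^k s_p)`, for every holomorphic frame `s` of `E` around `x`; these rows must
be compatible. -/
def JetFibre (n : ℕ) (x : Ω) :
    Submodule ℂ ({s : HolFrame l E // x ∈ s.dom} → Fin (n + 1) × Fin l → ℂ) where
  carrier := {v | ∀ s t, v t = v s ᵥ* s.1.jetTrans n t.1 x}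
  add_mem' := by
    intro v w hv hw s t
    simp only [Pi.add_apply, Matrix.add_vecMul, hv s t, hw s t]
  zero_mem' := by
    intro s t
    simp
  smul_mem' := by
    intro c v hv s t
    simp only [Pi.smul_apply, Matrix.smul_vecMul, hv s t]

theorem pascalMat_comm_jetTrans (n : ℕ) (s t : HolFrame l E) (x : Ω) :
    s.jetTrans n t x * pascalMat l n = pascalMat l n * s.jetTrans n t x := by
  ext ⟨j, p⟩ ⟨k, q⟩
  have e1 : (s.jetTrans n t x * pascalMat l n) (j, p) (k, q) =
      ((j : ℕ).choose (k + 1) : ℂ) * ((k : ℂ) + 1) *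
        (dz 0)^[(j : ℕ) - (k + 1)] (fun y => s.trans t y p q) x := by
    rw [Matrix.mul_apply]
    by_cases hk : (k : ℕ) + 1 < n + 1
    · rw [Finset.sum_eq_single (⟨k + 1, hk⟩, q)]
      · simp [HolFrame.jetTrans, pascalMat]
        ring
      · rintro ⟨c, r⟩ - hc
        have : ¬ ((c : ℕ) = k + 1 ∧ r = q) := by
          rintro ⟨h1, h2⟩
          exact hc (by ext <;> simp [h1, h2])
        simp [pascalMat, this]
      · simp
    · rw [Nat.choose_eq_zero_of_lt (by omega), Finset.sum_eq_zero]
      · simp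
      · rintro ⟨c, r⟩ -
        have : ¬ ((c : ℕ) = k + 1 ∧ r = q) := by
          rintro ⟨h1, -⟩
          omega
        simp [pascalMat, this]
  have e2 : (pascalMat l n * s.jetTrans n t x) (j, p) (k, q) =
      (j : ℂ) * (((j : ℕ) - 1).choose k : ℂ) *
        (dz 0)^[(j : ℕ) - (k + 1)] (fun y => s.trans t y p q) x := by
    rw [Matrix.mul_apply]
    by_cases hj : (j : ℕ) = 0
    · rw [Finset.sum_eq_zero]
      · simp [hj]
      · rintro ⟨c, r⟩ -
        simp [pascalMat, hj]
    · rw [Finset.sum_eq_single (⟨j - 1, by omega⟩, p)]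
      · have h1 : (j : ℕ) = j - 1 + 1 := by omega
        have h2 : (j : ℕ) - (k + 1) = j - 1 - k := by omega
        simp only [HolFrame.jetTrans, pascalMat, Matrix.of_apply, h2]
        rw [if_pos ⟨h1, trivial⟩]
        ring
      · rintro ⟨c, r⟩ - hc
        have : ¬ ((j : ℕ) = c + 1 ∧ p = r) := by
          rintro ⟨h1, h2⟩
          exact hc (by ext <;> simp [h1, h2])
        simp [pascalMat, this]
      · simp
  rw [e1, e2]
  congr 1
  rcases Nat.eq_zero_or_pos (j : ℕ) with hj | hj
  · simp [hj]
  · obtain ⟨i, hi⟩ : ∃ i, (j : ℕ) = i + 1 := ⟨j - 1, by omega⟩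
    rw [hi]
    have := Nat.add_one_mul_choose_eq i k
    exact_mod_cast this.symm

/-- The Pascal map `P_1` on the fibre of the jet bundle: `∂_{z_1}^k s_p ↦ k ∂_{z_1}^{k-1} s_p` for
`k ≥ 1` and `s_p ↦ 0`, for every holomorphic frame `s`. -/
def pascalMap (n : ℕ) (x : Ω) : JetFibre l E n x →ₗ[ℂ] JetFibre l E n x where
  toFun v := ⟨fun s => v.1 s ᵥ* pascalMat l n, by
    intro s t
    simp only [v.2 s t, Matrix.vecMul_vecMul, pascalMat_comm_jetTrans]⟩
  map_add' := by
    intro v w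
    ext s : 2
    simp [Matrix.add_vecMul]
  map_smul' := by
    intro c v
    ext s : 2
    simp [Matrix.smul_vecMul]

/-- The Gram matrix `[∂_{z_1}^j ∂_{z̄_1}^k H]` of the frame `(∂_{z_1}^j s_p)` of the jet bundle. -/
def HermMetric.jetGram (h : HermMetric l E) (n : ℕ) (s : HolFrame l E) (x : Ω) :
    Matrix (Fin (n + 1) × Fin l) (Fin (n + 1) × Fin l) ℂ :=
  Matrix.of fun a b =>
    (dz 0)^[(a.1 : ℕ)] ((dzbar 0)^[(b.1 : ℕ)] fun y => h.gram s y a.2 b.2) x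

/-- The Hermitian form on the fibre of the jet bundle, computed in the frame `s`. -/
def HermMetric.jetForm (h : HermMetric l E) (n : ℕ) {x : Ω} (s : {s : HolFrame l E // x ∈ s.dom})
    (v w : JetFibre l E n x) : ℂ :=
  v.1 s ⬝ᵥ (h.jetGram n s.1 x *ᵥ star (w.1 s))

end Bundles

/-! ### Bundle maps along the hypersurface `Z = {(0, w) | w ∈ Ω'}` -/

section Hypersurface

variable {m : ℕ} {Ω : Opens (Fin (m + 1) → ℂ)} {Ω' : Opens (Fin m → ℂ)}

/-- The parametrization `w ↦ (0, w)` of `Z` by `Ω'`. -/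
def zPoint (hZ : ∀ w ∈ Ω', (Fin.cons 0 w : Fin (m + 1) → ℂ) ∈ Ω) (w : Ω') : Ω :=
  ⟨Fin.cons 0 w.1, hZ w.1 w.2⟩

variable {l : ℕ} {E : Ω → Type*}
  [TopologicalSpace (TotalSpace (Fin l → ℂ) E)] [∀ x, TopologicalSpace (E x)]
  [∀ x, AddCommGroup (E x)] [∀ x, Module ℂ (E x)]
  [FiberBundle (Fin l → ℂ) E]
  {l' : ℕ} {E' : Ω → Type*}
  [TopologicalSpace (TotalSpace (Fin l' → ℂ) E')] [∀ x, TopologicalSpace (E' x)]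
  [∀ x, AddCommGroup (E' x)] [∀ x, Module ℂ (E' x)]
  [FiberBundle (Fin l' → ℂ) E']

/-- `Ψ` is a holomorphic isometric bundle map `E|_Z → E'|_Z`: its matrices with respect to
holomorphic frames are holomorphic on `Z`, and it preserves the metrics. -/
structure IsHolIsometry (hZ : ∀ w ∈ Ω', (Fin.cons 0 w : Fin (m + 1) → ℂ) ∈ Ω)
    (h : HermMetric l E) (h' : HermMetric l' E')
    (Ψ : ∀ w : Ω', E (zPoint hZ w) ≃ₗ[ℂ] E' (zPoint hZ w)) : Prop where
  holomorphic : ∀ (s : HolFrame l E) (s' : HolFrame l' E') (p : Fin l) (q : Fin l'),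
    HolomorphicOn
      (fun w : Ω' => s'.isFrame.coeff q (zPoint hZ w) (Ψ w (s.sec p (zPoint hZ w))))
      {w | zPoint hZ w ∈ s.dom ∧ zPoint hZ w ∈ s'.dom}
  isometric : ∀ (w : Ω') (u v : E (zPoint hZ w)),
    h'.form _ (Ψ w u) (Ψ w v) = h.form _ u v

/-- `Φ` is a holomorphic isometric bundle map between the restrictions to `Z` of the `n`-jet
bundles with respect to `z_1`: with respect to the frames induced by holomorphic frames it is
represented by holomorphic matrix functions on `Z`, and it preserves the Hermitian forms. -/
structure IsJetHolIsometry (hZ : ∀ w ∈ Ω', (Fin.cons 0 w : Fin (m + 1) → ℂ) ∈ Ω) (n : ℕ)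
    (h : HermMetric l E) (h' : HermMetric l' E')
    (Φ : ∀ w : Ω', JetFibre l E n (zPoint hZ w) ≃ₗ[ℂ] JetFibre l' E' n (zPoint hZ w)) :
    Prop where
  holomorphic : ∀ (s : HolFrame l E) (s' : HolFrame l' E'),
    ∃ M : Ω' → Matrix (Fin (n + 1) × Fin l) (Fin (n + 1) × Fin l') ℂ,
      (∀ a b, HolomorphicOn (fun w => M w a b)
        {w | zPoint hZ w ∈ s.dom ∧ zPoint hZ w ∈ s'.dom}) ∧
      ∀ (w : Ω') (hs : zPoint hZ w ∈ s.dom) (hs' : zPoint hZ w ∈ s'.dom)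
        (v : JetFibre l E n (zPoint hZ w)),
        (Φ w v).1 ⟨s', hs'⟩ = v.1 ⟨s, hs⟩ ᵥ* M w
  isometric : ∀ (w : Ω') (s : {s : HolFrame l E // zPoint hZ w ∈ s.dom})
    (s' : {s : HolFrame l' E' // zPoint hZ w ∈ s.dom}) (u v : JetFibre l E n (zPoint hZ w)),
    h'.jetForm n s' (Φ w u) (Φ w v) = h.jetForm n s u v

/-- `(E, h)` and `(E', h')` have contact of order `n` along `Z`: there is a holomorphic isometric
bundle map between the restrictions to `Z` of their `n`-jet bundles with respect to `z_1` which
intertwines the Pascal maps. -/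
def HasContactAlong (hZ : ∀ w ∈ Ω', (Fin.cons 0 w : Fin (m + 1) → ℂ) ∈ Ω) (n : ℕ)
    (h : HermMetric l E) (h' : HermMetric l' E') : Prop :=
  ∃ Φ : ∀ w : Ω', JetFibre l E n (zPoint hZ w) ≃ₗ[ℂ] JetFibre l' E' n (zPoint hZ w),
    IsJetHolIsometry hZ n h h' Φ ∧
    ∀ w v, Φ w (pascalMap n _ v) = pascalMap n _ (Φ w v)

/-- `Ψ` intertwines the bundle maps `(K_{1 j̄})_{z_1^r z̄_1^t}` of `E` and `E'` on `Z`. -/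
def IntertwinesCovCurv (hZ : ∀ w ∈ Ω', (Fin.cons 0 w : Fin (m + 1) → ℂ) ∈ Ω)
    (h : HermMetric l E) (h' : HermMetric l' E')
    (Ψ : ∀ w : Ω', E (zPoint hZ w) ≃ₗ[ℂ] E' (zPoint hZ w))
    (j : Fin (m + 1)) (r t : ℕ) : Prop :=
  ∀ (w : Ω') (s : HolFrame l E) (s' : HolFrame l' E')
    (hs : zPoint hZ w ∈ s.dom) (hs' : zPoint hZ w ∈ s'.dom) (v : E (zPoint hZ w)),
    Ψ w (h.covCurv s j r t hs v) = h'.covCurv s' j r t hs' (Ψ w v)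

end Hypersurface

end

/-! The theorem rests on one identity. For a holomorphic frame with Gram matrix `H` put `Γ_j =
∂_{z_1}^j H · H⁻¹`, let `∂̄` be the derivative in any direction `z̄_a`, and let `κ_i` be the `i`-th
covariant `z_1`-derivative of `K_{1 ā}`. Then `∂̄ Γ_j = ∑_{i<j} binom(j, i+1) Γ_{j-1-i} κ_i`
(`curvature_expansion`). The term `i = j-1` has coefficient `1`, so the `κ_i` can be solved for
recursively from the `Γ_j`; conversely the `κ_i` and the `Γ_i` of lower index determine `∂̄ Γ_j`.

From contact to curvature: a matrix commuting with the Pascal matrix has the binomial block pattern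
of a jet transition matrix (`pascal_comm_blocks`). So the first block column of `Φ` can be used as
Taylor coefficients in `z_1` of a change of frame, and every frame `s` of `E` has a partner `t` in
`E'` with `Φ` taking the jets of `s` to those of `t` (`exists_frame_of_jetIso`). Isometry says that
all `∂_{z_1}^j ∂_{z̄_1}^k H`, `j, k ≤ n`, of `s` and `t` agree on `Z`, and the identity transfers
this to the curvatures. In direction `z̄_1` one order is lost; in a tangential direction none is,
since such derivatives depend only on values on `Z`. The map `Ψ` is the order-zero part of `Φ`.

From curvature to contact: start with `s` and an extension `t` of its image under `Ψ`. If the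
`∂_{z_1}^j H` of the two frames agree on `Z` for `j ≤ k`, then by (ii) and the identity the
difference `X` of the two `Γ_{k+1}` is holomorphic along `Z`. Replacing `t` by `(1 + z_1^{k+1} X /
(k+1)!) t` gives agreement to order `k+1` (`IsAdapted.exists_succ`). After `n` steps the pure
derivatives agree; then (i) and the identity, by induction on the number of `∂_{z̄_1}`, give the
mixed ones (`jets_of_evalZ_covCurv`). Sending the jets of `s` to those of `t` defines `Φ`. It does
not depend on the adapted pair, because the jets of a transition matrix can be read off from the
`∂_{z_1}`-jets of the Gram matrices and its value on `Z` (`IsAdapted.jetTrans_eq`).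

The matrix algebra takes place in an abstract noncommutative ring with derivations, later taken to
be matrices over the smooth functions on an open set. Osgood's lemma enters because the matrices of
`Φ` and `Ψ` are only assumed complex differentiable, whereas frames have to be analytic. -/

noncomputable section

/-! ### Osgood's lemma -/

section Osgood

open MeasureTheory Metric

/-- Cauchy's integral formula on a polydisc. -/
theorem torusIntegral_prod_sub_inv_mul {d : ℕ} {f : (Fin d → ℂ) → ℂ} {c z : Fin d → ℂ} {r : ℝ}
    (hr : 0 < r) (hf : ∀ x ∈ closedBall c r, DifferentiableAt ℂ f x) (hz : z ∈ ball c r) :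
    torusIntegral (fun x => (∏ i, (x i - z i)⁻¹) * f x) c (fun _ => r) =
      (2 * Real.pi * Complex.I) ^ d * f z := by
  induction d with
  | zero =>
    rw [torusIntegral_dim0]
    simp [Subsingleton.elim c z]
  | succ d ih =>
    have hmem (θ : Fin (d + 1) → ℝ) : torusMap c (fun _ => r) θ ∈ closedBall c r := by
      rw [closedBall_pi _ hr.le]
      intro i _
      simp [torusMap, abs_of_pos hr]
    have hz' : ∀ i, z i ∈ ball (c i) r := by
      rw [ball_pi _ hr] at hz
      exact fun i => hz i trivial
    have hne (θ : Fin (d + 1) → ℝ) (i) : torusMap c (fun _ => r) θ i - z i ≠ 0 := by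
      intro h0
      have h1 := hz' i
      rw [← sub_eq_zero.mp h0] at h1
      simp [torusMap, abs_of_pos hr] at h1
    have hint : TorusIntegrable (fun x => (∏ i, (x i - z i)⁻¹) * f x) c (fun _ => r) := by
      refine ContinuousOn.integrableOn_compact isCompact_Icc (Continuous.continuousOn ?_)
      have ht : Continuous (torusMap c (fun _ => r)) := by
        unfold torusMap
        fun_prop
      refine Continuous.mul (continuous_finsetProd _ fun i _ => ?_) ?_
      · refine Continuous.inv₀ ?_ fun θ => hne θ i
        exact ((continuous_apply i).comp ht).sub continuous_const
      · exact continuous_iff_continuousAt.2 fun θ =>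
          ContinuousAt.comp (f := torusMap c (fun _ => r)) (hf _ (hmem θ)).continuousAt
            ht.continuousAt
    rw [torusIntegral_succ hint]
    have hcons (x : ℂ) (hx : x ∈ closedBall (c 0) r) (y : Fin d → ℂ)
        (hy : y ∈ closedBall (c ∘ Fin.succ) r) :
        (Fin.cons x y : Fin (d + 1) → ℂ) ∈ closedBall c r := by
      rw [closedBall_pi _ hr.le] at hy ⊢
      intro i _
      refine Fin.cases ?_ (fun j => ?_) i
      · simpa using hx
      · simpa using hy j trivial
    have hztail : (fun i => z (Fin.succ i)) ∈ ball (c ∘ Fin.succ) r := by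
      rw [ball_pi _ hr]
      exact fun i _ => hz' i.succ
    -- With the first variable frozen on its circle, the induction hypothesis evaluates the
    -- remaining integrals; what is left is the one-variable Cauchy formula.
    have inner (x : ℂ) (hx : x ∈ sphere (c 0) r) :
        torusIntegral (fun y : Fin d → ℂ =>
          (∏ i, ((Fin.cons x y : Fin (d + 1) → ℂ) i - z i)⁻¹) * f (Fin.cons x y))
          (c ∘ Fin.succ) ((fun _ => r) ∘ Fin.succ) =
        (x - z 0)⁻¹ • ((2 * Real.pi * Complex.I) ^ d * f (Fin.cons x (fun i => z (Fin.succ i)))) := by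
      have h1 := ih (f := fun y => f (Fin.cons x y)) (c := c ∘ Fin.succ)
        (z := fun i => z (Fin.succ i)) (fun y hy => by
          refine DifferentiableAt.comp y (hf _ (hcons x (sphere_subset_closedBall hx) y hy)) ?_
          rw [differentiableAt_pi]
          intro i
          refine Fin.cases ?_ (fun j => ?_) i
          · simp
          · simp only [Fin.cons_succ]
            fun_prop) hztail
      rw [← h1, smul_eq_mul, ← torusIntegral_const_mul]
      congr 1
      ext y
      rw [Fin.prod_univ_succ]
      simp [mul_assoc]
    rw [circleIntegral.integral_congr hr.le inner]
    rw [DifferentiableOn.circleIntegral_sub_inv_smul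
      (f := fun x => (2 * Real.pi * Complex.I) ^ d * f (Fin.cons x (fun i => z (Fin.succ i))))
      ?_ (hz' 0)]
    · have : (Fin.cons (z 0) (fun i => z (Fin.succ i)) : Fin (d + 1) → ℂ) = z :=
        Fin.cons_self_tail z
      rw [this, smul_eq_mul]
      ring
    · intro x hx
      refine (DifferentiableAt.const_mul ?_ _).differentiableWithinAt
      refine DifferentiableAt.comp x (hf _ (hcons x hx _ (ball_subset_closedBall hztail))) ?_
      rw [differentiableAt_pi]
      intro i
      refine Fin.cases ?_ (fun j => ?_) i
      · simp only [Fin.cons_zero]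
        fun_prop
      · simp

/-- The integral of the product with `k`, as a continuous linear functional. -/
def integralMulCLM {K : Type*} [TopologicalSpace K] [CompactSpace K] [MeasurableSpace K]
    [BorelSpace K] (μ : Measure K) [IsFiniteMeasure μ] (k : C(K, ℂ)) : C(K, ℂ) →L[ℂ] ℂ :=
  LinearMap.mkContinuous
    { toFun := fun g => ∫ x, (k * g) x ∂μ
      map_add' := fun g₁ g₂ => by
        rw [mul_add]
        exact integral_add ((k * g₁).continuous.integrable_of_hasCompactSupport
            (HasCompactSupport.of_compactSpace _))
          ((k * g₂).continuous.integrable_of_hasCompactSupport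
            (HasCompactSupport.of_compactSpace _))
      map_smul' := fun a g => by
        rw [mul_smul_comm]
        exact integral_smul a _ }
    (‖k‖ * μ.real Set.univ) (fun g => by
      have h : ∀ᵐ x ∂μ, ‖(k * g) x‖ ≤ ‖k‖ * ‖g‖ := Filter.Eventually.of_forall fun x =>
        ((k * g).norm_coe_le_norm x).trans (norm_mul_le _ _)
      refine (norm_integral_le_of_norm_le_const h).trans (le_of_eq ?_)
      ring)

/-- Osgood's lemma: a function that is complex differentiable near a point of `ℂ^d` is analytic
there. -/
theorem contDiffAt_omega_of_differentiableOn {d : ℕ} {f : (Fin d → ℂ) → ℂ} {U : Set (Fin d → ℂ)}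
    (hU : IsOpen U) (hf : DifferentiableOn ℂ f U) {c : Fin d → ℂ} (hc : c ∈ U) :
    ContDiffAt ℂ ω f c := by
  obtain ⟨r, hr, hrU⟩ := Metric.nhds_basis_closedBall.mem_iff.1 (hU.mem_nhds hc)
  have hf' : ∀ x ∈ closedBall c r, DifferentiableAt ℂ f x := fun x hx =>
    hf.differentiableAt (hU.mem_nhds (hrU hx))
  let K : Set (Fin d → ℝ) := Set.Icc 0 fun _ => 2 * Real.pi
  have : CompactSpace K := isCompact_iff_compactSpace.1 isCompact_Icc
  let μ : Measure K := volume.comap Subtype.val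
  have : IsFiniteMeasure μ := by
    constructor
    rw [MeasurableEmbedding.comap_apply (MeasurableEmbedding.subtype_coe measurableSet_Icc)]
    rw [Set.image_univ, Subtype.range_coe]
    exact isCompact_Icc.measure_lt_top
  have ht : Continuous (torusMap c (fun _ : Fin d => r)) := by
    unfold torusMap
    fun_prop
  have hmem (θ : Fin d → ℝ) : torusMap c (fun _ => r) θ ∈ closedBall c r := by
    rw [closedBall_pi _ hr.le]
    intro i _
    simp [torusMap, abs_of_pos hr]
  -- The part of the Cauchy integrand that does not involve `z`: the values of `f` on the torus and
  -- the Jacobian of its parametrization.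
  let k : C(K, ℂ) :=
    { toFun := fun θ => (∏ i, (r : ℂ) * Complex.exp (θ.1 i * Complex.I) * Complex.I) *
        f (torusMap c (fun _ => r) θ)
      continuous_toFun := by
        refine Continuous.mul (continuous_finsetProd _ fun i _ => ?_) ?_
        · have : Continuous fun θ : K => (θ.1 i : ℂ) :=
            Complex.continuous_ofReal.comp ((continuous_apply i).comp continuous_subtype_val)
          fun_prop
        · exact continuous_iff_continuousAt.2 fun θ =>
            ContinuousAt.comp (f := fun θ : K => torusMap c (fun _ => r) θ)
              (hf' _ (hmem θ)).continuousAt (ht.comp continuous_subtype_val).continuousAt }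
  let e (i : Fin d) : C(K, ℂ) :=
    { toFun := fun θ => torusMap c (fun _ => r) θ.1 i
      continuous_toFun := (continuous_apply i).comp (ht.comp continuous_subtype_val) }
  -- The point `z` enters only through these elements of the Banach algebra `C(K, ℂ)`, which are
  -- affine in `z`. Since inversion in a Banach algebra is analytic and integration against `k` is
  -- continuous and linear, the Cauchy integral is analytic in `z` without differentiating under the
  -- integral sign.
  let u (i : Fin d) (z : Fin d → ℂ) : C(K, ℂ) := e i - z i • 1
  have hu (i : Fin d) (z) (hz : z ∈ ball c r) (θ : K) : u i z θ ≠ 0 := by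
    intro h0
    rw [ball_pi _ hr] at hz
    have h1 := hz i trivial
    have h2 : torusMap c (fun _ => r) θ.1 i - z i = 0 := by simpa [u, e] using h0
    rw [← sub_eq_zero.mp h2] at h1
    simp [torusMap, abs_of_pos hr] at h1
  have hunit (i : Fin d) (z) (hz : z ∈ ball c r) : IsUnit (u i z) :=
    (ContinuousMap.isUnit_iff_forall_ne_zero _).2 (hu i z hz)
  have hΦ : ContDiffAt ℂ ω (fun z => ∏ i, Ring.inverse (u i z)) c := by
    refine contDiffAt_prod fun i _ => ?_
    obtain ⟨v, hv⟩ := hunit i c (mem_ball_self hr)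
    have h0 : ContDiffAt ℂ ω (fun z : Fin d → ℂ => z i) c := (contDiff_apply ℂ ℂ i).contDiffAt
    have h1 : ContDiffAt ℂ ω (u i) c := contDiffAt_const.sub (h0.smul contDiffAt_const)
    exact ContDiffAt.comp c (g := Ring.inverse) (by rw [← hv]; exact contDiffAt_ringInverse ℂ v) h1
  have hL : ContDiffAt ℂ ω (fun z => ((2 * Real.pi * Complex.I) ^ d)⁻¹ *
      integralMulCLM μ k (∏ i, Ring.inverse (u i z))) c :=
    contDiffAt_const.mul ((integralMulCLM μ k).contDiff.contDiffAt.comp c hΦ)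
  refine hL.congr_of_eventuallyEq ?_
  filter_upwards [isOpen_ball.mem_nhds (mem_ball_self hr)] with z hz
  have h3 := torusIntegral_prod_sub_inv_mul hr hf' hz
  have h4 : torusIntegral (fun x => (∏ i, (x i - z i)⁻¹) * f x) c (fun _ => r) =
      integralMulCLM μ k (∏ i, Ring.inverse (u i z)) := by
    change _ = ∫ θ : K, (k * _) θ ∂μ
    unfold torusIntegral
    rw [← integral_subtype_comap measurableSet_Icc]
    refine integral_congr_ae (Filter.Eventually.of_forall fun θ => ?_)
    have h5 (i : Fin d) : Ring.inverse (u i z) θ = (torusMap c (fun _ => r) θ.1 i - z i)⁻¹ := by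
      have h6 := congrArg (fun g : C(K, ℂ) => g θ) (Ring.mul_inverse_cancel _ (hunit i z hz))
      have h7 : (torusMap c (fun _ => r) θ.1 i - z i) * Ring.inverse (u i z) θ = 1 := by
        simpa [u, e] using h6
      exact eq_inv_of_mul_eq_one_right h7
    simp only [ContinuousMap.mul_apply, ContinuousMap.prod_apply, h5, smul_eq_mul]
    simp only [k, ContinuousMap.coe_mk]
    ring
  rw [← h4, h3, inv_mul_cancel_left₀]
  have := Complex.two_pi_I_ne_zero
  positivity

end Osgood

/-! ### Derivations of noncommutative rings -/

section Derivations

variable {S T : Type*} [Ring S] [Ring T]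

/-- The additive map `δ` satisfies the Leibniz rule. -/
def IsDeriv (δ : S →+ S) : Prop := ∀ x y, δ (x * y) = δ x * y + x * δ y

theorem IsDeriv.map_one {δ : S →+ S} (hδ : IsDeriv δ) : δ 1 = 0 := by
  simpa using hδ 1 1

theorem IsDeriv.map_inv {δ : S →+ S} (hδ : IsDeriv δ) {x y : S} (hxy : x * y = 1)
    (hyx : y * x = 1) : δ y = -(y * δ x * y) := by
  have h1 := hδ y x
  rw [hyx, hδ.map_one] at h1
  have h2 : δ y * x * y + y * δ x * y = 0 := by rw [← add_mul, ← h1, zero_mul]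
  rw [mul_assoc (δ y), hxy, mul_one] at h2
  exact eq_neg_of_add_eq_zero_left h2

/-- The general Leibniz rule. -/
theorem IsDeriv.iterate_mul {δ : S →+ S} (hδ : IsDeriv δ) (n : ℕ) (x y : S) :
    δ^[n] (x * y) = ∑ b ∈ Finset.range (n + 1), n.choose b • (δ^[n - b] x * δ^[b] y) := by
  induction n with
  | zero => simp
  | succ n ih =>
    have h1 : δ^[n + 1] (x * y) = ∑ b ∈ Finset.range (n + 1), (n.choose b •
        (δ^[n + 1 - b] x * δ^[b] y) + n.choose b • (δ^[n - b] x * δ^[b + 1] y)) := by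
      rw [Function.iterate_succ_apply', ih, map_sum]
      refine Finset.sum_congr rfl fun b hb => ?_
      have hb' : n + 1 - b = n - b + 1 := by
        have := Finset.mem_range.1 hb
        omega
      rw [map_nsmul, hδ, smul_add, hb', Function.iterate_succ_apply', Function.iterate_succ_apply']
    have h2 : ∑ b ∈ Finset.range (n + 1 + 1), (n + 1).choose b • (δ^[n + 1 - b] x * δ^[b] y) =
        ∑ b ∈ Finset.range (n + 1), (n.choose b • (δ^[n - b] x * δ^[b + 1] y) +
          n.choose (b + 1) • (δ^[n - b] x * δ^[b + 1] y)) + δ^[n + 1] x * y := by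
      rw [Finset.sum_range_succ' _ (n + 1)]
      congr 1
      · refine Finset.sum_congr rfl fun b _ => ?_
        rw [Nat.choose_succ_succ, add_smul, Nat.add_sub_add_right]
      · simp
    rw [h1, h2, Finset.sum_add_distrib, Finset.sum_add_distrib,
      Finset.sum_range_succ (fun b => n.choose (b + 1) • (δ^[n - b] x * δ^[b + 1] y)),
      Finset.sum_range_succ' (fun b => n.choose b • (δ^[n + 1 - b] x * δ^[b] y))]
    simp
    abel

theorem IsDeriv.iterate_mul_of_left {δ : S →+ S} (hδ : IsDeriv δ) {x : S} (hx : δ x = 0)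
    (n : ℕ) (y : S) : δ^[n] (x * y) = x * δ^[n] y := by
  induction n with
  | zero => rfl
  | succ n ih =>
    rw [Function.iterate_succ_apply', ih, hδ, hx, zero_mul, zero_add, Function.iterate_succ_apply']

theorem IsDeriv.iterate_mul_of_right {δ : S →+ S} (hδ : IsDeriv δ) {y : S} (hy : δ y = 0)
    (n : ℕ) (x : S) : δ^[n] (x * y) = δ^[n] x * y := by
  induction n with
  | zero => rfl
  | succ n ih =>
    rw [Function.iterate_succ_apply', ih, hδ, hy, mul_zero, add_zero, Function.iterate_succ_apply']

/-! ### Curvature of a connection matrix -/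

/-- The covariant derivative `δ X - Γ X + X Γ`. -/
def covDeriv (δ : S →+ S) (Γ X : S) : S := δ X - Γ * X + X * Γ

/-- How a second derivation acts on the iterated covariant derivatives `δ^j H · H⁻¹` of a frame:
the result is expressed through the covariant derivatives of the curvature. -/
theorem curvature_expansion {δ D : S →+ S} (hδ : IsDeriv δ) (hD : IsDeriv D)
    (hc : ∀ x, D (δ x) = δ (D x)) {H G : S} (hHG : H * G = 1) (hGH : G * H = 1) (j : ℕ) :
    D (δ^[j] H * G) = ∑ i ∈ Finset.range j, j.choose (i + 1) •
      (δ^[j - 1 - i] H * G * (covDeriv δ (δ H * G))^[i] (D (δ H * G))) := by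
  set Γ : ℕ → S := fun j => δ^[j] H * G with hΓ
  set κ : ℕ → S := fun i => (covDeriv δ (δ H * G))^[i] (D (δ H * G)) with hκ
  have hΓ1 : δ H * G = Γ 1 := rfl
  -- The correction `Γ j * Γ 1` compensates the derivative `δ G = -(G * δ H * G)` of the inverse.
  have hΓs (j : ℕ) : Γ (j + 1) = δ (Γ j) + Γ j * Γ 1 := by
    simp only [hΓ, Function.iterate_succ_apply', hδ _ G, hδ.map_inv hHG hGH, Function.iterate_zero,
      id]
    have : δ^[j] H * G * (δ H * G) = δ^[j] H * (G * δ H * G) := by simp only [mul_assoc]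
    rw [this, mul_neg]
    abel
  have hκs (i : ℕ) : δ (κ i) = κ (i + 1) + Γ 1 * κ i - κ i * Γ 1 := by
    have : κ (i + 1) = δ (κ i) - Γ 1 * κ i + κ i * Γ 1 := by
      simp only [hκ, Function.iterate_succ_apply']
      rfl
    rw [this]
    abel
  -- The operator `X ↦ δ X + X Γ_1` acts like a derivation that raises the index of either factor by
  -- one, so iterating it produces binomial coefficients.
  have hL (a i : ℕ) : δ (Γ a * κ i) + Γ a * κ i * Γ 1 = Γ (a + 1) * κ i + Γ a * κ (i + 1) := by
    rw [hδ (Γ a) (κ i), hκs, hΓs a]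
    noncomm_ring
  change D (Γ j) = ∑ i ∈ Finset.range j, j.choose (i + 1) • (Γ (j - 1 - i) * κ i)
  induction j with
  | zero => simp [hΓ, hHG, hD.map_one]
  | succ j ih =>
    have h0 : D (Γ (j + 1)) = δ (D (Γ j)) + D (Γ j) * Γ 1 + Γ j * κ 0 := by
      rw [hΓs j, map_add, hc, hD (Γ j) (Γ 1), ← add_assoc]
      rfl
    have h1 : δ (D (Γ j)) + D (Γ j) * Γ 1 = ∑ i ∈ Finset.range j,
        (j.choose (i + 1) • (Γ (j - i) * κ i) + j.choose (i + 1) • (Γ (j - 1 - i) * κ (i + 1))) := by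
      rw [ih, map_sum, Finset.sum_mul, ← Finset.sum_add_distrib]
      refine Finset.sum_congr rfl fun i hi => ?_
      have hi' : j - i = j - 1 - i + 1 := by
        have := Finset.mem_range.1 hi
        omega
      rw [map_nsmul, smul_mul_assoc, ← smul_add, hL, smul_add, hi']
    -- Pascal's rule splits the coefficients for `j + 1`. The extra term `Γ j * κ 0` supplies the
    -- summand `j.choose 0` that the shifted sum lacks.
    rw [h0, h1, Finset.sum_congr rfl (s₁ := Finset.range (j + 1)) (g := fun i =>
      j.choose i • (Γ (j - i) * κ i) + j.choose (i + 1) • (Γ (j - i) * κ i)),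
      Finset.sum_add_distrib, Finset.sum_add_distrib,
      Finset.sum_range_succ (fun i => j.choose (i + 1) • (Γ (j - i) * κ i)),
      Finset.sum_range_succ' (fun i => j.choose i • (Γ (j - i) * κ i))]
    · simp only [Nat.choose_succ_self, zero_smul, add_zero, Nat.choose_zero_right, one_smul,
        Nat.sub_zero]
      have : ∀ i, j - 1 - i = j - (i + 1) := fun i => by omega
      simp only [this]
      abel
    · intro i _
      rw [Nat.choose_succ_succ, add_smul, Nat.add_sub_cancel]

/-! ### Agreement of jets -/

/-- `x` and `x'` agree under `ev` together with their derivatives up to order `N`. -/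
def AgreeTo (D : S →+ S) (ev : S →+* T) (N : ℕ) (x x' : S) : Prop :=
  ∀ a ≤ N, ev (D^[a] x) = ev (D^[a] x')

variable {D : S →+ S} {ev : S →+* T} {N : ℕ} {x x' y y' : S}

theorem AgreeTo.mono {M : ℕ} (h : AgreeTo D ev N x x') (hM : M ≤ N) : AgreeTo D ev M x x' :=
  fun a ha => h a (ha.trans hM)

theorem agreeTo_zero : AgreeTo D ev 0 x x' ↔ ev x = ev x' := by
  simp [AgreeTo]

/-- Peeling off the value at order zero reduces products and inverses to one application of the
Leibniz rule and induction on `N`. -/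
theorem agreeTo_succ :
    AgreeTo D ev (N + 1) x x' ↔ ev x = ev x' ∧ AgreeTo D ev N (D x) (D x') := by
  constructor
  · intro h
    exact ⟨h 0 (by omega), fun a ha => by simpa using h (a + 1) (by omega)⟩
  · rintro ⟨h0, h1⟩ a ha
    cases a with
    | zero => exact h0
    | succ a => simpa using h1 a (by omega)

theorem AgreeTo.add (h : AgreeTo D ev N x x') (h' : AgreeTo D ev N y y') :
    AgreeTo D ev N (x + y) (x' + y') := fun a ha => by
  rw [iterate_map_add, iterate_map_add, map_add, map_add, h a ha, h' a ha]

theorem AgreeTo.neg (h : AgreeTo D ev N x x') : AgreeTo D ev N (-x) (-x') := fun a ha => by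
  have : ∀ z, D^[a] (-z) = -D^[a] z := fun z => by
    rw [eq_neg_iff_add_eq_zero, ← iterate_map_add, neg_add_cancel]
    clear * -
    induction a with
    | zero => rfl
    | succ a ih => rw [Function.iterate_succ_apply, map_zero, ih]
  rw [this, this, map_neg, map_neg, h a ha]

theorem AgreeTo.sub (h : AgreeTo D ev N x x') (h' : AgreeTo D ev N y y') :
    AgreeTo D ev N (x - y) (x' - y') := by
  simpa only [sub_eq_add_neg] using h.add h'.neg

theorem AgreeTo.refl (x : S) : AgreeTo D ev N x x := fun _ _ => rfl

theorem AgreeTo.nsmul (h : AgreeTo D ev N x x') (k : ℕ) : AgreeTo D ev N (k • x) (k • x') := by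
  induction k with
  | zero => simpa using AgreeTo.refl 0
  | succ k ih => simpa only [succ_nsmul] using ih.add h

theorem AgreeTo.sum {ι : Type*} {s : Finset ι} {f f' : ι → S}
    (h : ∀ i ∈ s, AgreeTo D ev N (f i) (f' i)) : AgreeTo D ev N (∑ i ∈ s, f i) (∑ i ∈ s, f' i) := by
  classical
  induction s using Finset.induction_on with
  | empty => simpa using AgreeTo.refl 0
  | insert i s hi ih =>
    rw [Finset.sum_insert hi, Finset.sum_insert hi]
    exact (h i (Finset.mem_insert_self _ _)).add
      (ih fun j hj => h j (Finset.mem_insert_of_mem hj))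

theorem AgreeTo.mul (hD : IsDeriv D) (h : AgreeTo D ev N x x') (h' : AgreeTo D ev N y y') :
    AgreeTo D ev N (x * y) (x' * y') := by
  induction N generalizing x x' y y' with
  | zero => rw [agreeTo_zero] at *; rw [map_mul, map_mul, h, h']
  | succ N ih =>
    have g := agreeTo_succ.1 h
    have g' := agreeTo_succ.1 h'
    refine agreeTo_succ.2 ⟨by rw [map_mul, map_mul, g.1, g'.1], ?_⟩
    rw [hD, hD]
    exact (ih g.2 (h'.mono N.le_succ)).add (ih (h.mono N.le_succ) g'.2)

/-- The values agree by uniqueness of inverses in `T`. For the higher orders, `D y = -(y * D x * y)`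
expresses the derivatives of `y` through those of `x` and lower ones of `y`. -/
theorem AgreeTo.inv (hD : IsDeriv D) (hxy : x * y = 1) (hyx : y * x = 1) (hxy' : x' * y' = 1)
    (hyx' : y' * x' = 1) (h : AgreeTo D ev N x x') : AgreeTo D ev N y y' := by
  have h0 : ev y = ev y' := by
    have h1 : ev x = ev x' := h 0 (Nat.zero_le _)
    have h2 : ev y * ev x = 1 := by rw [← map_mul, hyx, map_one]
    have h3 : ev x' * ev y' = 1 := by rw [← map_mul, hxy', map_one]
    rw [h1] at h2
    exact left_inv_eq_right_inv h2 h3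
  induction N with
  | zero => exact agreeTo_zero.2 h0
  | succ N ih =>
    refine agreeTo_succ.2 ⟨h0, ?_⟩
    have ih' := ih (h.mono N.le_succ)
    rw [hD.map_inv hxy hyx, hD.map_inv hxy' hyx']
    exact ((ih'.mul hD (agreeTo_succ.1 h).2).mul hD ih').neg

variable {δ D' : S →+ S} {H G H' G' : S}

/-- Covariant derivatives of curvatures agree if the connection data do. -/
theorem agreeTo_covDeriv_curvature (hδ : IsDeriv δ) (hD : IsDeriv D) (hD' : IsDeriv D')
    (hc : ∀ x, D' (δ x) = δ (D' x)) (hHG : H * G = 1) (hGH : G * H = 1) (hHG' : H' * G' = 1)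
    (hGH' : G' * H' = 1) {n : ℕ}
    (h1 : ∀ j ≤ n, AgreeTo D ev N (δ^[j] H * G) (δ^[j] H' * G'))
    (h2 : ∀ j ≤ n, AgreeTo D ev N (D' (δ^[j] H * G)) (D' (δ^[j] H' * G'))) (r : ℕ) (hr : r < n) :
    AgreeTo D ev N ((covDeriv δ (δ H * G))^[r] (D' (δ H * G)))
      ((covDeriv δ (δ H' * G'))^[r] (D' (δ H' * G'))) := by
  induction r using Nat.strong_induction_on with
  | _ r ih =>
    -- The expansion for `j = r + 1` is solved for its last term, whose coefficient is `(r +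
    -- 1).choose (r + 1) • (H * G) = 1`. The direction `D'` of the curvature is kept apart from the
    -- direction `D` in which agreement is measured, since both tangential and transversal curvature
    -- components are needed.
    have key {H G : S} (hHG : H * G = 1) (hGH : G * H = 1) :
        (covDeriv δ (δ H * G))^[r] (D' (δ H * G)) = D' (δ^[r + 1] H * G) -
        ∑ i ∈ Finset.range r, (r + 1).choose (i + 1) •
          (δ^[r - i] H * G * (covDeriv δ (δ H * G))^[i] (D' (δ H * G))) := by
      rw [curvature_expansion hδ hD' hc hHG hGH (r + 1), Finset.sum_range_succ]
      simp [hHG]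
    rw [key hHG hGH, key hHG' hGH']
    refine (h2 _ hr).sub (AgreeTo.sum fun i hi => AgreeTo.nsmul (AgreeTo.mul hD (h1 _ ?_) ?_) _)
    · omega
    · exact ih i (Finset.mem_range.1 hi) ((Finset.mem_range.1 hi).trans hr)

/-- Derivatives of connection data agree if curvatures and connection data of lower order do. -/
theorem agreeTo_deriv_connection (hδ : IsDeriv δ) (hD : IsDeriv D) (hD' : IsDeriv D')
    (hc : ∀ x, D' (δ x) = δ (D' x)) (hHG : H * G = 1) (hGH : G * H = 1) (hHG' : H' * G' = 1)
    (hGH' : G' * H' = 1) {j : ℕ}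
    (h1 : ∀ i < j, AgreeTo D ev N (δ^[i] H * G) (δ^[i] H' * G'))
    (h2 : ∀ r < j, AgreeTo D ev N ((covDeriv δ (δ H * G))^[r] (D' (δ H * G)))
      ((covDeriv δ (δ H' * G'))^[r] (D' (δ H' * G')))) :
    AgreeTo D ev N (D' (δ^[j] H * G)) (D' (δ^[j] H' * G')) := by
  rw [curvature_expansion hδ hD' hc hHG hGH, curvature_expansion hδ hD' hc hHG' hGH']
  refine AgreeTo.sum fun i hi => AgreeTo.nsmul (AgreeTo.mul hD (h1 _ ?_) (h2 _ ?_)) _ <;>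
  · have := Finset.mem_range.1 hi
    omega

/-- Agreement of the connection data to order `n` from that of the curvatures. -/
theorem agreeTo_connection_of_curvature (hδ : IsDeriv δ) (hD : IsDeriv D)
    (hc : ∀ x, D (δ x) = δ (D x)) (hHG : H * G = 1) (hGH : G * H = 1) (hHG' : H' * G' = 1)
    (hGH' : G' * H' = 1) {n : ℕ} (h1 : ∀ j ≤ n, ev (δ^[j] H * G) = ev (δ^[j] H' * G'))
    (h2 : ∀ r < n, ∀ t < n, ev (D^[t] ((covDeriv δ (δ H * G))^[r] (D (δ H * G)))) =
      ev (D^[t] ((covDeriv δ (δ H' * G'))^[r] (D (δ H' * G'))))) :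
    ∀ N ≤ n, ∀ j ≤ n, AgreeTo D ev N (δ^[j] H * G) (δ^[j] H' * G') := by
  intro N
  induction N with
  | zero => exact fun _ j hj => agreeTo_zero.2 (h1 j hj)
  | succ N ih =>
    intro hN j hj
    refine agreeTo_succ.2 ⟨h1 j hj, ?_⟩
    -- Order `N` for the `Γ_i` with `i < j` gives order `N` for `D Γ_j`, that is, order `N + 1` for
    -- `Γ_j`: each round gains one `D`.
    refine agreeTo_deriv_connection hδ hD hD hc hHG hGH hHG' hGH' (fun i hi => ih (by omega) i
      (by omega)) fun r hr a ha => h2 r (by omega) a (by omega)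

/-! ### Change of frame -/

variable {A B C : S}

/-- Here `As` stands for the conjugate transpose of a holomorphic `A`. It is constant for `δ = ∂_z`,
so it cancels against its inverse and the usual gauge law remains. -/
theorem connection_change_frame {As Bs : S} (hδ : IsDeriv δ) (hHG : H * G = 1) (hABs : As * Bs = 1)
    (hs : δ As = 0) :
    δ (A * H * As) * (Bs * G * B) = δ A * B + A * (δ H * G) * B := by
  have h1 : δ (A * H * As) = (δ A * H + A * δ H) * As := by rw [hδ, hs, hδ, mul_zero, add_zero]
  have h2 : (δ A * H + A * δ H) * As * (Bs * G * B) =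
      (δ A * H + A * δ H) * (As * Bs) * G * B := by simp only [mul_assoc]
  rw [h1, h2, hABs, mul_one, add_mul, mul_assoc _ H, hHG, mul_one, add_mul, mul_assoc A]

/-- The inhomogeneous term `δ A * B` of the gauge law is holomorphic and is killed by `D = ∂_{z̄}`;
thus curvature is a tensor. -/
theorem curvature_change_frame (hD : IsDeriv D) (hc : ∀ x, D (δ x) = δ (D x))
    (hAB : A * B = 1) (hBA : B * A = 1) (hA : D A = 0) (X : S) :
    D (δ A * B + A * X * B) = A * D X * B := by
  have hB : D B = 0 := by rw [hD.map_inv hAB hBA, hA, mul_zero, zero_mul, neg_zero]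
  rw [map_add, hD, hc, hA, hB, hD, hD, hA, hB]
  simp

/-- The derivatives of the outer factors `A` and `B` cancel against the commutator with the
inhomogeneous term `δ A * B`. -/
theorem covDeriv_change_frame (hδ : IsDeriv δ) (hAB : A * B = 1) (hBA : B * A = 1) (Γ X : S) :
    covDeriv δ (δ A * B + A * Γ * B) (A * X * B) = A * covDeriv δ Γ X * B := by
  have hBA' (z : S) : B * (A * z) = z := by rw [← mul_assoc, hBA, one_mul]
  rw [covDeriv, hδ (A * X) B, hδ A X, hδ.map_inv hAB hBA]
  simp only [covDeriv, mul_add, add_mul, mul_sub, sub_mul, mul_assoc, hBA', mul_neg]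
  abel

theorem iterate_covDeriv_change_frame (hδ : IsDeriv δ) (hAB : A * B = 1) (hBA : B * A = 1)
    (Γ X : S) (r : ℕ) :
    (covDeriv δ (δ A * B + A * Γ * B))^[r] (A * X * B) = A * (covDeriv δ Γ)^[r] X * B := by
  induction r with
  | zero => rfl
  | succ r ih => rw [Function.iterate_succ_apply', ih, covDeriv_change_frame hδ hAB hBA,
      Function.iterate_succ_apply']

end Derivations

/-! ### The algebra of smooth functions on an open subset of `ℂ^d` -/

section SmoothFunctions

open Topology

variable {d : ℕ} {V : Opens (Fin d → ℂ)}

theorem extendZero_apply (f : V → ℂ) (x : V) : extendZero f x.1 = f x :=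
  Subtype.val_injective.extend_apply _ _ _

/-- Because `V` is open, germs at its points ignore the extension; each derivative below is computed
by exchanging the zero extension for a convenient `F`. -/
theorem extendZero_eventuallyEq {f : V → ℂ} {F : (Fin d → ℂ) → ℂ} (h : ∀ y : V, f y = F y.1)
    (x : V) : extendZero f =ᶠ[𝓝 x.1] F := by
  filter_upwards [V.isOpen.mem_nhds x.2] with y hy
  rw [← h ⟨y, hy⟩, ← extendZero_apply f ⟨y, hy⟩]

/-- The function `f` on the open set `V` is smooth. -/
def IsSmooth (f : V → ℂ) : Prop := ∀ x : V, ContDiffAt ℝ ∞ (extendZero f) x.1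

theorem IsSmooth.of_eq {f : V → ℂ} {F : (Fin d → ℂ) → ℂ} (h : ∀ y : V, f y = F y.1)
    (hF : ∀ x : V, ContDiffAt ℝ ∞ F x.1) : IsSmooth f := fun x =>
  (hF x).congr_of_eventuallyEq (extendZero_eventuallyEq h x)

variable (V) in
/-- The algebra of smooth complex-valued functions on `V`. -/
def smoothFun : Subalgebra ℂ (V → ℂ) where
  carrier := {f | IsSmooth f}
  mul_mem' {f g} hf hg := IsSmooth.of_eq (F := fun x => extendZero f x * extendZero g x)
    (fun y => by rw [extendZero_apply, extendZero_apply]; rfl) fun x => (hf x).mul (hg x)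
  add_mem' {f g} hf hg := IsSmooth.of_eq (F := fun x => extendZero f x + extendZero g x)
    (fun y => by rw [extendZero_apply, extendZero_apply]; rfl) fun x => (hf x).add (hg x)
  algebraMap_mem' c := IsSmooth.of_eq (F := fun _ => c) (fun _ => rfl) fun _ => contDiffAt_const

theorem differentiableAt_extendZero (f : smoothFun V) (x : V) :
    DifferentiableAt ℝ (extendZero f.1) x.1 :=
  (f.2 x).differentiableAt (by simp)

/-- Evaluation of smooth functions at a point. -/
def evalAt (x : V) : smoothFun V →+* ℂ where
  toFun f := f.1 x
  map_one' := rfl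
  map_mul' _ _ := rfl
  map_zero' := rfl
  map_add' _ _ := rfl

theorem evalAt_apply (x : V) (f : smoothFun V) : evalAt x f = f.1 x := rfl

theorem smoothFun.ext_evalAt {f g : smoothFun V} (h : ∀ x, evalAt x f = evalAt x g) : f = g :=
  Subtype.ext (funext h)

theorem fderiv_extendZero_add (f g : smoothFun V) (x : V) :
    fderiv ℝ (extendZero (f + g).1) x.1 =
      fderiv ℝ (extendZero f.1) x.1 + fderiv ℝ (extendZero g.1) x.1 := by
  rw [← fderiv_add (differentiableAt_extendZero f x) (differentiableAt_extendZero g x)]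
  refine (extendZero_eventuallyEq (fun y => ?_) x).fderiv_eq
  rw [Pi.add_apply, extendZero_apply, extendZero_apply]
  rfl

theorem fderiv_extendZero_smul (c : ℂ) (f : smoothFun V) (x : V) :
    fderiv ℝ (extendZero (c • f).1) x.1 = c • fderiv ℝ (extendZero f.1) x.1 := by
  rw [← fderiv_const_smul (differentiableAt_extendZero f x) c]
  refine (extendZero_eventuallyEq (fun y => ?_) x).fderiv_eq
  rw [Pi.smul_apply, extendZero_apply]
  rfl

/-- The real derivative in the direction `v`. -/
def dirDeriv (v : Fin d → ℂ) : smoothFun V →ₗ[ℂ] smoothFun V where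
  toFun f := ⟨fun x => fderiv ℝ (extendZero f.1) x.1 v,
    IsSmooth.of_eq (F := fun x => fderiv ℝ (extendZero f.1) x v) (fun _ => rfl) fun x =>
      ((f.2 x).fderiv_right (m := ∞) (by simp)).clm_apply contDiffAt_const⟩
  map_add' f g := by
    ext x
    change fderiv ℝ (extendZero (f + g).1) x.1 v = _
    rw [fderiv_extendZero_add]
    rfl
  map_smul' c f := by
    ext x
    change fderiv ℝ (extendZero (c • f).1) x.1 v = _
    rw [fderiv_extendZero_smul]
    rfl

theorem dirDeriv_apply (v : Fin d → ℂ) (f : smoothFun V) (x : V) :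
    (dirDeriv v f).1 x = fderiv ℝ (extendZero f.1) x.1 v := rfl

theorem dirDeriv_mul (v : Fin d → ℂ) (f g : smoothFun V) :
    dirDeriv v (f * g) = dirDeriv v f * g + f * dirDeriv v g := by
  ext x
  have h1 : fderiv ℝ (extendZero (f * g).1) x.1 =
      fderiv ℝ (fun y => extendZero f.1 y * extendZero g.1 y) x.1 := by
    refine (extendZero_eventuallyEq (fun y => ?_) x).fderiv_eq
    rw [extendZero_apply, extendZero_apply]
    rfl
  change fderiv ℝ (extendZero (f * g).1) x.1 v =
    fderiv ℝ (extendZero f.1) x.1 v * g.1 x + f.1 x * fderiv ℝ (extendZero g.1) x.1 v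
  rw [h1, fderiv_fun_mul (differentiableAt_extendZero f x) (differentiableAt_extendZero g x), extendZero_apply,
    extendZero_apply]
  simp
  ring

theorem dirDeriv_comm (v w : Fin d → ℂ) (f : smoothFun V) :
    dirDeriv v (dirDeriv w f) = dirDeriv w (dirDeriv v f) := by
  have key (v w : Fin d → ℂ) (x : V) : (dirDeriv v (dirDeriv w f)).1 x =
      fderiv ℝ (fderiv ℝ (extendZero f.1)) x.1 v w := by
    have h1 : fderiv ℝ (extendZero (dirDeriv w f).1) x.1 =
        fderiv ℝ (fun y => fderiv ℝ (extendZero f.1) y w) x.1 :=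
      (extendZero_eventuallyEq (F := fun y => fderiv ℝ (extendZero f.1) y w) (fun y => rfl) x).fderiv_eq
    have h2 : DifferentiableAt ℝ (fderiv ℝ (extendZero f.1)) x.1 :=
      ((f.2 x).fderiv_right (m := ∞) (by simp)).differentiableAt (by simp)
    rw [dirDeriv_apply, h1, fderiv_clm_apply h2 (differentiableAt_const w)]
    simp
  ext x
  rw [key, key]
  have h3 : IsSymmSndFDerivAt ℝ (extendZero f.1) x.1 := (f.2 x).isSymmSndFDerivAt (by
    rw [minSmoothness_of_isRCLikeNormedField]
    exact WithTop.coe_le_coe.2 le_top)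
  exact h3 v w

/-- The operator `(∂/∂x_i + c ∂/∂y_i) / 2`. -/
def wirtinger (c : ℂ) (i : Fin d) : smoothFun V →+ smoothFun V where
  toFun f := (1 / 2 : ℂ) • (dirDeriv (Pi.single i 1) f + c • dirDeriv (Pi.single i Complex.I) f)
  map_zero' := by simp
  map_add' f g := by
    simp only [map_add, smul_add]
    abel

theorem wirtinger_apply (c : ℂ) (i : Fin d) (f : smoothFun V) : wirtinger c i f =
    (1 / 2 : ℂ) • (dirDeriv (Pi.single i 1) f + c • dirDeriv (Pi.single i Complex.I) f) := rfl

theorem wirtinger_mul (c : ℂ) (i : Fin d) (f g : smoothFun V) :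
    wirtinger c i (f * g) = wirtinger c i f * g + f * wirtinger c i g := by
  simp only [wirtinger_apply, dirDeriv_mul, smul_add, add_mul, mul_add, smul_mul_assoc,
    mul_smul_comm]
  abel

theorem wirtinger_comm (c c' : ℂ) (i j : Fin d) (f : smoothFun V) :
    wirtinger c i (wirtinger c' j f) = wirtinger c' j (wirtinger c i f) := by
  simp only [wirtinger_apply, map_add, map_smul, smul_add,
    dirDeriv_comm (Pi.single j 1) (Pi.single i 1),
    dirDeriv_comm (Pi.single j 1) (Pi.single i Complex.I),
    dirDeriv_comm (Pi.single j Complex.I) (Pi.single i 1),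
    dirDeriv_comm (Pi.single j Complex.I) (Pi.single i Complex.I), smul_smul]
  rw [show (1 / 2 : ℂ) * (c * (1 / 2)) = 1 / 2 * (1 / 2 * c) by ring,
    show (1 / 2 : ℂ) * (c' * (1 / 2)) = 1 / 2 * (1 / 2 * c') by ring,
    show (1 / 2 : ℂ) * (c * (1 / 2 * c')) = 1 / 2 * (c' * (1 / 2 * c)) by ring]
  abel

/-- `∂/∂z_i` on smooth functions. -/
def dzS (i : Fin d) : smoothFun V →+ smoothFun V := wirtinger (-Complex.I) i

/-- `∂/∂z̄_i` on smooth functions. -/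
def dzbarS (i : Fin d) : smoothFun V →+ smoothFun V := wirtinger Complex.I i

theorem dzS_apply (i : Fin d) (f : smoothFun V) (x : V) : (dzS i f).1 x = dz i f.1 x := by
  change (1 / 2 : ℂ) * (fderiv ℝ (extendZero f.1) x.1 (Pi.single i 1) +
    -Complex.I * fderiv ℝ (extendZero f.1) x.1 (Pi.single i Complex.I)) = _
  rw [dz]
  ring

theorem dzbarS_apply (i : Fin d) (f : smoothFun V) (x : V) :
    (dzbarS i f).1 x = dzbar i f.1 x := rfl

/-- If `g` is the conjugate of `f`, then `∂g/∂z̄_i` is the conjugate of `∂f/∂z_i`. -/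
theorem dzbarS_conj {f g : smoothFun V} (h : ∀ x, g.1 x = conj (f.1 x)) (i : Fin d) (x : V) :
    (dzbarS i g).1 x = conj ((dzS i f).1 x) := by
  have h1 : fderiv ℝ (extendZero g.1) x.1 =
      fderiv ℝ ((Complex.conjCLE : ℂ →L[ℝ] ℂ) ∘ extendZero f.1) x.1 := by
    refine (extendZero_eventuallyEq (fun y => ?_) x).fderiv_eq
    rw [h, Function.comp_apply, extendZero_apply]
    rfl
  have h2 (v) : fderiv ℝ (extendZero g.1) x.1 v = conj (fderiv ℝ (extendZero f.1) x.1 v) := by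
    rw [h1, ((Complex.conjCLE : ℂ →L[ℝ] ℂ).hasFDerivAt.comp x.1
      (differentiableAt_extendZero f x).hasFDerivAt).fderiv]
    rfl
  rw [dzbarS_apply, dzS_apply, dzbar, dz, h2, h2]
  simp [Complex.conj_ofNat]

theorem iterate_dzbarS_conj {f g : smoothFun V} (h : ∀ x, g.1 x = conj (f.1 x)) (i : Fin d)
    (k : ℕ) (x : V) : ((dzbarS i)^[k] g).1 x = conj (((dzS i)^[k] f).1 x) := by
  induction k generalizing f g with
  | zero => exact h x
  | succ k ih => exact ih (dzbarS_conj h i)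

/-- Derivatives may be computed after restriction to a smaller open set. -/
theorem fderiv_extendZero_restrict {Ω : Opens (Fin d → ℂ)} {f : Ω → ℂ} {g : V → ℂ}
    (hV : ∀ x ∈ V, x ∈ Ω) (h : ∀ x : V, f ⟨x.1, hV _ x.2⟩ = g x) (x : V) :
    fderiv ℝ (extendZero f) x.1 = fderiv ℝ (extendZero g) x.1 :=
  (extendZero_eventuallyEq (F := extendZero f)
    (fun y => by rw [← h y, ← extendZero_apply f ⟨y.1, hV _ y.2⟩]) x).fderiv_eq.symm

theorem dz_restrict {Ω : Opens (Fin d → ℂ)} {f : Ω → ℂ} {g : V → ℂ}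
    (hV : ∀ x ∈ V, x ∈ Ω) (h : ∀ x : V, f ⟨x.1, hV _ x.2⟩ = g x) (i : Fin d) (x : V) :
    dz i f ⟨x.1, hV _ x.2⟩ = dz i g x := by
  simp only [dz, fderiv_extendZero_restrict hV h x]

theorem dzbar_restrict {Ω : Opens (Fin d → ℂ)} {f : Ω → ℂ} {g : V → ℂ}
    (hV : ∀ x ∈ V, x ∈ Ω) (h : ∀ x : V, f ⟨x.1, hV _ x.2⟩ = g x) (i : Fin d) (x : V) :
    dzbar i f ⟨x.1, hV _ x.2⟩ = dzbar i g x := by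
  simp only [dzbar, fderiv_extendZero_restrict hV h x]

theorem dzbarS_eq_zero_of_differentiableAt {f : smoothFun V} {x : V}
    (h : DifferentiableAt ℂ (extendZero f.1) x.1) (i : Fin d) : (dzbarS i f).1 x = 0 := by
  rw [dzbarS_apply, dzbar, h.fderiv_restrictScalars ℝ]
  have : (Pi.single i Complex.I : Fin d → ℂ) = Complex.I • Pi.single i 1 := by
    rw [← Pi.single_smul]
    simp
  rw [this, ContinuousLinearMap.coe_restrictScalars', map_smul, smul_eq_mul, ← mul_assoc,
    Complex.I_mul_I]
  ring

/-- The Cauchy-Riemann equations characterize holomorphic functions. -/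
theorem differentiableAt_of_dzbarS_eq_zero {f : smoothFun V} {x : V}
    (h : ∀ i, (dzbarS i f).1 x = 0) : DifferentiableAt ℂ (extendZero f.1) x.1 := by
  rw [differentiableAt_iff_restrictScalars ℝ (differentiableAt_extendZero f x)]
  set L := fderiv ℝ (extendZero f.1) x.1
  have hI (i : Fin d) : L (Pi.single i Complex.I) = Complex.I * L (Pi.single i 1) := by
    have h1 := h i
    rw [dzbarS_apply, dzbar] at h1
    have h2 : L (Pi.single i 1) + Complex.I * L (Pi.single i Complex.I) = 0 := by
      simpa using h1
    linear_combination (-Complex.I) * h2 + L (Pi.single i Complex.I) * Complex.I_mul_I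
  -- The complex linear map with the same values as `L` on the unit vectors. By `hI` it also agrees
  -- with `L` on their multiples by `I`, hence on a real basis.
  refine ⟨∑ i, (ContinuousLinearMap.proj i : (Fin d → ℂ) →L[ℂ] ℂ).smulRight (L (Pi.single i 1)), ?_⟩
  ext v
  have h3 : v = ∑ i, ((v i).re • (Pi.single i 1 : Fin d → ℂ) +
      (v i).im • (Pi.single i Complex.I : Fin d → ℂ)) := by
    ext j
    simp [Finset.sum_apply, Pi.single_apply, Finset.sum_add_distrib]
  conv_rhs => rw [h3]
  simp only [map_sum, map_add, map_smul, hI]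
  simp only [ContinuousLinearMap.coe_restrictScalars', _root_.sum_apply,
    ContinuousLinearMap.smulRight_apply, ContinuousLinearMap.proj_apply]
  refine Finset.sum_congr rfl fun i _ => ?_
  conv_lhs => rw [← Complex.re_add_im (v i)]
  simp only [smul_eq_mul, Complex.real_smul]
  ring

/-! ### Restriction to the hypersurface -/

variable {m : ℕ} {V' : Opens (Fin (m + 1) → ℂ)} {W : Opens (Fin m → ℂ)}

/-- The embedding `w ↦ (0, w)` as a continuous linear map. -/
def consZero (m : ℕ) : (Fin m → ℂ) →L[ℝ] (Fin (m + 1) → ℂ) :=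
  LinearMap.toContinuousLinearMap
    { toFun := fun w => Fin.cons 0 w
      map_add' := fun v w => by
        ext i
        refine Fin.cases ?_ (fun j => ?_) i <;> simp
      map_smul' := fun c w => by
        ext i
        refine Fin.cases ?_ (fun j => ?_) i <;> simp }

theorem consZero_apply (w : Fin m → ℂ) : consZero m w = Fin.cons 0 w := rfl

theorem consZero_single (j : Fin m) (c : ℂ) : consZero m (Pi.single j c) = Pi.single j.succ c := by
  ext i
  rw [consZero_apply]
  refine Fin.cases ?_ (fun k => ?_) i
  · simp [(Fin.succ_ne_zero j).symm]
  · simp [Pi.single_apply]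

/-- The restriction of a smooth function to the hypersurface. -/
def restrictZ (hW : ∀ w ∈ W, (Fin.cons 0 w : Fin (m + 1) → ℂ) ∈ V') (f : smoothFun V') :
    smoothFun W :=
  ⟨fun w => f.1 (zPoint hW w), IsSmooth.of_eq (F := fun w => extendZero f.1 (consZero m w))
    (fun w => (extendZero_apply f.1 (zPoint hW w)).symm) fun w =>
      ContDiffAt.comp w.1 (f := consZero m) (f.2 (zPoint hW w)) (consZero m).contDiff.contDiffAt⟩

theorem dirDeriv_restrictZ (hW : ∀ w ∈ W, (Fin.cons 0 w : Fin (m + 1) → ℂ) ∈ V')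
    (f : smoothFun V') (v : Fin m → ℂ) (w : W) :
    fderiv ℝ (extendZero (restrictZ hW f).1) w.1 v =
      fderiv ℝ (extendZero f.1) (zPoint hW w).1 (consZero m v) := by
  have h1 : fderiv ℝ (extendZero (restrictZ hW f).1) w.1 =
      fderiv ℝ (extendZero f.1 ∘ consZero m) w.1 :=
    (extendZero_eventuallyEq (fun w => (extendZero_apply f.1 (zPoint hW w)).symm) w).fderiv_eq
  rw [h1, fderiv_comp w.1 (differentiableAt_extendZero f (zPoint hW w)) (consZero m).differentiableAt,
    ContinuousLinearMap.fderiv]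
  rfl

/-- The index shift `j ↦ j.succ` reflects that the embedding sends the `j`-th coordinate direction
to the `j.succ`-th. This is why tangential derivatives cost no order of agreement. -/
theorem dzbarS_restrictZ (hW : ∀ w ∈ W, (Fin.cons 0 w : Fin (m + 1) → ℂ) ∈ V')
    (f : smoothFun V') (j : Fin m) (w : W) :
    (dzbarS j (restrictZ hW f)).1 w = (dzbarS j.succ f).1 (zPoint hW w) := by
  rw [dzbarS_apply, dzbarS_apply, dzbar, dzbar, dirDeriv_restrictZ, dirDeriv_restrictZ,
    consZero_single, consZero_single]

end SmoothFunctions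

/-! ### Matrices of smooth functions -/

section SmoothMatrices

open Topology

variable {d l : ℕ} {V : Opens (Fin d → ℂ)}

theorem isDeriv_mapMatrix {R : Type*} [CommRing R] {δ : R →+ R}
    (hδ : ∀ x y, δ (x * y) = δ x * y + x * δ y) :
    IsDeriv (δ.mapMatrix : Matrix (Fin l) (Fin l) R →+ Matrix (Fin l) (Fin l) R) := by
  intro X Y
  ext p q : 2
  simp [Matrix.mul_apply, hδ, Finset.sum_add_distrib]

theorem iterate_mapMatrix {R : Type*} [CommRing R] (δ : R →+ R) (k : ℕ)
    (X : Matrix (Fin l) (Fin l) R) (p q : Fin l) : δ.mapMatrix^[k] X p q = δ^[k] (X p q) := by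
  induction k generalizing X with
  | zero => rfl
  | succ k ih => exact ih _

/-- Entrywise `∂/∂z_i` on matrices of smooth functions. -/
def dzM (i : Fin d) : Matrix (Fin l) (Fin l) (smoothFun V) →+ Matrix (Fin l) (Fin l) (smoothFun V) :=
  (dzS i).mapMatrix

/-- Entrywise `∂/∂z̄_i` on matrices of smooth functions. -/
def dzbarM (i : Fin d) :
    Matrix (Fin l) (Fin l) (smoothFun V) →+ Matrix (Fin l) (Fin l) (smoothFun V) :=
  (dzbarS i).mapMatrix

theorem isDeriv_dzM (i : Fin d) : IsDeriv (dzM i : Matrix (Fin l) (Fin l) (smoothFun V) →+ _) :=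
  isDeriv_mapMatrix (wirtinger_mul _ i)

theorem isDeriv_dzbarM (i : Fin d) :
    IsDeriv (dzbarM i : Matrix (Fin l) (Fin l) (smoothFun V) →+ _) :=
  isDeriv_mapMatrix (wirtinger_mul _ i)

theorem dzbarM_dzM_comm (i j : Fin d) (X : Matrix (Fin l) (Fin l) (smoothFun V)) :
    dzbarM i (dzM j X) = dzM j (dzbarM i X) := by
  refine Matrix.ext fun p q => ?_
  exact wirtinger_comm _ _ i j _

theorem iterate_dzM_apply (i : Fin d) (k : ℕ) (X : Matrix (Fin l) (Fin l) (smoothFun V))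
    (p q : Fin l) : (dzM i)^[k] X p q = (dzS i)^[k] (X p q) := iterate_mapMatrix _ k X p q

theorem iterate_dzbarM_apply (i : Fin d) (k : ℕ) (X : Matrix (Fin l) (Fin l) (smoothFun V))
    (p q : Fin l) : (dzbarM i)^[k] X p q = (dzbarS i)^[k] (X p q) := iterate_mapMatrix _ k X p q

theorem iterate_dzbarM_iterate_dzM_comm (i j : Fin d) (a b : ℕ)
    (X : Matrix (Fin l) (Fin l) (smoothFun V)) :
    (dzbarM i)^[a] ((dzM j)^[b] X) = (dzM j)^[b] ((dzbarM i)^[a] X) :=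
  (Function.Commute.iterate_iterate (f := dzbarM i) (g := dzM j)
    (fun X => dzbarM_dzM_comm i j X) a b) X

/-- Evaluation of matrices of smooth functions at a point. -/
def evalMat (x : V) : Matrix (Fin l) (Fin l) (smoothFun V) →+* Matrix (Fin l) (Fin l) ℂ :=
  (evalAt x).mapMatrix

theorem evalMat_apply (x : V) (X : Matrix (Fin l) (Fin l) (smoothFun V)) (p q : Fin l) :
    evalMat x X p q = (X p q).1 x := rfl

theorem ext_evalMat {X Y : Matrix (Fin l) (Fin l) (smoothFun V)}
    (h : ∀ x, evalMat x X = evalMat x Y) : X = Y := by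
  refine Matrix.ext fun p q => ?_
  exact smoothFun.ext_evalAt fun x => congrFun (congrFun (h x) p) q

theorem isUnit_smoothFun {f : smoothFun V} (h : ∀ x, f.1 x ≠ 0) : IsUnit f := by
  refine isUnit_iff_exists_inv.2 ⟨⟨fun x => (f.1 x)⁻¹, IsSmooth.of_eq
    (F := fun x => (extendZero f.1 x)⁻¹) (fun y => by rw [extendZero_apply]) fun x =>
      (f.2 x).inv (by rw [extendZero_apply]; exact h x)⟩, ?_⟩
  ext x
  exact mul_inv_cancel₀ (h x)

theorem isUnit_of_evalMat {X : Matrix (Fin l) (Fin l) (smoothFun V)}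
    (h : ∀ x, IsUnit (evalMat x X)) : IsUnit X := by
  rw [Matrix.isUnit_iff_isUnit_det]
  refine isUnit_smoothFun fun x => ?_
  have h1 : (evalMat x X).det = X.det.1 x := ((evalAt x).map_det X).symm
  rw [← h1]
  exact ((Matrix.isUnit_iff_isUnit_det _).1 (h x)).ne_zero

/-! ### Representing functions on a larger set -/

variable {Ω : Opens (Fin d → ℂ)} {hV : ∀ x ∈ V, x ∈ Ω}

/-- The matrix `X` of smooth functions is the restriction of `F` to `V`. -/
def Represents (hV : ∀ x ∈ V, x ∈ Ω) (F : Ω → Matrix (Fin l) (Fin l) ℂ)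
    (X : Matrix (Fin l) (Fin l) (smoothFun V)) : Prop :=
  ∀ x : V, F ⟨x.1, hV _ x.2⟩ = evalMat x X

variable {F F' : Ω → Matrix (Fin l) (Fin l) ℂ} {X X' : Matrix (Fin l) (Fin l) (smoothFun V)}

theorem Represents.dzMat (h : Represents hV F X) (i : Fin d) :
    Represents hV (dzMat i F) (dzM i X) := by
  intro x
  ext p q
  rw [evalMat_apply]
  change dz i _ _ = (dzS i (X p q)).1 x
  rw [dzS_apply]
  exact dz_restrict hV (fun y => congrFun (congrFun (h y) p) q) i x

theorem Represents.dzbarMat (h : Represents hV F X) (i : Fin d) :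
    Represents hV (dzbarMat i F) (dzbarM i X) := by
  intro x
  ext p q
  rw [evalMat_apply]
  change dzbar i _ _ = (dzbarS i (X p q)).1 x
  rw [dzbarS_apply]
  exact dzbar_restrict hV (fun y => congrFun (congrFun (h y) p) q) i x

theorem Represents.iterate {φ : (Ω → Matrix (Fin l) (Fin l) ℂ) → Ω → Matrix (Fin l) (Fin l) ℂ}
    {ψ : Matrix (Fin l) (Fin l) (smoothFun V) → Matrix (Fin l) (Fin l) (smoothFun V)}
    (hφ : ∀ F X, Represents hV F X → Represents hV (φ F) (ψ X)) (h : Represents hV F X) (k : ℕ) :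
    Represents hV (φ^[k] F) (ψ^[k] X) := by
  induction k generalizing F X with
  | zero => exact h
  | succ k ih => exact ih (hφ _ _ h)

theorem Represents.mul (h : Represents hV F X) (h' : Represents hV F' X') :
    Represents hV (fun x => F x * F' x) (X * X') := fun x => by
  rw [map_mul, ← h x, ← h' x]

theorem Represents.add (h : Represents hV F X) (h' : Represents hV F' X') :
    Represents hV (fun x => F x + F' x) (X + X') := fun x => by
  rw [map_add, ← h x, ← h' x]

theorem Represents.sub (h : Represents hV F X) (h' : Represents hV F' X') :
    Represents hV (fun x => F x - F' x) (X - X') := fun x => by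
  rw [map_sub, ← h x, ← h' x]

theorem Represents.inv (h : Represents hV F X) (hX : X * X' = 1) :
    Represents hV (fun x => (F x)⁻¹) X' := fun x => by
  refine Matrix.inv_eq_right_inv ?_
  rw [h x, ← map_mul, hX, map_one]

theorem iterate_dz_of_represents (h : Represents hV F X) (i : Fin d) (k : ℕ) (p q : Fin l) (x : V) :
    (dz i)^[k] (fun y => F y p q) ⟨x.1, hV _ x.2⟩ = evalMat x ((dzM i)^[k] X) p q := by
  have h1 := Represents.iterate (φ := _root_.dzMat i) (ψ := dzM i)
    (fun F X h => Represents.dzMat (F := F) h i) h k x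
  rw [← h1]
  have h2 : ∀ k (F : Ω → Matrix (Fin l) (Fin l) ℂ) y,
      (dz i)^[k] (fun y => F y p q) y = (_root_.dzMat i)^[k] F y p q := by
    intro k
    induction k with
    | zero => exact fun _ _ => rfl
    | succ k ih => exact fun F y => ih (_root_.dzMat i F) y
  exact h2 k F _

theorem iterate_dz_dzbar_of_represents (h : Represents hV F X) (i : Fin d) (j k : ℕ) (p q : Fin l)
    (x : V) : (dz i)^[j] ((dzbar i)^[k] (fun y => F y p q)) ⟨x.1, hV _ x.2⟩ =
      evalMat x ((dzM i)^[j] ((dzbarM i)^[k] X)) p q := by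
  have h1 := Represents.iterate (φ := _root_.dzbarMat i) (ψ := dzbarM i)
    (fun F X h => Represents.dzbarMat (F := F) h i) h k
  have h2 : ∀ k (F : Ω → Matrix (Fin l) (Fin l) ℂ),
      (dzbar i)^[k] (fun y => F y p q) = fun y => (_root_.dzbarMat i)^[k] F y p q := by
    intro k
    induction k with
    | zero => exact fun _ => rfl
    | succ k ih => exact fun F => ih (_root_.dzbarMat i F)
  rw [h2]
  exact iterate_dz_of_represents h1 i j p q x

theorem exists_represents (hV : ∀ x ∈ V, x ∈ Ω) {F : Ω → Matrix (Fin l) (Fin l) ℂ}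
    (hF : ∀ p q, ∀ x ∈ V, ContDiffAt ℝ ∞ (extendZero fun y => F y p q) x) :
    ∃ X, Represents hV F X := by
  refine ⟨Matrix.of fun p q => ⟨fun x => F ⟨x.1, hV _ x.2⟩ p q, IsSmooth.of_eq
    (F := extendZero fun y => F y p q) (fun y => ?_) fun x => hF p q _ x.2⟩, fun x => rfl⟩
  exact (extendZero_apply (fun y => F y p q) ⟨y.1, hV _ y.2⟩).symm

end SmoothMatrices

/-! ### Evaluation along the hypersurface -/

section EvalZ

variable {m l : ℕ} {V : Opens (Fin (m + 1) → ℂ)}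

/-- Evaluation of matrices of smooth functions along the hypersurface `z_1 = 0`. -/
def evalZ (V : Opens (Fin (m + 1) → ℂ)) (l : ℕ) : Matrix (Fin l) (Fin l) (smoothFun V) →+*
    ({x : V // x.1 0 = 0} → Matrix (Fin l) (Fin l) ℂ) :=
  RingHom.pi fun x => evalMat x.1

theorem evalZ_eq_iff {X Y : Matrix (Fin l) (Fin l) (smoothFun V)} :
    evalZ V l X = evalZ V l Y ↔ ∀ x : V, x.1 0 = 0 → evalMat x X = evalMat x Y := by
  constructor
  · exact fun h x hx => congrFun h ⟨x, hx⟩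
  · exact fun h => funext fun x => h x.1 x.2

/-- The open set of all `w` with `(0, w) ∈ V`. -/
def sliceZ (V : Opens (Fin (m + 1) → ℂ)) : Opens (Fin m → ℂ) :=
  ⟨{w | (Fin.cons 0 w : Fin (m + 1) → ℂ) ∈ V},
    V.isOpen.preimage (consZero m).continuous⟩

theorem mem_sliceZ {w : Fin m → ℂ} : w ∈ sliceZ V ↔ (Fin.cons 0 w : Fin (m + 1) → ℂ) ∈ V := Iff.rfl

theorem zPoint_tail {x : V} (hx : x.1 0 = 0) :
    zPoint (fun w (hw : w ∈ sliceZ V) => hw)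
      ⟨Fin.tail x.1, by rw [mem_sliceZ, ← hx, Fin.cons_self_tail]; exact x.2⟩ = x := by
  refine Subtype.ext ?_
  change (Fin.cons 0 (Fin.tail x.1) : Fin (m + 1) → ℂ) = x.1
  rw [← hx, Fin.cons_self_tail]

/-- Tangential derivatives along the hypersurface only depend on the restriction to it. -/
theorem evalZ_dzbarM_succ {X Y : Matrix (Fin l) (Fin l) (smoothFun V)}
    (h : evalZ V l X = evalZ V l Y) (j : Fin m) :
    evalZ V l (dzbarM j.succ X) = evalZ V l (dzbarM j.succ Y) := by
  rw [evalZ_eq_iff] at h ⊢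
  intro x hx
  ext p q
  have h1 : restrictZ (fun w (hw : w ∈ sliceZ V) => hw) (X p q) =
      restrictZ (fun w (hw : w ∈ sliceZ V) => hw) (Y p q) := by
    ext w
    exact congrFun (congrFun (h (zPoint (fun w (hw : w ∈ sliceZ V) => hw) w) rfl) p) q
  have h2 (Z : Matrix (Fin l) (Fin l) (smoothFun V)) : evalMat x (dzbarM j.succ Z) p q =
      (dzbarS j (restrictZ (fun w (hw : w ∈ sliceZ V) => hw) (Z p q))).1
        ⟨Fin.tail x.1, by rw [mem_sliceZ, ← hx, Fin.cons_self_tail]; exact x.2⟩ :=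
    (congrArg (dzbarS j.succ (Z p q)).1 (zPoint_tail hx).symm).trans
      (dzbarS_restrictZ _ (Z p q) j _).symm
  rw [h2 X, h2 Y, h1]

end EvalZ

/-! ### Holomorphic frames -/

section Frames

variable {m : ℕ} {Ω : Opens (Fin (m + 1) → ℂ)} {l : ℕ} {E : Ω → Type*}
  [TopologicalSpace (TotalSpace (Fin l → ℂ) E)] [∀ x, TopologicalSpace (E x)]
  [∀ x, AddCommGroup (E x)] [∀ x, Module ℂ (E x)]
  [FiberBundle (Fin l → ℂ) E]

/-- The basis of the fibre given by a frame. -/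
def HolFrame.basis (s : HolFrame l E) {x : Ω} (hx : x ∈ s.dom) : Module.Basis (Fin l) ℂ (E x) :=
  s.isFrame.toBasisAt hx

theorem HolFrame.basis_apply (s : HolFrame l E) {x : Ω} (hx : x ∈ s.dom) (p : Fin l) :
    s.basis hx p = s.sec p x := s.isFrame.toBasisAt_coe hx p

theorem HolFrame.coeff_eq (s : HolFrame l E) {x : Ω} (hx : x ∈ s.dom) (p : Fin l) (v : E x) :
    s.isFrame.coeff p x v = (s.basis hx).repr v p := by
  simp [IsLocalFrameOn.coeff, hx, HolFrame.basis]

theorem HolFrame.sum_coeff (s : HolFrame l E) {x : Ω} (hx : x ∈ s.dom) (v : E x) :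
    ∑ p, s.isFrame.coeff p x v • s.sec p x = v := by
  simp only [s.coeff_eq hx, ← s.basis_apply hx]
  exact (s.basis hx).sum_repr v

theorem HolFrame.coeff_sum (s : HolFrame l E) {x : Ω} (hx : x ∈ s.dom) (c : Fin l → ℂ) (p : Fin l) :
    s.isFrame.coeff p x (∑ q, c q • s.sec q x) = c p := by
  simp only [s.coeff_eq hx, ← s.basis_apply hx]
  rw [(s.basis hx).repr_sum_self]

theorem HolFrame.sec_eq_sum (s t : HolFrame l E) {x : Ω} (hx : x ∈ t.dom) (p : Fin l) :
    s.sec p x = ∑ q, s.trans t x p q • t.sec q x := (t.sum_coeff hx _).symm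

theorem HolFrame.trans_mul_trans (s : HolFrame l E) {t u : HolFrame l E} {x : Ω} (ht : x ∈ t.dom)
    (hu : x ∈ u.dom) : s.trans t x * t.trans u x = s.trans u x := by
  ext p q
  change _ = u.isFrame.coeff q x (s.sec p x)
  have h1 : s.sec p x = ∑ r, (∑ k, s.trans t x p k * t.trans u x k r) • u.sec r x := by
    conv_lhs => rw [s.sec_eq_sum t ht p]
    simp only [Finset.sum_smul]
    rw [Finset.sum_comm]
    refine Finset.sum_congr rfl fun k _ => ?_
    rw [t.sec_eq_sum u hu k, Finset.smul_sum]
    simp only [smul_smul]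
  rw [h1, u.coeff_sum hu (fun r => ∑ k, s.trans t x p k * t.trans u x k r), Matrix.mul_apply]

theorem HolFrame.trans_self (s : HolFrame l E) {x : Ω} (hx : x ∈ s.dom) : s.trans s x = 1 := by
  ext p q
  change s.isFrame.coeff q x (s.sec p x) = _
  rw [s.coeff_eq hx, ← s.basis_apply hx, Module.Basis.repr_self, Finsupp.single_apply,
    Matrix.one_apply]

theorem HolFrame.isUnit_trans {s t : HolFrame l E} {x : Ω} (hs : x ∈ s.dom) (ht : x ∈ t.dom) :
    IsUnit (s.trans t x) := by
  rw [Matrix.isUnit_iff_isUnit_det]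
  exact Matrix.isUnit_det_of_right_inverse
    ((s.trans_mul_trans ht hs).trans (s.trans_self hs))

/-- The domain of a frame as an open subset of `ℂ^(m+1)`. -/
def HolFrame.domain (s : HolFrame l E) : Opens (Fin (m + 1) → ℂ) :=
  ⟨Subtype.val '' s.dom, Ω.isOpen.isOpenMap_subtype_val _ s.isOpen_dom⟩

theorem HolFrame.mem_domain {s : HolFrame l E} {x : Ω} : x.1 ∈ s.domain ↔ x ∈ s.dom := by
  constructor
  · rintro ⟨y, hy, hyx⟩
    rwa [← Subtype.ext hyx]
  · exact fun h => ⟨x, h, rfl⟩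

theorem HolFrame.domain_le (s : HolFrame l E) {x} (hx : x ∈ s.domain) : x ∈ Ω := by
  obtain ⟨y, -, rfl⟩ := hx
  exact y.2

theorem HolFrame.mem_dom (s : HolFrame l E) {x} (hx : x ∈ s.domain) (hx' : x ∈ Ω) :
    (⟨x, hx'⟩ : Ω) ∈ s.dom := HolFrame.mem_domain.1 hx

theorem contMDiffAt_iff_extendZero {f : Ω → ℂ} {x : Ω} :
    ContMDiffAt 𝓘(ℂ, Fin (m + 1) → ℂ) 𝓘(ℂ) ω f x ↔ ContDiffAt ℂ ω (extendZero f) x.1 := by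
  rw [← contMDiffAt_iff_contDiffAt, ← contMDiffAt_subtype_iff]
  simp only [extendZero_apply]

theorem HolFrame.gram_eq (h : HermMetric l E) (s : HolFrame l E) {t : HolFrame l E} {x : Ω}
    (ht : x ∈ t.dom) : h.gram s x = s.trans t x * h.gram t x * (s.trans t x)ᴴ := by
  ext p q
  change h.form x (s.sec p x) (s.sec q x) = _
  rw [s.sec_eq_sum t ht p, s.sec_eq_sum t ht q]
  simp only [map_sum, LinearMap.sum_apply, map_smul, LinearMap.smul_apply, map_smulₛₗ,
    Matrix.mul_apply, Finset.sum_mul, Finset.mul_sum, smul_eq_mul, Matrix.conjTranspose_apply]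
  refine Finset.sum_congr rfl fun a _ => Finset.sum_congr rfl fun b _ => ?_
  change _ * (_ * h.form x (t.sec b x) (t.sec a x)) = _ * h.form x (t.sec b x) (t.sec a x) * _
  simp only [starRingEnd_apply]
  ring

/-- A row vector killed by the Gram matrix gives a vector orthogonal to the whole frame, hence to
itself, so it vanishes by positivity. -/
theorem HermMetric.isUnit_gram (h : HermMetric l E) {s : HolFrame l E} {x : Ω} (hx : x ∈ s.dom) :
    IsUnit (h.gram s x) := by
  rw [← Matrix.vecMul_injective_iff_isUnit]
  refine (injective_iff_map_eq_zero (Matrix.vecMulLinear (h.gram s x)).toAddMonoidHom).2 ?_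
  intro v hv
  have hv' : v ᵥ* h.gram s x = 0 := hv
  have h1 : ∑ p, v p • s.sec p x = 0 := by
    by_contra hne
    refine (h.pos x _ hne).ne' ?_
    have h2 (q : Fin l) : h.form x (∑ p, v p • s.sec p x) (s.sec q x) = 0 := by
      have h3 := congrFun hv' q
      simp only [map_sum, LinearMap.sum_apply, map_smul, LinearMap.smul_apply]
      exact h3
    have h4 : h.form x (∑ p, v p • s.sec p x) (∑ p, v p • s.sec p x) = 0 := by
      rw [map_sum]
      refine Finset.sum_eq_zero fun q _ => ?_
      rw [map_smulₛₗ, h2 q, smul_zero]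
    rw [h4, Complex.zero_re]
  funext p
  rw [← s.coeff_sum hx v p, h1, map_zero]
  rfl

theorem HermMetric.gram_conj (h : HermMetric l E) (s : HolFrame l E) (x : Ω) (p q : Fin l) :
    h.gram s x q p = conj (h.gram s x p q) := h.conj_symm x _ _

theorem HermMetric.contDiffAt_gram (h : HermMetric l E) {s : HolFrame l E} {x} (hx : x ∈ s.domain)
    (p q : Fin l) : ContDiffAt ℝ ∞ (extendZero fun y => h.gram s y p q) x :=
  (h.smooth s p q).contDiffAt (s.domain.isOpen.mem_nhds hx)

/-! ### Frames obtained by a change of basis and frames of local trivializations. -/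

section VectorBundle

variable [VectorBundle ℂ (Fin l → ℂ) E]

/-- The frame `A t` for an invertible holomorphic matrix function `A`. -/
def HolFrame.changeBy (t : HolFrame l E) (A : Ω → Matrix (Fin l) (Fin l) ℂ) (U : Set Ω)
    (hU : IsOpen U) (hUt : U ⊆ t.dom)
    (hA : ∀ p q, ∀ x ∈ U, ContDiffAt ℂ ω (extendZero fun y => A y p q) x.1)
    (hA' : ∀ x ∈ U, IsUnit (A x)) : HolFrame l E where
  dom := U
  isOpen_dom := hU
  sec p x := ∑ q, A x p q • t.sec q x
  isFrame := by
    have hli {x : Ω} (hx : x ∈ U) : LinearIndependent ℂ fun p => ∑ q, A x p q • t.sec q x := by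
      rw [Fintype.linearIndependent_iff]
      intro c hc
      have h1 : c ᵥ* A x = 0 := by
        funext q
        have h2 : ∑ p, c p • ∑ q, A x p q • t.sec q x = ∑ q, (c ᵥ* A x) q • t.sec q x := by
          simp only [Finset.smul_sum, smul_smul, Matrix.vecMul, dotProduct, Finset.sum_smul]
          rw [Finset.sum_comm]
        rw [← t.coeff_sum (hUt hx) (c ᵥ* A x) q, ← h2, hc, map_zero]
        rfl
      have h3 : c = 0 := Matrix.vecMul_injective_iff_isUnit.2 (hA' x hx) (by simpa using h1)
      exact fun p => congrFun h3 p
    refine ⟨hli, fun {x} hx => ?_, fun p => ?_⟩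
    · have := Module.Basis.finiteDimensional_of_finite (t.basis (hUt hx))
      rw [(hli hx).span_eq_top_of_card_eq_finrank']
      rw [Module.finrank_eq_card_basis (t.basis (hUt hx))]
    · refine (t.isFrame.mono hUt).contMDiffOn_of_coeff fun q => ?_
      intro x hx
      have h1 : ContMDiffAt 𝓘(ℂ, Fin (m + 1) → ℂ) 𝓘(ℂ) ω (fun y => A y p q) x :=
        contMDiffAt_iff_extendZero.2 (hA p q x hx)
      refine h1.contMDiffWithinAt.congr_of_mem (fun y hy => ?_) hx
      have h2 := t.coeff_sum (hUt hy) (fun q => A y p q) q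
      simp only [LinearMap.piApply_apply]
      rw [← h2, t.coeff_eq (hUt hy)]
      simp only [IsLocalFrameOn.coeff, hy, dif_pos]
      rfl

theorem HolFrame.trans_changeBy (t : HolFrame l E) (A : Ω → Matrix (Fin l) (Fin l) ℂ) (U : Set Ω)
    (hU : IsOpen U) (hUt : U ⊆ t.dom)
    (hA : ∀ p q, ∀ x ∈ U, ContDiffAt ℂ ω (extendZero fun y => A y p q) x.1)
    (hA' : ∀ x ∈ U, IsUnit (A x)) {x : Ω} (hx : x ∈ U) :
    (t.changeBy A U hU hUt hA hA').trans t x = A x := by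
  ext p q
  exact t.coeff_sum (hUt hx) (A x p) q

variable [ContMDiffVectorBundle ω (Fin l → ℂ) E 𝓘(ℂ, Fin (m + 1) → ℂ)]

variable (l E) in
/-- The frame of a local trivialization. -/
def trivFrame (x : Ω) : HolFrame l E where
  dom := (trivializationAt (Fin l → ℂ) E x).baseSet
  isOpen_dom := (trivializationAt (Fin l → ℂ) E x).open_baseSet
  sec := (trivializationAt (Fin l → ℂ) E x).localFrame (Pi.basisFun ℂ (Fin l))
  isFrame := Trivialization.isLocalFrameOn_localFrame_baseSet _ _ _ _

theorem mem_dom_trivFrame (x : Ω) : x ∈ (trivFrame l E x).dom :=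
  FiberBundle.mem_baseSet_trivializationAt' x

theorem contDiffAt_trans_trivFrame (s : HolFrame l E) (x₀ : Ω) {x : Ω} (hs : x ∈ s.dom)
    (hx : x ∈ (trivFrame l E x₀).dom) (p q : Fin l) :
    ContDiffAt ℂ ω (extendZero fun y => s.trans (trivFrame l E x₀) y p q) x.1 := by
  rw [← contMDiffAt_iff_extendZero]
  have : ContMDiffVectorBundle 1 (Fin l → ℂ) E 𝓘(ℂ, Fin (m + 1) → ℂ) :=
    ContMDiffVectorBundle.of_le (n := ω) le_top
  have h1 := contMDiffAt_localFrameCoeff (e := trivializationAt (Fin l → ℂ) E x₀)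
    (I := 𝓘(ℂ, Fin (m + 1) → ℂ)) (k := ω) (Pi.basisFun ℂ (Fin l)) hx
    (s.isFrame.contMDiffAt s.isOpen_dom hs p) q
  exact h1

end VectorBundle

end Frames

section LocalData

variable {m : ℕ} {Ω : Opens (Fin (m + 1) → ℂ)} {l : ℕ} {E : Ω → Type*}
  [TopologicalSpace (TotalSpace (Fin l → ℂ) E)] [∀ x, TopologicalSpace (E x)]
  [∀ x, AddCommGroup (E x)] [∀ x, Module ℂ (E x)]
  [FiberBundle (Fin l → ℂ) E]
  {V : Opens (Fin (m + 1) → ℂ)} {hV : ∀ x ∈ V, x ∈ Ω}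

/-! ### Gram matrices over the ring of smooth functions -/

/-- The Gram matrix of a frame on `V` and its inverse, as matrices of smooth functions. -/
structure GramOn (h : HermMetric l E) (s : HolFrame l E) (hV : ∀ x ∈ V, x ∈ Ω) where
  /-- the Gram matrix -/
  H : Matrix (Fin l) (Fin l) (smoothFun V)
  /-- its inverse -/
  G : Matrix (Fin l) (Fin l) (smoothFun V)
  rep : Represents hV (h.gram s) H
  mul_inv : H * G = 1
  inv_mul : G * H = 1

theorem exists_gramOn (h : HermMetric l E) (s : HolFrame l E) (hV : ∀ x ∈ V, x ∈ Ω)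
    (hs : V ≤ s.domain) : Nonempty (GramOn h s hV) := by
  obtain ⟨H, hH⟩ := exists_represents hV (F := h.gram s) fun p q x hx =>
    h.contDiffAt_gram (hs hx) p q
  obtain ⟨⟨H, G, h1, h2⟩, rfl⟩ := isUnit_of_evalMat (X := H) fun x => by
    rw [← hH x]
    exact h.isUnit_gram (s.mem_dom (hs x.2) _)
  exact ⟨⟨H, G, hH, h1, h2⟩⟩

variable {h : HermMetric l E} {s t : HolFrame l E}

/-- The covariant derivatives of the curvature as matrices of smooth functions. -/
def GramOn.covCurv (D : GramOn h s hV) (j : Fin (m + 1)) (r t : ℕ) :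
    Matrix (Fin l) (Fin l) (smoothFun V) :=
  (dzbarM 0)^[t] ((covDeriv (dzM 0) (dzM 0 D.H * D.G))^[r] (dzbarM j (dzM 0 D.H * D.G)))

theorem GramOn.represents_covCurv (D : GramOn h s hV) (j : Fin (m + 1)) (r t : ℕ) :
    Represents hV (h.covCurvMat s j r t) (D.covCurv j r t) := by
  have h1 : Represents hV (h.connMat s 0) (dzM 0 D.H * D.G) :=
    (D.rep.dzMat 0).mul (D.rep.inv D.mul_inv)
  refine Represents.iterate (fun F X h => h.dzbarMat 0) ?_ t
  refine Represents.iterate (fun F X h => ?_) (h1.dzbarMat j) r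
  exact ((h.dzMat 0).sub (h1.mul h)).add (h.mul h1)

theorem GramOn.jetGram_apply (D : GramOn h s hV) (n : ℕ) (x : V) (a b : Fin (n + 1) × Fin l) :
    h.jetGram n s ⟨x.1, hV _ x.2⟩ a b =
      evalMat x ((dzM 0)^[(a.1 : ℕ)] ((dzbarM 0)^[(b.1 : ℕ)] D.H)) a.2 b.2 :=
  iterate_dz_dzbar_of_represents D.rep 0 a.1 b.1 a.2 b.2 x

theorem GramOn.evalMat_iterate_dzbarM (D : GramOn h s hV) (i : Fin (m + 1)) (k : ℕ) (x : V) :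
    evalMat x ((dzbarM i)^[k] D.H) = (evalMat x ((dzM i)^[k] D.H))ᴴ := by
  ext p q
  have h1 : ∀ y : V, (D.H p q).1 y = conj ((D.H q p).1 y) := fun y => by
    have h2 := h.gram_conj s ⟨y.1, hV _ y.2⟩ q p
    rw [D.rep y] at h2
    exact h2
  rw [Matrix.conjTranspose_apply, evalMat_apply, evalMat_apply, iterate_dzbarM_apply,
    iterate_dzM_apply, iterate_dzbarS_conj h1]
  rfl

/-! ### Transition matrices -/

/-- A matrix function on `V` that is the conjugate transpose of a holomorphic one. -/
theorem exists_conjTranspose {d : ℕ} {V : Opens (Fin d → ℂ)}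
    (A : Matrix (Fin l) (Fin l) (smoothFun V)) :
    ∃ A' : Matrix (Fin l) (Fin l) (smoothFun V),
      (∀ x, evalMat x A' = (evalMat x A)ᴴ) ∧
      (∀ i k x, evalMat x ((dzbarM i)^[k] A') = (evalMat x ((dzM i)^[k] A))ᴴ) ∧
      ∀ i, dzbarM i A = 0 → dzM i A' = 0 := by
  have hc (f : smoothFun V) : ∃ g : smoothFun V, ∀ x, g.1 x = conj (f.1 x) := by
    refine ⟨⟨fun x => conj (f.1 x), IsSmooth.of_eq
      (F := fun x => Complex.conjCLE (extendZero f.1 x)) (fun y => ?_) fun x => ?_⟩, fun x => rfl⟩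
    · rw [extendZero_apply]
      rfl
    · exact Complex.conjCLE.contDiff.contDiffAt.comp x.1 (f.2 x)
  choose c hc using hc
  have h1 (i : Fin d) (k : ℕ) (x : V) : evalMat x ((dzbarM i)^[k] (Matrix.of fun p q => c (A q p)))
      = (evalMat x ((dzM i)^[k] A))ᴴ := by
    ext p q
    rw [Matrix.conjTranspose_apply, evalMat_apply, evalMat_apply, iterate_dzbarM_apply,
      iterate_dzM_apply]
    exact iterate_dzbarS_conj (hc (A q p)) i k x
  refine ⟨Matrix.of fun p q => c (A q p), fun x => ?_, h1, fun i hi => ?_⟩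
  · ext p q
    exact hc (A q p) x
  · refine Matrix.ext fun p q => ?_
    refine smoothFun.ext_evalAt fun x => ?_
    have h2 : ∀ y, (A q p).1 y = conj ((c (A q p)).1 y) := fun y => by rw [hc, Complex.conj_conj]
    have h3 := dzbarS_conj h2 i x
    have h4 : (dzbarS i (A q p)).1 x = 0 :=
      congrFun (congrArg Subtype.val (congrFun (congrFun hi q) p)) x
    rw [h4] at h3
    change (dzS i (c (A q p))).1 x = 0
    rw [← Complex.conj_conj ((dzS i (c (A q p))).1 x), ← h3, map_zero]

section VectorBundle

variable [VectorBundle ℂ (Fin l → ℂ) E]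
  [ContMDiffVectorBundle ω (Fin l → ℂ) E 𝓘(ℂ, Fin (m + 1) → ℂ)]

theorem dzbarM_eq_zero_of_represents {F : Ω → Matrix (Fin l) (Fin l) ℂ}
    {X : Matrix (Fin l) (Fin l) (smoothFun V)} (hX : Represents hV F X)
    (hF : ∀ p q, ∀ x ∈ V, DifferentiableAt ℂ (extendZero fun y => F y p q) x) (i : Fin (m + 1)) :
    dzbarM i X = 0 := by
  refine Matrix.ext fun p q => smoothFun.ext_evalAt fun x => ?_
  refine dzbarS_eq_zero_of_differentiableAt ((hF p q x.1 x.2).congr_of_eventuallyEq ?_) i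
  refine extendZero_eventuallyEq (fun y => ?_) x
  rw [← evalMat_apply, ← hX y]
  exact (extendZero_apply (fun y => F y p q) ⟨y.1, hV _ y.2⟩).symm

/-- Near `x` the transition factors through the trivialization frame `e` as `S * T⁻¹`, where `S` and
`T` are the analytic transitions from `s` and `t` to `e`. Both are annihilated by every `∂_{z̄_i}`,
hence so is the product, and the Cauchy-Riemann equations give holomorphy. -/
theorem contDiffAt_trans {x : Ω} (hs : x ∈ s.dom) (ht : x ∈ t.dom) (p q : Fin l) :
    ContDiffAt ℝ ∞ (extendZero fun y => s.trans t y p q) x.1 ∧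
      DifferentiableAt ℂ (extendZero fun y => s.trans t y p q) x.1 := by
  let e := trivFrame l E x
  let V : Opens (Fin (m + 1) → ℂ) := (s.domain ⊓ t.domain) ⊓ e.domain
  have hV : ∀ y ∈ V, y ∈ Ω := fun y hy => e.domain_le hy.2
  have hω (u : HolFrame l E) (hu : V ≤ u.domain) (p q) : ∀ y ∈ V,
      ContDiffAt ℂ ω (extendZero fun y => u.trans e y p q) y := fun y hy =>
    contDiffAt_trans_trivFrame u x (u.mem_dom (hu hy) (hV y hy)) (e.mem_dom hy.2 (hV y hy)) p q
  have hex (u : HolFrame l E) (hu : V ≤ u.domain) :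
      ∃ X, Represents hV (u.trans e) X ∧ ∀ i, dzbarM i X = 0 := by
    obtain ⟨X, hX⟩ := exists_represents hV (F := u.trans e) fun p q y hy =>
      ((hω u hu p q y hy).restrict_scalars ℝ).of_le le_top
    exact ⟨X, hX, dzbarM_eq_zero_of_represents hX fun p q y hy =>
      (hω u hu p q y hy).differentiableAt (by simp)⟩
  obtain ⟨S, hS, hS'⟩ := hex s fun y hy => hy.1.1
  obtain ⟨T, hT, hT'⟩ := hex t fun y hy => hy.1.2
  obtain ⟨⟨T, T', h1, h2⟩, rfl⟩ := isUnit_of_evalMat (X := T) fun y => by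
    rw [← hT y]
    exact HolFrame.isUnit_trans (t.mem_dom y.2.1.2 _) (e.mem_dom y.2.2 _)
  have hX : Represents hV (s.trans t) (S * T') := fun y => by
    have h3 := s.trans_mul_trans (t.mem_dom y.2.1.2 (hV _ y.2)) (e.mem_dom y.2.2 (hV _ y.2))
    rw [hT y, hS y] at h3
    rw [map_mul, ← h3, mul_assoc, ← map_mul, h1, map_one, mul_one]
  have hX' (i) : dzbarM i (S * T') = 0 := by
    rw [isDeriv_dzbarM i, hS', (isDeriv_dzbarM i).map_inv h1 h2]
    change 0 * T' + S * -(T' * dzbarM i T * T') = 0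
    rw [show dzbarM i T = 0 from hT' i]
    simp
  have hx : x.1 ∈ V := ⟨⟨HolFrame.mem_domain.2 hs, HolFrame.mem_domain.2 ht⟩,
    HolFrame.mem_domain.2 (mem_dom_trivFrame x)⟩
  have h4 := extendZero_eventuallyEq (f := ((S * T') p q).1)
    (F := extendZero fun y => s.trans t y p q) (fun y => by
      rw [← evalMat_apply, ← hX y]
      exact (extendZero_apply (fun y => s.trans t y p q) ⟨y.1, hV _ y.2⟩).symm) ⟨x.1, hx⟩
  refine ⟨(((S * T') p q).2 ⟨x.1, hx⟩).congr_of_eventuallyEq h4.symm, ?_⟩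
  refine (differentiableAt_of_dzbarS_eq_zero (f := (S * T') p q) (x := ⟨x.1, hx⟩)
    fun i => ?_).congr_of_eventuallyEq h4.symm
  exact congrFun (congrArg Subtype.val (congrFun (congrFun (hX' i) p) q)) _

theorem exists_transOn (hV : ∀ x ∈ V, x ∈ Ω) (hs : V ≤ s.domain) (ht : V ≤ t.domain) :
    ∃ A : Matrix (Fin l) (Fin l) (smoothFun V), Represents hV (s.trans t) A ∧
      ∀ i, dzbarM i A = 0 := by
  have h1 (p q) (x) (hx : x ∈ V) := contDiffAt_trans (s := s) (t := t)
    (s.mem_dom (hs hx) (hV x hx)) (t.mem_dom (ht hx) (hV x hx)) p q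
  obtain ⟨A, hA⟩ := exists_represents hV (F := s.trans t) fun p q x hx => (h1 p q x hx).1
  exact ⟨A, hA, dzbarM_eq_zero_of_represents hA fun p q x hx => (h1 p q x hx).2⟩

end VectorBundle

end LocalData

/-! ### Jets -/

section Blocks

variable {n l : ℕ}

/-- The matrix with the given blocks. -/
def ofBlocks (f : Fin (n + 1) → Fin (n + 1) → Matrix (Fin l) (Fin l) ℂ) :
    Matrix (Fin (n + 1) × Fin l) (Fin (n + 1) × Fin l) ℂ :=
  Matrix.of fun a b => f a.1 b.1 a.2 b.2

theorem ofBlocks_mul (f g : Fin (n + 1) → Fin (n + 1) → Matrix (Fin l) (Fin l) ℂ) :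
    ofBlocks f * ofBlocks g = ofBlocks fun a b => ∑ c, f a c * g c b := by
  ext a b
  simp only [ofBlocks, Matrix.mul_apply, Matrix.of_apply, Fintype.sum_prod_type, Matrix.sum_apply]

theorem ofBlocks_conjTranspose (f : Fin (n + 1) → Fin (n + 1) → Matrix (Fin l) (Fin l) ℂ) :
    (ofBlocks f)ᴴ = ofBlocks fun a b => (f b a)ᴴ := rfl

/-- This is the `(a, b)` block of a product of two jet transition matrices. It is the Leibniz rule
for `δ^[a - b]` combined with `binom(a,c) binom(c,b) = binom(a,b) binom(a-b,c-b)`. Outside `b ≤ c ≤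
a` a binomial coefficient vanishes, so the truncated subtractions do no harm. -/
theorem IsDeriv.sum_choose_mul {S : Type*} [Ring S] {δ : S →+ S} (hδ : IsDeriv δ) (x y : S)
    {n a b : ℕ} (ha : a ≤ n) :
    ∑ c : Fin (n + 1), (a.choose c * (c : ℕ).choose b) • (δ^[a - c] x * δ^[c - b] y) =
      a.choose b • δ^[a - b] (x * y) := by
  rw [← Finset.sum_range fun c => (a.choose c * c.choose b) • (δ^[a - c] x * δ^[c - b] y)]
  by_cases hab : b ≤ a
  · obtain ⟨k, rfl⟩ := Nat.exists_eq_add_of_le hab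
    rw [← Finset.sum_subset (s₁ := Finset.Ico b (b + k + 1)), Finset.sum_Ico_eq_sum_range,
      hδ.iterate_mul, Finset.smul_sum]
    · refine Finset.sum_congr (by congr 1; omega) fun e _ => ?_
      rw [Nat.choose_mul, smul_smul, Nat.add_sub_cancel_left, Nat.add_sub_cancel_left,
        Nat.add_sub_add_left]
      exact Nat.le_add_right b e
    · intro c hc
      have := Finset.mem_Ico.1 hc
      exact Finset.mem_range.2 (by omega)
    · intro c _ hc
      have : c < b ∨ b + k < c := by
        by_contra hh
        exact hc (Finset.mem_Ico.2 (by omega))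
      rcases this with h1 | h1
      · rw [Nat.choose_eq_zero_of_lt h1, mul_zero, zero_smul]
      · rw [Nat.choose_eq_zero_of_lt h1, zero_mul, zero_smul]
  · rw [Nat.choose_eq_zero_of_lt (by omega : a < b), zero_smul]
    refine Finset.sum_eq_zero fun c _ => ?_
    rcases le_or_gt c a with h1 | h1
    · rw [Nat.choose_eq_zero_of_lt (by omega : c < b), mul_zero, zero_smul]
    · rw [Nat.choose_eq_zero_of_lt h1, zero_mul, zero_smul]

/-- The Leibniz rule with the range of summation enlarged to all block indices, to match matrix
products. -/
theorem IsDeriv.iterate_mul_fin {S : Type*} [Ring S] {δ : S →+ S} (hδ : IsDeriv δ) (x y : S)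
    {n a : ℕ} (ha : a ≤ n) :
    δ^[a] (x * y) = ∑ c : Fin (n + 1), a.choose c • (δ^[a - c] x * δ^[c] y) := by
  have := hδ.sum_choose_mul x y (b := 0) ha
  simpa using this.symm

theorem IsDeriv.iterate_mul_fin' {S : Type*} [Ring S] {δ : S →+ S} (hδ : IsDeriv δ) (x y : S)
    {n a : ℕ} (ha : a ≤ n) :
    δ^[a] (x * y) = ∑ c : Fin (n + 1), a.choose c • (δ^[c] x * δ^[a - c] y) := by
  rw [← Finset.sum_range fun c => a.choose c • (δ^[c] x * δ^[a - c] y),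
    ← Finset.sum_subset (Finset.range_mono (by omega : a + 1 ≤ n + 1)), hδ.iterate_mul,
    ← Finset.sum_flip]
  · refine Finset.sum_congr rfl fun c hc => ?_
    have hc' : c ≤ a := Nat.lt_succ_iff.1 (Finset.mem_range.1 hc)
    rw [Nat.choose_symm hc', Nat.sub_sub_self hc']
  · intro c _ hc
    rw [Nat.choose_eq_zero_of_lt (by simpa using hc), zero_smul]

end Blocks

/-! ### Transition and Gram matrices of the jet bundle in block form. -/

section Jets

variable {m : ℕ} {Ω : Opens (Fin (m + 1) → ℂ)} {l : ℕ} {E : Ω → Type*}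
  [TopologicalSpace (TotalSpace (Fin l → ℂ) E)] [∀ x, TopologicalSpace (E x)]
  [∀ x, AddCommGroup (E x)] [∀ x, Module ℂ (E x)]
  [FiberBundle (Fin l → ℂ) E]
  {V : Opens (Fin (m + 1) → ℂ)} {hV : ∀ x ∈ V, x ∈ Ω} {h : HermMetric l E} {s t u : HolFrame l E}

theorem jetTrans_eq_ofBlocks {A : Matrix (Fin l) (Fin l) (smoothFun V)}
    (hA : Represents hV (s.trans t) A) (n : ℕ) (x : V) :
    s.jetTrans n t ⟨x.1, hV _ x.2⟩ = ofBlocks fun a b =>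
      evalMat x ((a : ℕ).choose b • (dzM 0)^[(a : ℕ) - b] A) := by
  ext a b
  simp only [ofBlocks, HolFrame.jetTrans, Matrix.of_apply, map_nsmul]
  rw [iterate_dz_of_represents hA, Matrix.smul_apply, nsmul_eq_mul]

theorem jetGram_eq_ofBlocks (D : GramOn h s hV) (n : ℕ) (x : V) :
    h.jetGram n s ⟨x.1, hV _ x.2⟩ = ofBlocks fun a b =>
      evalMat x ((dzM 0)^[(a : ℕ)] ((dzbarM 0)^[(b : ℕ)] D.H)) := by
  ext a b
  exact D.jetGram_apply n x a b

theorem jetTrans_self (n : ℕ) {x : Ω} (hs : x ∈ s.dom) : s.jetTrans n s x = 1 := by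
  have hA : Represents (fun _ => s.domain_le) (s.trans s) 1 := fun y => by
    rw [map_one]
    exact s.trans_self (s.mem_dom y.2 _)
  have e1 := jetTrans_eq_ofBlocks hA n ⟨x.1, HolFrame.mem_domain.2 hs⟩
  rw [e1]
  ext a b
  simp only [ofBlocks, Matrix.of_apply]
  by_cases hab : a.1 = b.1
  · rw [hab]
    simp [Matrix.one_apply, Prod.ext_iff, hab]
  · rw [Matrix.one_apply_ne (fun h => hab (congrArg Prod.fst h))]
    have hab' : (a.1 : ℕ) ≠ b.1 := fun h => hab (Fin.ext h)
    rcases lt_or_gt_of_ne hab' with h1 | h1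
    · rw [Nat.choose_eq_zero_of_lt h1, zero_smul, map_zero]
      rfl
    · obtain ⟨k, hk⟩ : ∃ k, (a.1 : ℕ) - b.1 = k + 1 := ⟨a.1 - b.1 - 1, by omega⟩
      have h2 : (dzM 0)^[(a.1 : ℕ) - b.1] (1 : Matrix (Fin l) (Fin l) (smoothFun s.domain)) = 0 := by
        rw [hk, Function.iterate_succ_apply, (isDeriv_dzM 0).map_one, iterate_map_zero]
      rw [h2, smul_zero, map_zero]
      rfl

section VectorBundle

variable [VectorBundle ℂ (Fin l → ℂ) E]
  [ContMDiffVectorBundle ω (Fin l → ℂ) E 𝓘(ℂ, Fin (m + 1) → ℂ)]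

/-- This cocycle identity ensures that any row of coordinates in one frame extends to a compatible
family, so that `jetCoord` is an isomorphism. -/
theorem jetTrans_mul_jetTrans (n : ℕ) {x : Ω} (hs : x ∈ s.dom) (ht : x ∈ t.dom) (hu : x ∈ u.dom) :
    s.jetTrans n t x * t.jetTrans n u x = s.jetTrans n u x := by
  let V : Opens (Fin (m + 1) → ℂ) := (s.domain ⊓ t.domain) ⊓ u.domain
  have hV : ∀ y ∈ V, y ∈ Ω := fun y hy => u.domain_le hy.2
  obtain ⟨A, hA, -⟩ := exists_transOn (s := s) (t := t) hV (fun y hy => hy.1.1) fun y hy => hy.1.2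
  obtain ⟨B, hB, -⟩ := exists_transOn (s := t) (t := u) hV (fun y hy => hy.1.2) fun y hy => hy.2
  have hAB : Represents hV (s.trans u) (A * B) := fun y => by
    rw [map_mul, ← hA y, ← hB y]
    exact (s.trans_mul_trans (t.mem_dom y.2.1.2 _) (u.mem_dom y.2.2 _)).symm
  have hx : x.1 ∈ V := ⟨⟨HolFrame.mem_domain.2 hs, HolFrame.mem_domain.2 ht⟩,
    HolFrame.mem_domain.2 hu⟩
  have e1 := jetTrans_eq_ofBlocks hA n ⟨x.1, hx⟩
  have e2 := jetTrans_eq_ofBlocks hB n ⟨x.1, hx⟩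
  have e3 := jetTrans_eq_ofBlocks hAB n ⟨x.1, hx⟩
  rw [e1, e2, e3, ofBlocks_mul]
  congr 1
  funext a b
  rw [← (isDeriv_dzM 0).sum_choose_mul A B (Nat.lt_succ_iff.1 a.2), map_sum]
  refine Finset.sum_congr rfl fun c _ => ?_
  rw [← map_mul, smul_mul_smul_comm]

/-- Differentiate `H = A K A*`: the derivatives `∂_{z̄_1}` pass through `A` and the derivatives
`∂_{z_1}` pass through `A*`, so the two Leibniz sums separate into a left and a right block factor.
The Hermitian form on jets is therefore independent of the frame. -/
theorem jetGram_eq_mul (n : ℕ) {x : Ω} (hs : x ∈ s.dom) (ht : x ∈ t.dom) :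
    h.jetGram n s x = s.jetTrans n t x * h.jetGram n t x * (s.jetTrans n t x)ᴴ := by
  let V : Opens (Fin (m + 1) → ℂ) := s.domain ⊓ t.domain
  have hV : ∀ y ∈ V, y ∈ Ω := fun y hy => t.domain_le hy.2
  obtain ⟨A, hA, hA0⟩ := exists_transOn (s := s) (t := t) hV (fun y hy => hy.1) fun y hy => hy.2
  obtain ⟨A', hA', hAd, hA0'⟩ := exists_conjTranspose A
  obtain ⟨Ds⟩ := exists_gramOn h s hV fun y hy => hy.1
  obtain ⟨Dt⟩ := exists_gramOn h t hV fun y hy => hy.2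
  have hH : Ds.H = A * Dt.H * A' := ext_evalMat fun y => by
    rw [map_mul, map_mul, hA', ← hA y, ← Ds.rep y, ← Dt.rep y]
    exact s.gram_eq h (t.mem_dom y.2.2 _)
  have hx : x.1 ∈ V := ⟨HolFrame.mem_domain.2 hs, HolFrame.mem_domain.2 ht⟩
  have e1 := jetTrans_eq_ofBlocks hA n ⟨x.1, hx⟩
  have e2 := jetGram_eq_ofBlocks Ds n ⟨x.1, hx⟩
  have e3 := jetGram_eq_ofBlocks Dt n ⟨x.1, hx⟩
  rw [e1, e2, e3, ofBlocks_conjTranspose, ofBlocks_mul, ofBlocks_mul]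
  congr 1
  funext a b
  have h0 (c : Fin (n + 1)) :
      (evalMat ⟨x.1, hx⟩ ((b : ℕ).choose c • (dzM 0)^[(b : ℕ) - c] A))ᴴ =
        evalMat ⟨x.1, hx⟩ ((b : ℕ).choose c • (dzbarM 0)^[(b : ℕ) - c] A') := by
    rw [map_nsmul, map_nsmul, hAd, Matrix.conjTranspose_nsmul]
  simp only [h0]
  have hA'' (k : ℕ) : dzM 0 ((dzbarM 0)^[k] A') = 0 := by
    rw [← Function.iterate_one (dzM 0), ← iterate_dzbarM_iterate_dzM_comm 0 0 k 1,
      Function.iterate_one, hA0' 0 (hA0 0), iterate_map_zero]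
  have h1 : (dzbarM 0)^[(b : ℕ)] (A * Dt.H * A') = ∑ c : Fin (n + 1), A *
      ((dzbarM 0)^[(c : ℕ)] Dt.H * (b : ℕ).choose c • (dzbarM 0)^[(b : ℕ) - c] A') := by
    have h2 : (dzbarM 0)^[(b : ℕ)] (Dt.H * A') = ∑ c : Fin (n + 1),
        (dzbarM 0)^[(c : ℕ)] Dt.H * (b : ℕ).choose c • (dzbarM 0)^[(b : ℕ) - c] A' := by
      rw [(isDeriv_dzbarM 0).iterate_mul_fin' Dt.H A' (Nat.lt_succ_iff.1 b.2)]
      simp only [mul_smul_comm]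
    rw [mul_assoc, (isDeriv_dzbarM 0).iterate_mul_of_left (hA0 0), h2, Finset.mul_sum]
  have hadd (k : ℕ) (f : Fin (n + 1) → Matrix (Fin l) (Fin l) (smoothFun V)) :
      (dzM 0)^[k] (∑ c, f c) = ∑ c, (dzM 0)^[k] (f c) := by
    induction k generalizing f with
    | zero => rfl
    | succ k ih => simp only [Function.iterate_succ_apply, map_sum, ih]
  rw [hH, h1, hadd, map_sum]
  refine Finset.sum_congr rfl fun c _ => ?_
  rw [← mul_assoc, (isDeriv_dzM 0).iterate_mul_of_right (by rw [map_nsmul, hA'', smul_zero]),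
    map_mul, (isDeriv_dzM 0).iterate_mul_fin A _ (Nat.lt_succ_iff.1 a.2), map_sum]
  simp only [← map_mul, smul_mul_assoc]

/-! ### Coordinates on the fibres of the jet bundle -/

theorem jetForm_eq (n : ℕ) {x : Ω} (s t : {s : HolFrame l E // x ∈ s.dom}) (v w : JetFibre l E n x) :
    h.jetForm n s v w = h.jetForm n t v w := by
  have hv := v.2 s t
  have hw := w.2 s t
  simp only [HermMetric.jetForm]
  rw [hv, hw, jetGram_eq_mul n s.2 t.2, star_vecMul, ← dotProduct_mulVec, ← Matrix.mulVec_mulVec,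
    ← Matrix.mulVec_mulVec]

/-- The coordinates of a vector of the jet bundle with respect to a frame. -/
def jetCoord (n : ℕ) {x : Ω} (s : HolFrame l E) (hs : x ∈ s.dom) :
    JetFibre l E n x ≃ₗ[ℂ] (Fin (n + 1) × Fin l → ℂ) where
  toFun v := v.1 ⟨s, hs⟩
  map_add' _ _ := rfl
  map_smul' _ _ := rfl
  invFun c := ⟨fun t => c ᵥ* s.jetTrans n t.1 x, fun t u => by
    rw [Matrix.vecMul_vecMul, jetTrans_mul_jetTrans n hs t.2 u.2]⟩
  left_inv v := Subtype.ext (funext fun t => (v.2 ⟨s, hs⟩ t).symm)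
  right_inv c := by
    change c ᵥ* s.jetTrans n s x = c
    rw [jetTrans_self n hs, Matrix.vecMul_one]

theorem jetCoord_apply (n : ℕ) {x : Ω} (s : HolFrame l E) (hs : x ∈ s.dom) (v : JetFibre l E n x) :
    jetCoord n s hs v = v.1 ⟨s, hs⟩ := rfl

theorem jetCoord_change (n : ℕ) {x : Ω} {s t : HolFrame l E} (hs : x ∈ s.dom) (ht : x ∈ t.dom)
    (v : JetFibre l E n x) : jetCoord n t ht v = jetCoord n s hs v ᵥ* s.jetTrans n t x :=
  v.2 ⟨s, hs⟩ ⟨t, ht⟩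

theorem jetCoord_pascalMap (n : ℕ) {x : Ω} (s : HolFrame l E) (hs : x ∈ s.dom)
    (v : JetFibre l E n x) :
    jetCoord n s hs (pascalMap n x v) = jetCoord n s hs v ᵥ* pascalMat l n := rfl

end VectorBundle

end Jets

/-! ### Frames with prescribed Taylor coefficients along the hypersurface -/

section Taylor

theorem IsDeriv.pow_succ {S : Type*} [Ring S] {δ : S →+ S} (hδ : IsDeriv δ) {Z : S} (hZ : δ Z = 1)
    (j : ℕ) : δ (Z ^ (j + 1)) = (j + 1) • Z ^ j := by
  induction j with
  | zero => simpa using hZ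
  | succ j ih =>
    rw [_root_.pow_succ, hδ, ih, hZ, mul_one, smul_mul_assoc, ← _root_.pow_succ, succ_nsmul _ (j + 1)]

/-- The derivatives of a polynomial in `Z` at `Z = 0`. -/
theorem IsDeriv.iterate_sum_pow_mul {S T : Type*} [Ring S] [Ring T] {δ : S →+ S} (hδ : IsDeriv δ)
    {Z : S} (hZ : δ Z = 1) (ev : S →+* T) (hev : ev Z = 0) (k N : ℕ) (hk : k < N) (C : ℕ → S)
    (hC : ∀ j, δ (C j) = 0) :
    ev (δ^[k] (∑ j ∈ Finset.range N, Z ^ j * C j)) = k.factorial • ev (C k) := by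
  induction k generalizing N C with
  | zero =>
    obtain ⟨N, rfl⟩ : ∃ N', N = N' + 1 := ⟨N - 1, by omega⟩
    simp [Finset.sum_range_succ', map_sum, hev]
  | succ k ih =>
    obtain ⟨N, rfl⟩ : ∃ N', N = N' + 1 := ⟨N - 1, by omega⟩
    have h1 : δ (∑ j ∈ Finset.range (N + 1), Z ^ j * C j) =
        ∑ j ∈ Finset.range N, Z ^ j * ((j + 1) • C (j + 1)) := by
      rw [Finset.sum_range_succ', map_add, map_sum, pow_zero, one_mul, hC, add_zero]
      refine Finset.sum_congr rfl fun j _ => ?_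
      rw [hδ, hC, mul_zero, add_zero, hδ.pow_succ hZ, smul_mul_assoc, mul_smul_comm]
    rw [Function.iterate_succ_apply, h1, ih N (by omega) (fun j => (j + 1) • C (j + 1))
      fun j => by rw [map_nsmul, hC, smul_zero], map_nsmul, smul_smul, Nat.factorial_succ, mul_comm]

variable {m : ℕ}

/-- The projection `(z, w) ↦ w` as a continuous linear map. -/
def tailL (𝕜 : Type*) [NontriviallyNormedField 𝕜] [NormedAlgebra 𝕜 ℂ] (m : ℕ) :
    (Fin (m + 1) → ℂ) →L[𝕜] (Fin m → ℂ) :=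
  ContinuousLinearMap.pi fun i => ContinuousLinearMap.proj i.succ

theorem tailL_apply (𝕜 : Type*) [NontriviallyNormedField 𝕜] [NormedAlgebra 𝕜 ℂ]
    (x : Fin (m + 1) → ℂ) : tailL 𝕜 m x = Fin.tail x := rfl

theorem dzS_zero_of_comp_tail {V : Opens (Fin (m + 1) → ℂ)} {f : smoothFun V}
    {g : (Fin m → ℂ) → ℂ} (hfg : ∀ x : V, f.1 x = g (Fin.tail x.1))
    (hg : ∀ x : V, DifferentiableAt ℝ g (Fin.tail x.1)) : dzS 0 f = 0 := by
  refine smoothFun.ext_evalAt fun x => ?_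
  have h1 : fderiv ℝ (extendZero f.1) x.1 = fderiv ℝ (g ∘ tailL ℝ m) x.1 :=
    (extendZero_eventuallyEq (fun y => hfg y) x).fderiv_eq
  have h2 (c : ℂ) : fderiv ℝ (extendZero f.1) x.1 (Pi.single 0 c) = 0 := by
    have h4 : DifferentiableAt ℝ g (tailL ℝ m x.1) := hg x
    rw [h1, fderiv_comp x.1 h4 (tailL ℝ m).differentiableAt, ContinuousLinearMap.fderiv]
    have h3 : tailL ℝ m (Pi.single 0 c) = 0 := by
      ext i
      simp [tailL_apply, Fin.tail]
    rw [ContinuousLinearMap.comp_apply, h3, map_zero]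
  rw [evalAt_apply, dzS_apply, dz, h2, h2]
  simp

theorem exists_coordinate (V : Opens (Fin (m + 1) → ℂ)) :
    ∃ z : smoothFun V, (∀ x, z.1 x = x.1 0) ∧ dzS 0 z = 1 := by
  let z : smoothFun V := ⟨fun x => x.1 0, IsSmooth.of_eq (F := fun x => x 0) (fun _ => rfl)
    fun _ => (contDiff_apply ℝ ℂ 0).contDiffAt⟩
  refine ⟨z, fun _ => rfl, smoothFun.ext_evalAt fun x => ?_⟩
  have h1 : fderiv ℝ (extendZero z.1) x.1 =
      fderiv ℝ (ContinuousLinearMap.proj (R := ℝ) (φ := fun _ : Fin (m + 1) => ℂ) 0) x.1 :=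
    (extendZero_eventuallyEq (f := z.1)
      (F := ContinuousLinearMap.proj (R := ℝ) (φ := fun _ : Fin (m + 1) => ℂ) 0)
      (fun y => rfl) x).fderiv_eq
  rw [evalAt_apply, dzS_apply, dz, h1, ContinuousLinearMap.fderiv]
  simp only [ContinuousLinearMap.proj_apply, Pi.single_eq_same, Complex.I_mul_I, map_one]
  norm_num

variable {Ω : Opens (Fin (m + 1) → ℂ)} {l : ℕ} {E : Ω → Type*}
  [TopologicalSpace (TotalSpace (Fin l → ℂ) E)] [∀ x, TopologicalSpace (E x)]
  [∀ x, AddCommGroup (E x)] [∀ x, Module ℂ (E x)]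
  [FiberBundle (Fin l → ℂ) E] [VectorBundle ℂ (Fin l → ℂ) E]

/-- Given holomorphic matrix functions `c_j` on the hypersurface with `c_0` invertible, there is a
frame `u = A t` such that the `j`-th derivative of `A` along the hypersurface is `c_j`. -/
theorem exists_frame_of_taylor (t : HolFrame l E) (N : ℕ) (W : Opens (Fin m → ℂ))
    (hW : ∀ w ∈ W, (Fin.cons 0 w : Fin (m + 1) → ℂ) ∈ t.domain)
    (c : ℕ → (Fin m → ℂ) → Matrix (Fin l) (Fin l) ℂ)
    (hc : ∀ j p q, DifferentiableOn ℂ (fun w => c j w p q) W) (hc0 : ∀ w ∈ W, IsUnit (c 0 w)) :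
    ∃ u : HolFrame l E, u.domain ≤ t.domain ∧
      (∀ w ∈ W, (Fin.cons 0 w : Fin (m + 1) → ℂ) ∈ u.domain) ∧
      (∀ x ∈ u.domain, Fin.tail x ∈ W) ∧
      ∃ A : Matrix (Fin l) (Fin l) (smoothFun u.domain),
        Represents (fun _ => u.domain_le) (u.trans t) A ∧
        ∀ x : u.domain, x.1 0 = 0 → ∀ j ≤ N, evalMat x ((dzM 0)^[j] A) = c j (Fin.tail x.1) := by
  -- The Taylor polynomial in `z_1` with the prescribed coefficients `c_j / j!`, each extended to be
  -- constant in `z_1`.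
  let F : (Fin (m + 1) → ℂ) → Matrix (Fin l) (Fin l) ℂ := fun x =>
    ∑ j ∈ Finset.range (N + 1), x 0 ^ j • (j.factorial : ℂ)⁻¹ • c j (Fin.tail x)
  let O : Opens (Fin (m + 1) → ℂ) :=
    t.domain ⊓ ⟨{x | Fin.tail x ∈ W}, W.isOpen.preimage (tailL ℂ m).continuous⟩
  have hcω (j p q) (w) (hw : w ∈ W) : ContDiffAt ℂ ω (fun w => c j w p q) w :=
    contDiffAt_omega_of_differentiableOn W.isOpen (hc j p q) hw
  have hFω (p q) (x) (hx : x ∈ O) : ContDiffAt ℂ ω (fun x => F x p q) x := by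
    have h1 : (fun x => F x p q) = fun x => ∑ j ∈ Finset.range (N + 1),
        x 0 ^ j * ((j.factorial : ℂ)⁻¹ * c j (tailL ℂ m x) p q) := by
      funext x
      simp [F, Matrix.sum_apply, tailL_apply]
    rw [h1]
    refine ContDiffAt.sum fun j _ => ((contDiff_apply ℂ ℂ 0).contDiffAt.pow j).mul
      (contDiffAt_const.mul ?_)
    exact (hcω j p q _ hx.2).comp x (tailL ℂ m).contDiff.contDiffAt
  have hdet : ContinuousOn (fun x => (F x).det) O := by
    intro x hx
    simp only [Matrix.det_apply]
    refine (tendsto_finsetSum _ fun σ _ => ?_)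
    refine Filter.Tendsto.const_smul (tendsto_finsetProd _ fun i _ => ?_) _
    exact (hFω _ _ x hx).continuousAt.continuousWithinAt
  -- Shrinking to the set where `F` is invertible loses no point of the hypersurface over `W`,
  -- because there `F = c 0`.
  let O' : Opens (Fin (m + 1) → ℂ) :=
    ⟨O ∩ (fun x => (F x).det) ⁻¹' {0}ᶜ, hdet.isOpen_inter_preimage O.isOpen isOpen_compl_singleton⟩
  let U : Set Ω := Subtype.val ⁻¹' (O' : Set (Fin (m + 1) → ℂ))
  have hU : IsOpen U := O'.isOpen.preimage continuous_subtype_val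
  have hUt : U ⊆ t.dom := fun x hx => HolFrame.mem_domain.1 hx.1.1
  have hAω (p q) (x : Ω) (hx : x ∈ U) :
      ContDiffAt ℂ ω (extendZero fun y : Ω => F y.1 p q) x.1 :=
    (hFω p q x.1 hx.1).congr_of_eventuallyEq (extendZero_eventuallyEq (F := fun x => F x p q) (fun _ => rfl) x)
  have hAu (x : Ω) (hx : x ∈ U) : IsUnit (F x.1) := by
    rw [Matrix.isUnit_iff_isUnit_det]
    exact isUnit_iff_ne_zero.2 hx.2
  let u : HolFrame l E := t.changeBy (fun x => F x.1) U hU hUt hAω hAu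
  have hu {x} (hx : x ∈ u.domain) : x ∈ O' := u.mem_dom hx (u.domain_le hx)
  have hF0 (x : Fin (m + 1) → ℂ) (hx : x 0 = 0) : F x = c 0 (Fin.tail x) := by
    simp [F, Finset.sum_range_succ', hx]
  refine ⟨u, fun x hx => (hu hx).1.1, fun w hw => ?_, fun x hx => (hu hx).1.2, ?_⟩
  · have hx := t.domain_le (hW w hw)
    refine HolFrame.mem_domain (x := ⟨_, hx⟩).2 ⟨⟨hW w hw, ?_⟩, ?_⟩
    · change Fin.tail (Fin.cons 0 w : Fin (m + 1) → ℂ) ∈ W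
      rwa [Fin.tail_cons]
    · change (F (Fin.cons 0 w)).det ≠ 0
      rw [hF0 _ rfl, Fin.tail_cons]
      exact ((Matrix.isUnit_iff_isUnit_det _).1 (hc0 w hw)).ne_zero
  · obtain ⟨z, hz, hz'⟩ := exists_coordinate u.domain
    let C (j : ℕ) : Matrix (Fin l) (Fin l) (smoothFun u.domain) := Matrix.of fun p q =>
      ⟨fun x => (j.factorial : ℂ)⁻¹ * c j (Fin.tail x.1) p q, IsSmooth.of_eq
        (F := fun x => (j.factorial : ℂ)⁻¹ * c j (tailL ℂ m x) p q) (fun _ => rfl) fun x =>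
          ((contDiffAt_const.mul ((hcω j p q _ (hu x.2).1.2).comp x.1
            (tailL ℂ m).contDiff.contDiffAt)).restrict_scalars ℝ).of_le le_top⟩
    have hC (j) : dzM 0 (C j) = 0 := by
      refine Matrix.ext fun p q => ?_
      refine dzS_zero_of_comp_tail (g := fun w => (j.factorial : ℂ)⁻¹ * c j w p q)
        (fun x => rfl) fun x => ?_
      exact (((hcω j p q _ (hu x.2).1.2).differentiableAt (by simp)).const_mul _).restrictScalars ℝ
    have hZ : dzM 0 (Matrix.scalar (Fin l) z) = 1 := by
      refine Matrix.ext fun p q => ?_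
      change dzS 0 (Matrix.diagonal (fun _ => z) p q) = _
      rw [Matrix.diagonal_apply, Matrix.one_apply]
      split_ifs
      · exact hz'
      · exact map_zero _
    have hZe (x : u.domain) : evalMat x (Matrix.scalar (Fin l) z) = Matrix.scalar (Fin l) (x.1 0) := by
      ext p q
      rw [← hz x]
      change evalAt x (Matrix.diagonal (fun _ => z) p q) = Matrix.diagonal (fun _ => z.1 x) p q
      rw [Matrix.diagonal_apply, Matrix.diagonal_apply]
      split_ifs
      · rfl
      · exact map_zero _
    have hCe (x : u.domain) (j : ℕ) :
        evalMat x (C j) = (j.factorial : ℂ)⁻¹ • c j (Fin.tail x.1) := rfl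
    refine ⟨∑ j ∈ Finset.range (N + 1), Matrix.scalar (Fin l) z ^ j * C j, fun x => ?_,
      fun x hx j hj => ?_⟩
    · have h1 : u.trans t ⟨x.1, _⟩ = F x.1 :=
        t.trans_changeBy (fun x => F x.1) U hU hUt hAω hAu (u.mem_dom x.2 (u.domain_le x.2))
      rw [h1, map_sum]
      refine Finset.sum_congr rfl fun j _ => ?_
      rw [map_mul, map_pow, hZe, hCe, ← map_pow, Matrix.scalar_apply, ← Matrix.smul_eq_diagonal_mul]
    · rw [(isDeriv_dzM 0).iterate_sum_pow_mul hZ (evalMat x) (by rw [hZe, hx, map_zero]) j (N + 1)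
        (by omega) C hC, hCe, ← Nat.cast_smul_eq_nsmul ℂ, smul_smul, mul_inv_cancel₀, one_smul]
      exact_mod_cast j.factorial_ne_zero

end Taylor

/-! ### Comparison of two metrics along the hypersurface -/

section Compare

open Topology

variable {m : ℕ}

/-- Only the tangential Cauchy-Riemann equations at points of the hypersurface are required: they
are the full system for the restriction, while `f` itself may fail to be holomorphic. -/
theorem differentiableAt_along_hypersurface {V : Opens (Fin (m + 1) → ℂ)} {f : smoothFun V}
    (hf : ∀ (j : Fin m) (x : V), x.1 0 = 0 → (dzbarS j.succ f).1 x = 0) {g : (Fin m → ℂ) → ℂ}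
    {w₀ : Fin m → ℂ} (hw₀ : (Fin.cons 0 w₀ : Fin (m + 1) → ℂ) ∈ V)
    (hg : ∀ᶠ w in 𝓝 w₀, ∀ hw : (Fin.cons 0 w : Fin (m + 1) → ℂ) ∈ V, g w = f.1 ⟨Fin.cons 0 w, hw⟩) :
    DifferentiableAt ℂ g w₀ := by
  have hW : ∀ w ∈ sliceZ V, (Fin.cons 0 w : Fin (m + 1) → ℂ) ∈ V := fun w hw => hw
  have h1 : DifferentiableAt ℂ (extendZero (restrictZ hW f).1) w₀ :=
    differentiableAt_of_dzbarS_eq_zero (x := ⟨w₀, hw₀⟩) fun j => by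
      rw [dzbarS_restrictZ]
      exact hf j _ rfl
  refine h1.congr_of_eventuallyEq ?_
  filter_upwards [hg, (sliceZ V).isOpen.mem_nhds hw₀] with w hw hwV
  rw [hw hwV]
  exact (extendZero_apply (restrictZ hW f).1 ⟨w, hwV⟩).symm

variable {Ω : Opens (Fin (m + 1) → ℂ)} {l : ℕ} {E : Ω → Type*}
  [TopologicalSpace (TotalSpace (Fin l → ℂ) E)] [∀ x, TopologicalSpace (E x)]
  [∀ x, AddCommGroup (E x)] [∀ x, Module ℂ (E x)]
  [FiberBundle (Fin l → ℂ) E] {E' : Ω → Type*}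
  [TopologicalSpace (TotalSpace (Fin l → ℂ) E')] [∀ x, TopologicalSpace (E' x)]
  [∀ x, AddCommGroup (E' x)] [∀ x, Module ℂ (E' x)]
  [FiberBundle (Fin l → ℂ) E']
  {V : Opens (Fin (m + 1) → ℂ)} {hV : ∀ x ∈ V, x ∈ Ω} {h : HermMetric l E} {h' : HermMetric l E'}
  {s : HolFrame l E} {t : HolFrame l E'} {n : ℕ}

/-- The derivative `∂_{z_1}^j H` of the Gram matrix of a frame. -/
def HermMetric.gramDeriv (h : HermMetric l E) (s : HolFrame l E) (j : ℕ) :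
    Ω → Matrix (Fin l) (Fin l) ℂ :=
  (dzMat 0)^[j] (h.gram s)

theorem GramOn.represents_gramDeriv (D : GramOn h s hV) (j : ℕ) :
    Represents hV (h.gramDeriv s j) ((dzM 0)^[j] D.H) :=
  Represents.iterate (fun _ _ h => h.dzMat 0) D.rep j

/-- Passes between jet Gram matrices and the calculus of `AgreeTo`, using that `∂_{z_1}` and
`∂_{z̄_1}` commute. -/
theorem jetGram_eq_iff (D : GramOn h s hV) (D' : GramOn h' t hV) :
    (∀ x : V, x.1 0 = 0 → h.jetGram n s ⟨x.1, hV _ x.2⟩ = h'.jetGram n t ⟨x.1, hV _ x.2⟩) ↔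
    ∀ j ≤ n, AgreeTo (dzbarM 0) (evalZ V l) n ((dzM 0)^[j] D.H) ((dzM 0)^[j] D'.H) := by
  constructor
  · intro hx j hj k hk
    rw [iterate_dzbarM_iterate_dzM_comm, iterate_dzbarM_iterate_dzM_comm, evalZ_eq_iff]
    intro x hx0
    ext p q
    have h1 := congrFun (congrFun (hx x hx0) (⟨j, Nat.lt_succ_iff.2 hj⟩, p))
      (⟨k, Nat.lt_succ_iff.2 hk⟩, q)
    rwa [D.jetGram_apply, D'.jetGram_apply] at h1
  · intro hj x hx0
    ext a b
    have h1 := hj a.1 (Nat.lt_succ_iff.1 a.1.2) b.1 (Nat.lt_succ_iff.1 b.1.2)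
    rw [iterate_dzbarM_iterate_dzM_comm, iterate_dzbarM_iterate_dzM_comm, evalZ_eq_iff] at h1
    rw [D.jetGram_apply, D'.jetGram_apply, h1 x hx0]

theorem agreeTo_connection (D : GramOn h s hV) (D' : GramOn h' t hV)
    (hj : ∀ j ≤ n, AgreeTo (dzbarM 0) (evalZ V l) n ((dzM 0)^[j] D.H) ((dzM 0)^[j] D'.H))
    (j : ℕ) (hjn : j ≤ n) :
    AgreeTo (dzbarM 0) (evalZ V l) n ((dzM 0)^[j] D.H * D.G) ((dzM 0)^[j] D'.H * D'.G) :=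
  (hj j hjn).mul (isDeriv_dzbarM 0) ((hj 0 (Nat.zero_le _)).inv (isDeriv_dzbarM 0) D.mul_inv
    D.inv_mul D'.mul_inv D'.inv_mul)

/-- If the jets of the Gram matrices agree then the covariant derivatives of the curvature
component `K_{1 1̄}` agree. -/
theorem evalZ_covCurv_zero_of_jets (D : GramOn h s hV) (D' : GramOn h' t hV)
    (hj : ∀ j ≤ n, AgreeTo (dzbarM 0) (evalZ V l) n ((dzM 0)^[j] D.H) ((dzM 0)^[j] D'.H))
    {r k : ℕ} (hr : r < n) (hk : k < n) :
    evalZ V l (D.covCurv 0 r k) = evalZ V l (D'.covCurv 0 r k) := by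
  -- One `∂_{z̄_1}` is used up in forming the curvature, so agreement to order `n` of the `Γ_j`
  -- leaves order `n - 1` for its derivatives.
  obtain ⟨N, rfl⟩ : ∃ N, n = N + 1 := ⟨n - 1, by omega⟩
  have h1 := agreeTo_connection D D' hj
  exact agreeTo_covDeriv_curvature (isDeriv_dzM 0) (isDeriv_dzbarM 0) (isDeriv_dzbarM 0)
    (dzbarM_dzM_comm 0 0) D.mul_inv D.inv_mul D'.mul_inv D'.inv_mul
    (fun j hj => (h1 j hj).mono N.le_succ) (fun j hj => (agreeTo_succ.1 (h1 j hj)).2) r hr k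
    (by omega)

/-- If the derivatives of the Gram matrices agree then the covariant derivatives of the curvature
components `K_{1 j̄}` for tangential directions `j` agree. -/
theorem evalZ_covCurv_succ_of_jets (D : GramOn h s hV) (D' : GramOn h' t hV)
    (hj : ∀ j ≤ n, AgreeTo (dzbarM 0) (evalZ V l) n ((dzM 0)^[j] D.H) ((dzM 0)^[j] D'.H))
    {r : ℕ} (hr : r < n) (i : Fin m) :
    evalZ V l (D.covCurv i.succ r 0) = evalZ V l (D'.covCurv i.succ r 0) := by
  -- The values of the `Γ_j` on the hypersurface suffice, since they determine their tangential
  -- derivatives.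
  have h1 := fun j hjn => agreeTo_zero.1 ((agreeTo_connection D D' hj j hjn).mono (Nat.zero_le n))
  exact agreeTo_zero.1 (agreeTo_covDeriv_curvature (D := dzbarM 0) (isDeriv_dzM 0)
    (isDeriv_dzbarM 0) (isDeriv_dzbarM i.succ)
    (dzbarM_dzM_comm i.succ 0) D.mul_inv D.inv_mul D'.mul_inv D'.inv_mul
    (fun j hj => agreeTo_zero.2 (h1 j hj))
    (fun j hj => agreeTo_zero.2 (evalZ_dzbarM_succ (h1 j hj) i)) r hr)

/-- By Hermitian symmetry, `∂_{z̄_1}^k H` is the conjugate transpose of `∂_{z_1}^k H`. -/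
theorem evalZ_iterate_dzbarM (D : GramOn h s hV) (D' : GramOn h' t hV) {k : ℕ}
    (hk : evalZ V l ((dzM 0)^[k] D.H) = evalZ V l ((dzM 0)^[k] D'.H)) :
    evalZ V l ((dzbarM 0)^[k] D.H) = evalZ V l ((dzbarM 0)^[k] D'.H) := by
  rw [evalZ_eq_iff] at hk ⊢
  intro x hx
  rw [D.evalMat_iterate_dzbarM, D'.evalMat_iterate_dzbarM, hk x hx]

/-- If the derivatives `∂_{z_1}^j H` and the covariant derivatives of `K_{1 1̄}` agree, then all jets
of the Gram matrices agree. -/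
theorem jets_of_evalZ_covCurv (D : GramOn h s hV) (D' : GramOn h' t hV)
    (hj : ∀ j ≤ n, evalZ V l ((dzM 0)^[j] D.H) = evalZ V l ((dzM 0)^[j] D'.H))
    (hK : ∀ r < n, ∀ k < n, evalZ V l (D.covCurv 0 r k) = evalZ V l (D'.covCurv 0 r k)) :
    ∀ j ≤ n, AgreeTo (dzbarM 0) (evalZ V l) n ((dzM 0)^[j] D.H) ((dzM 0)^[j] D'.H) := by
  intro j hjn
  have h0 : evalZ V l D.G = evalZ V l D'.G := agreeTo_zero.1 (AgreeTo.inv (isDeriv_dzbarM 0)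
    D.mul_inv D.inv_mul D'.mul_inv D'.inv_mul (agreeTo_zero.2 (hj 0 (Nat.zero_le n))))
  have h1 := agreeTo_connection_of_curvature (isDeriv_dzM 0) (isDeriv_dzbarM 0)
    (dzbarM_dzM_comm 0 0) D.mul_inv D.inv_mul D'.mul_inv D'.inv_mul (ev := evalZ V l) (n := n)
    (fun j hjn => by rw [map_mul, map_mul, hj j hjn, h0]) hK n le_rfl j hjn
  have h2 : AgreeTo (dzbarM 0) (evalZ V l) n D.H D'.H := fun k hk =>
    evalZ_iterate_dzbarM D D' (hj k hk)
  -- The derivatives of the Gram matrix are recovered as `∂_{z_1}^j H = Γ_j H`.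
  have h3 := h1.mul (isDeriv_dzbarM 0) h2
  rwa [mul_assoc, D.inv_mul, mul_one, mul_assoc, D'.inv_mul, mul_one] at h3

/-- If the derivatives `∂_{z_1}^i H` for `i ≤ k` and the covariant derivatives of the curvature
agree then the difference of the derivatives of order `k + 1` is holomorphic. -/
theorem evalZ_dzbarM_connection (D : GramOn h s hV) (D' : GramOn h' t hV) {k : ℕ}
    (hj : ∀ j ≤ k, evalZ V l ((dzM 0)^[j] D.H) = evalZ V l ((dzM 0)^[j] D'.H)) (i : Fin m)
    (hK : ∀ r ≤ k, evalZ V l (D.covCurv i.succ r 0) = evalZ V l (D'.covCurv i.succ r 0)) :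
    evalZ V l (dzbarM i.succ ((dzM 0)^[k + 1] D.H * D.G)) =
      evalZ V l (dzbarM i.succ ((dzM 0)^[k + 1] D'.H * D'.G)) := by
  have h0 : evalZ V l D.G = evalZ V l D'.G := agreeTo_zero.1 (AgreeTo.inv (isDeriv_dzbarM 0)
    D.mul_inv D.inv_mul D'.mul_inv D'.inv_mul (agreeTo_zero.2 (hj 0 (Nat.zero_le k))))
  refine agreeTo_zero.1 (agreeTo_deriv_connection (D := dzbarM 0) (isDeriv_dzM 0)
    (isDeriv_dzbarM 0) (isDeriv_dzbarM i.succ) (dzbarM_dzM_comm i.succ 0) D.mul_inv D.inv_mul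
    D'.mul_inv D'.inv_mul (fun j hjk => agreeTo_zero.2 ?_) fun r hr => agreeTo_zero.2 (hK r ?_))
  · rw [map_mul, map_mul, hj j (by omega), h0]
  · omega

/-! ### Linear maps represented by matrices -/

theorem HolFrame.toEnd_sum (s : HolFrame l E) {x : Ω} (hx : x ∈ s.dom)
    (M : Matrix (Fin l) (Fin l) ℂ) (c : Fin l → ℂ) :
    s.toEnd hx M (∑ p, c p • s.sec p x) = ∑ q, (c ᵥ* M) q • s.sec q x := by
  have h1 (p : Fin l) : s.toEnd hx M (s.sec p x) = ∑ q, M p q • s.sec q x := by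
    rw [← s.basis_apply hx p]
    exact Module.Basis.constr_basis _ _ _ _
  simp only [map_sum, map_smul, h1, Finset.smul_sum, smul_smul, Matrix.vecMul, dotProduct,
    Finset.sum_smul]
  rw [Finset.sum_comm]

theorem HolFrame.sum_smul_sec (s : HolFrame l E) {t : HolFrame l E} {x : Ω} (ht : x ∈ t.dom)
    (c : Fin l → ℂ) : ∑ p, c p • s.sec p x = ∑ q, (c ᵥ* s.trans t x) q • t.sec q x := by
  simp only [Matrix.vecMul, dotProduct, Finset.sum_smul]
  rw [Finset.sum_comm]
  refine Finset.sum_congr rfl fun p _ => ?_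
  rw [s.sec_eq_sum t ht p, Finset.smul_sum]
  simp only [smul_smul]

theorem toEnd_congr {s t : HolFrame l E} {x : Ω} (hs : x ∈ s.dom) (ht : x ∈ t.dom)
    {M N : Matrix (Fin l) (Fin l) ℂ} (hMN : M * s.trans t x = s.trans t x * N) :
    s.toEnd hs M = t.toEnd ht N := by
  ext v
  rw [← s.sum_coeff hs v, s.toEnd_sum, s.sum_smul_sec ht, s.sum_smul_sec ht, t.toEnd_sum,
    Matrix.vecMul_vecMul, Matrix.vecMul_vecMul, hMN]

theorem jetTrans_zero {s t : HolFrame l E} {x : Ω} (p q : Fin l) :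
    s.jetTrans n t x (0, p) (0, q) = s.trans t x p q := by
  simp [HolFrame.jetTrans]

theorem trans_eq_of_jetTrans_eq {s s₂ : HolFrame l E} {t t₂ : HolFrame l E'} {x : Ω}
    (hJ : s.jetTrans n s₂ x = t.jetTrans n t₂ x) : s.trans s₂ x = t.trans t₂ x := by
  ext p q
  rw [← jetTrans_zero (n := n), hJ, jetTrans_zero]

/-- A linear map between fibres that maps a frame to a frame with the same Gram matrix is
isometric. -/
theorem isometric_of_gram_eq {s : HolFrame l E} {t : HolFrame l E'} {x : Ω} (hs : x ∈ s.dom)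
    (ψ : E x →ₗ[ℂ] E' x) (hψ : ∀ p, ψ (s.sec p x) = t.sec p x) (hg : h.gram s x = h'.gram t x)
    (u v : E x) : h'.form x (ψ u) (ψ v) = h.form x u v := by
  have hg' (p q) : h.form x (s.sec p x) (s.sec q x) = h'.form x (t.sec p x) (t.sec q x) :=
    congrFun (congrFun hg p) q
  rw [← s.sum_coeff hs u, ← s.sum_coeff hs v]
  simp only [map_sum, map_smul, LinearMap.sum_apply, LinearMap.smul_apply, map_smulₛₗ, hψ, hg']

theorem intertwines_of_matrix_eq {s : HolFrame l E} {t : HolFrame l E'} {x : Ω} (hs : x ∈ s.dom)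
    (ht : x ∈ t.dom) (ψ : E x →ₗ[ℂ] E' x) (hψ : ∀ p, ψ (s.sec p x) = t.sec p x)
    (M : Matrix (Fin l) (Fin l) ℂ) (v : E x) :
    ψ (s.toEnd hs M v) = t.toEnd ht M (ψ v) := by
  have h1 (c : Fin l → ℂ) : ψ (∑ p, c p • s.sec p x) = ∑ p, c p • t.sec p x := by
    simp only [map_sum, map_smul, hψ]
  rw [← s.sum_coeff hs v, s.toEnd_sum, h1, h1, t.toEnd_sum]

theorem evalZ_represents {V : Opens (Fin (m + 1) → ℂ)} {hV : ∀ x ∈ V, x ∈ Ω}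
    {F F' : Ω → Matrix (Fin l) (Fin l) ℂ} {X X' : Matrix (Fin l) (Fin l) (smoothFun V)}
    (hF : Represents hV F X) (hF' : Represents hV F' X') :
    evalZ V l X = evalZ V l X' ↔
      ∀ x : V, x.1 0 = 0 → F ⟨x.1, hV _ x.2⟩ = F' ⟨x.1, hV _ x.2⟩ := by
  rw [evalZ_eq_iff]
  refine forall_congr' fun x => ?_
  rw [hF x, hF' x]

/-- The covariant derivatives of the curvature do not depend on the frame. -/
theorem covCurv_congr [VectorBundle ℂ (Fin l → ℂ) E]
    [ContMDiffVectorBundle ω (Fin l → ℂ) E 𝓘(ℂ, Fin (m + 1) → ℂ)] (h : HermMetric l E)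
    {s t : HolFrame l E} {x : Ω} (hs : x ∈ s.dom) (ht : x ∈ t.dom) (j : Fin (m + 1)) (r k : ℕ) :
    h.covCurv s j r k hs = h.covCurv t j r k ht := by
  let V : Opens (Fin (m + 1) → ℂ) := s.domain ⊓ t.domain
  have hV : ∀ y ∈ V, y ∈ Ω := fun y hy => t.domain_le hy.2
  obtain ⟨A, hA, hA0⟩ := exists_transOn (s := s) (t := t) hV (fun y hy => hy.1) fun y hy => hy.2
  obtain ⟨A', hA', -, hA0'⟩ := exists_conjTranspose A
  obtain ⟨Ds⟩ := exists_gramOn h s hV fun y hy => hy.1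
  obtain ⟨Dt⟩ := exists_gramOn h t hV fun y hy => hy.2
  have hH : Ds.H = A * Dt.H * A' := ext_evalMat fun y => by
    rw [map_mul, map_mul, hA', ← hA y, ← Ds.rep y, ← Dt.rep y]
    exact s.gram_eq h (t.mem_dom y.2.2 _)
  obtain ⟨⟨A, B, hAB, hBA⟩, rfl⟩ := isUnit_of_evalMat (X := A) fun y => by
    rw [← hA y]
    exact HolFrame.isUnit_trans (s.mem_dom y.2.1 _) (t.mem_dom y.2.2 _)
  obtain ⟨⟨A', B', hAB', hBA'⟩, rfl⟩ := isUnit_of_evalMat (X := A') fun y => by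
    rw [hA', Matrix.isUnit_conjTranspose, ← hA y]
    exact HolFrame.isUnit_trans (s.mem_dom y.2.1 _) (t.mem_dom y.2.2 _)
  simp only at hH hA hA0 hA0'
  have hG : Ds.G = B' * Dt.G * B := by
    refine left_inv_eq_right_inv Ds.inv_mul ?_
    have h1 : A * Dt.H * A' * (B' * Dt.G * B) = A * (Dt.H * (A' * B') * Dt.G) * B := by
      simp only [mul_assoc]
    rw [hH, h1, hAB', mul_one, Dt.mul_inv, mul_one, hAB]
  have hB0 (i) : dzbarM i B = 0 := by
    rw [(isDeriv_dzbarM i).map_inv hAB hBA, hA0, mul_zero, zero_mul, neg_zero]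
  -- The factor `A'` drops out in the connection, and `A`, `B` are constant for `∂_{z̄}`, so they
  -- stay outside through all derivatives.
  have hcov : Ds.covCurv j r k = A * Dt.covCurv j r k * B := by
    rw [GramOn.covCurv, GramOn.covCurv, hH, hG,
      connection_change_frame (isDeriv_dzM 0) Dt.mul_inv hAB' (hA0' 0 (hA0 0)),
      curvature_change_frame (isDeriv_dzbarM j) (dzbarM_dzM_comm j 0) hAB hBA (hA0 j),
      iterate_covDeriv_change_frame (isDeriv_dzM 0) hAB hBA,
      (isDeriv_dzbarM 0).iterate_mul_of_right (hB0 0),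
      (isDeriv_dzbarM 0).iterate_mul_of_left (hA0 0)]
  refine toEnd_congr hs ht ?_
  have hx : x.1 ∈ V := ⟨HolFrame.mem_domain.2 hs, HolFrame.mem_domain.2 ht⟩
  have e1 := hA ⟨x.1, hx⟩
  have e2 := Ds.represents_covCurv j r k ⟨x.1, hx⟩
  have e3 := Dt.represents_covCurv j r k ⟨x.1, hx⟩
  simp only at e1 e2 e3
  rw [e1, e2, e3, hcov, ← map_mul, ← map_mul, mul_assoc, hBA, mul_one]

end Compare

/-! ### From contact to the intertwining of curvatures -/

section Forward

open Topology

/-- Comparing the entries of the two products gives `a M_{a-1,k} = (k+1) M_{a,k+1}`, and induction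
on the column index follows. So `M` is block lower triangular and determined by its first block
column, exactly like a jet transition matrix. For `b > a` the binomial coefficient is zero and the
truncated index `a - b` is irrelevant. -/
theorem pascal_comm_blocks {n l : ℕ} {M : Matrix (Fin (n + 1) × Fin l) (Fin (n + 1) × Fin l) ℂ}
    (hM : pascalMat l n * M = M * pascalMat l n) (a b : Fin (n + 1)) (p q : Fin l) :
    M (a, p) (b, q) = ((a : ℕ).choose b : ℂ) * M (⟨(a : ℕ) - b, by omega⟩, p) (0, q) := by
  obtain ⟨b, hb⟩ := b
  induction b generalizing a with
  | zero => simp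
  | succ k ih =>
    have hk : k < n + 1 := by omega
    have h1 : (M * pascalMat l n) (a, p) (⟨k, hk⟩, q) = M (a, p) (⟨k + 1, hb⟩, q) * (k + 1) := by
      rw [Matrix.mul_apply, Finset.sum_eq_single (⟨k + 1, hb⟩, q)]
      · simp [pascalMat]
      · rintro ⟨c, r⟩ - hc
        have : ¬ ((c : ℕ) = k + 1 ∧ r = q) := by
          rintro ⟨h1, h2⟩
          exact hc (by ext <;> simp [h1, h2])
        simp [pascalMat, this]
      · simp
    have hk0 : (k : ℂ) + 1 ≠ 0 := by exact_mod_cast Nat.succ_ne_zero k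
    obtain ⟨a, ha⟩ := a
    cases a with
    | zero =>
      have h2 : (pascalMat l n * M) (⟨0, ha⟩, p) (⟨k, hk⟩, q) = 0 := by
        rw [Matrix.mul_apply]
        refine Finset.sum_eq_zero fun c _ => ?_
        simp [pascalMat]
      rw [hM, h1] at h2
      rw [(mul_eq_zero.1 h2).resolve_right hk0]
      simp
    | succ a =>
      have h2 : (pascalMat l n * M) (⟨a + 1, ha⟩, p) (⟨k, hk⟩, q) =
          (a + 1) * M (⟨a, by omega⟩, p) (⟨k, hk⟩, q) := by
        rw [Matrix.mul_apply, Finset.sum_eq_single (⟨a, by omega⟩, p)]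
        · simp [pascalMat]
        · rintro ⟨c, r⟩ - hc
          have : ¬ (a = (c : ℕ) ∧ p = r) := fun h1 =>
            hc (Prod.ext (Fin.ext h1.1.symm) h1.2.symm)
          simp [pascalMat, this]
        · simp
      rw [hM, h1, ih ⟨a, by omega⟩ hk] at h2
      have h3 : ((a + 1 : ℂ)) * (a.choose k : ℂ) = ((a + 1).choose (k + 1) : ℂ) * (k + 1) := by
        exact_mod_cast Nat.add_one_mul_choose_eq a k
      refine mul_right_cancel₀ hk0 (h2.trans ?_)
      simp only [Nat.add_sub_add_right]
      linear_combination M (⟨a - k, by omega⟩, p) (0, q) * h3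

variable {m : ℕ} {Ω : Opens (Fin (m + 1) → ℂ)} {Ω' : Opens (Fin m → ℂ)} {l : ℕ} {E : Ω → Type*}
  [TopologicalSpace (TotalSpace (Fin l → ℂ) E)] [∀ x, TopologicalSpace (E x)]
  [∀ x, AddCommGroup (E x)] [∀ x, Module ℂ (E x)]
  [FiberBundle (Fin l → ℂ) E] [VectorBundle ℂ (Fin l → ℂ) E]
  [ContMDiffVectorBundle ω (Fin l → ℂ) E 𝓘(ℂ, Fin (m + 1) → ℂ)] {E' : Ω → Type*}
  [TopologicalSpace (TotalSpace (Fin l → ℂ) E')] [∀ x, TopologicalSpace (E' x)]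
  [∀ x, AddCommGroup (E' x)] [∀ x, Module ℂ (E' x)]
  [FiberBundle (Fin l → ℂ) E'] [VectorBundle ℂ (Fin l → ℂ) E']
  [ContMDiffVectorBundle ω (Fin l → ℂ) E' 𝓘(ℂ, Fin (m + 1) → ℂ)]
  {hZ : ∀ w ∈ Ω', (Fin.cons 0 w : Fin (m + 1) → ℂ) ∈ Ω} {n : ℕ}
  {h : HermMetric l E} {h' : HermMetric l E'}
  {Φ : ∀ w : Ω', JetFibre l E n (zPoint hZ w) ≃ₗ[ℂ] JetFibre l E' n (zPoint hZ w)}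

/-- For a frame `s` and an isomorphism `Φ` of jet bundles that intertwines the Pascal maps there is
a frame `t` such that `Φ` maps the jets of `s` to those of `t`. -/
theorem exists_frame_of_jetIso (hΦ : IsJetHolIsometry hZ n h h' Φ)
    (hP : ∀ w v, Φ w (pascalMap n _ v) = pascalMap n _ (Φ w v)) (s : HolFrame l E)
    (s' : HolFrame l E') :
    ∃ t : HolFrame l E', t.domain ≤ s'.domain ∧ (∀ x ∈ t.domain, Fin.tail x ∈ Ω') ∧
      ∀ w : Ω', ∀ hs : zPoint hZ w ∈ s.dom, zPoint hZ w ∈ s'.dom → ∃ ht : zPoint hZ w ∈ t.dom,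
        ∀ v, jetCoord n t ht (Φ w v) = jetCoord n s hs v := by
  obtain ⟨M, hM, hMΦ⟩ := hΦ.holomorphic s s'
  let W : Opens (Fin m → ℂ) := sliceZ (s.domain ⊓ s'.domain) ⊓ Ω'
  have hWs (w : Ω') (hw : w.1 ∈ W) : zPoint hZ w ∈ s.dom ∧ zPoint hZ w ∈ s'.dom :=
    ⟨HolFrame.mem_domain.1 hw.1.1, HolFrame.mem_domain.1 hw.1.2⟩
  have hcoord (w : Ω') (hs : zPoint hZ w ∈ s.dom) (hs' : zPoint hZ w ∈ s'.dom) (v) :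
      jetCoord n s' hs' (Φ w v) = jetCoord n s hs v ᵥ* M w := hMΦ w hs hs' v
  have hMP (w : Ω') (hs : zPoint hZ w ∈ s.dom) (hs' : zPoint hZ w ∈ s'.dom) :
      pascalMat l n * M w = M w * pascalMat l n := by
    refine Matrix.ext_of_single_vecMul fun i => ?_
    obtain ⟨v, hv⟩ := (jetCoord n s hs).surjective (Pi.single i 1)
    rw [← hv, ← Matrix.vecMul_vecMul, ← Matrix.vecMul_vecMul, ← jetCoord_pascalMap,
      ← hcoord w hs hs', ← hcoord w hs hs', hP, jetCoord_pascalMap]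
  -- The first block column of `M` provides the Taylor coefficients. Coefficients beyond `n` are
  -- never looked at.
  let c (j : ℕ) (w : Fin m → ℂ) : Matrix (Fin l) (Fin l) ℂ := Matrix.of fun p q =>
    if hj : j < n + 1 then extendZero (fun w => M w (⟨j, hj⟩, p) (0, q)) w else 0
  have hcM (j : ℕ) (hj : j < n + 1) (w : Ω') (p q) : c j w.1 p q = M w (⟨j, hj⟩, p) (0, q) := by
    simp only [c, Matrix.of_apply, dif_pos hj]
    exact extendZero_apply (fun w => M w (⟨j, hj⟩, p) (0, q)) w
  have hc (j p q) : DifferentiableOn ℂ (fun w => c j w p q) W := by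
    by_cases hj : j < n + 1
    · simp only [c, Matrix.of_apply, dif_pos hj]
      exact (hM (⟨j, hj⟩, p) (0, q)).mono fun w hw => ⟨⟨w, hw.2⟩, hWs ⟨w, hw.2⟩ hw, rfl⟩
    · simp only [c, Matrix.of_apply, dif_neg hj]
      exact differentiableOn_const 0
  -- By triangularity the top block row of `M` is `(c_0, 0, …, 0)`. A row vector killed by `c_0`,
  -- padded by zeros to `e`, is therefore killed by `M`, which contradicts injectivity of `Φ` unless
  -- it is zero.
  have hc0 (w) (hw : w ∈ W) : IsUnit (c 0 w) := by
    rw [← Matrix.vecMul_injective_iff_isUnit]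
    refine (injective_iff_map_eq_zero (Matrix.vecMulLinear (c 0 w)).toAddMonoidHom).2 ?_
    intro v hv
    have hv' : v ᵥ* c 0 w = 0 := hv
    obtain ⟨hs, hs'⟩ := hWs ⟨w, hw.2⟩ hw
    let e : Fin (n + 1) × Fin l → ℂ := fun a => if a.1 = 0 then v a.2 else 0
    have he : e ᵥ* M ⟨w, hw.2⟩ = 0 := by
      funext b
      have h1 : (e ᵥ* M ⟨w, hw.2⟩) b = ∑ p, v p * M ⟨w, hw.2⟩ (0, p) b := by
        simp only [Matrix.vecMul, dotProduct, Fintype.sum_prod_type, e]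
        rw [Finset.sum_eq_single 0]
        · simp
        · intro a _ ha
          simp [ha]
        · simp
      rw [h1]
      obtain ⟨b, q⟩ := b
      have h2 (p) := pascal_comm_blocks (hMP ⟨w, hw.2⟩ hs hs') 0 b p q
      by_cases hb : b = 0
      · subst hb
        have h3 := congrFun hv' q
        simp only [Matrix.vecMul, dotProduct, hcM 0 (Nat.succ_pos n) ⟨w, hw.2⟩] at h3
        exact h3
      · refine Finset.sum_eq_zero fun p _ => ?_
        have hb' : (0 : ℕ) < b := Nat.pos_of_ne_zero fun h0 => hb (Fin.ext h0)
        have h4 : ((0 : Fin (n + 1)) : ℕ).choose b = 0 := Nat.choose_eq_zero_of_lt hb'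
        rw [h2 p, h4, Nat.cast_zero, zero_mul, mul_zero]
    obtain ⟨u, hu⟩ := (jetCoord n s hs).surjective e
    rw [← hu, ← hcoord ⟨w, hw.2⟩ hs hs', LinearEquiv.map_eq_zero_iff,
      LinearEquiv.map_eq_zero_iff] at he
    rw [he, map_zero] at hu
    funext p
    exact (congrFun hu (0, p)).symm
  obtain ⟨t, ht1, ht2, ht3, A, hA, hAc⟩ :=
    exists_frame_of_taylor s' n W (fun w hw => hw.1.2) c hc hc0
  refine ⟨t, ht1, fun x hx => (ht3 x hx).2, fun w hs hs' => ?_⟩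
  have hw : w.1 ∈ W := ⟨⟨HolFrame.mem_domain.2 hs, HolFrame.mem_domain.2 hs'⟩, w.2⟩
  have ht : zPoint hZ w ∈ t.dom := HolFrame.mem_domain.1 (ht2 w.1 hw)
  refine ⟨ht, fun v => ?_⟩
  -- Both sides have the binomial block pattern, and their first block columns coincide by the
  -- choice of `c`.
  have hMw : M w = t.jetTrans n s' (zPoint hZ w) := by
    have e1 := jetTrans_eq_ofBlocks hA n ⟨(zPoint hZ w).1, HolFrame.mem_domain.2 ht⟩
    refine Eq.trans ?_ e1.symm
    ext ⟨a, p⟩ ⟨b, q⟩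
    simp only [ofBlocks, Matrix.of_apply, map_nsmul]
    rw [hAc _ rfl _ (by omega), pascal_comm_blocks (hMP w hs hs'), Matrix.smul_apply, nsmul_eq_mul]
    congr 1
    exact (hcM ((a : ℕ) - b) (by omega) w p q).symm
  rw [jetCoord_change n hs' ht, hcoord w hs hs', Matrix.vecMul_vecMul, hMw,
    jetTrans_mul_jetTrans n ht hs' ht, jetTrans_self n ht, Matrix.vecMul_one]

theorem jetGram_eq_of_jetCoord_eq (hΦ : IsJetHolIsometry hZ n h h' Φ) {s : HolFrame l E}
    {t : HolFrame l E'} {w : Ω'} (hs : zPoint hZ w ∈ s.dom) (ht : zPoint hZ w ∈ t.dom)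
    (hst : ∀ v, jetCoord n t ht (Φ w v) = jetCoord n s hs v) :
    h.jetGram n s (zPoint hZ w) = h'.jetGram n t (zPoint hZ w) := by
  ext a b
  obtain ⟨u, hu⟩ := (jetCoord n s hs).surjective (Pi.single a 1)
  obtain ⟨v, hv⟩ := (jetCoord n s hs).surjective (Pi.single b 1)
  have h1 := hΦ.isometric w ⟨s, hs⟩ ⟨t, ht⟩ u v
  simp only [HermMetric.jetForm] at h1
  rw [← jetCoord_apply n t ht, ← jetCoord_apply n t ht, ← jetCoord_apply n s hs,
    ← jetCoord_apply n s hs, hst, hst, hu, hv] at h1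
  have h2 : star (Pi.single b 1 : Fin (n + 1) × Fin l → ℂ) = Pi.single b 1 := by
    rw [← Pi.single_star, star_one]
  rw [h2] at h1
  simpa using h1.symm

/-- Partner frames change in the same way as the original ones. Hence the map `Ψ` built from them
does not depend on the frames used. -/
theorem jetTrans_eq_of_jetCoord_eq {s s₂ : HolFrame l E} {t t₂ : HolFrame l E'} {w : Ω'}
    (hs : zPoint hZ w ∈ s.dom) (hs₂ : zPoint hZ w ∈ s₂.dom)
    (ht : zPoint hZ w ∈ t.dom) (ht₂ : zPoint hZ w ∈ t₂.dom)
    (hst : ∀ v, jetCoord n t ht (Φ w v) = jetCoord n s hs v)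
    (hst₂ : ∀ v, jetCoord n t₂ ht₂ (Φ w v) = jetCoord n s₂ hs₂ v) :
    s.jetTrans n s₂ (zPoint hZ w) = t.jetTrans n t₂ (zPoint hZ w) := by
  refine Matrix.ext_of_single_vecMul fun i => ?_
  obtain ⟨v, hv⟩ := (jetCoord n s hs).surjective (Pi.single i 1)
  rw [← hv, ← jetCoord_change n hs hs₂, ← hst, ← jetCoord_change n ht ht₂, hst₂]

/-- Transition functions are holomorphic along the hypersurface. -/
theorem differentiableAt_iterate_trans (s t : HolFrame l E) (k : ℕ) (p q : Fin l) (w : Ω')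
    (hs : zPoint hZ w ∈ s.dom) (ht : zPoint hZ w ∈ t.dom) :
    DifferentiableAt ℂ (extendZero fun w : Ω' =>
      (dz 0)^[k] (fun y => s.trans t y p q) (zPoint hZ w)) w.1 := by
  let V : Opens (Fin (m + 1) → ℂ) := s.domain ⊓ t.domain
  have hV : ∀ y ∈ V, y ∈ Ω := fun y hy => t.domain_le hy.2
  obtain ⟨A, hA, hA0⟩ := exists_transOn (s := s) (t := t) hV (fun y hy => hy.1) fun y hy => hy.2
  refine differentiableAt_along_hypersurface (V := V) (f := (dzM 0)^[k] A p q) (fun j x _ => ?_)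
    ⟨HolFrame.mem_domain.2 hs, HolFrame.mem_domain.2 ht⟩ ?_
  · have h1 : dzbarM j.succ ((dzM 0)^[k] A) = 0 := by
      have h2 := iterate_dzbarM_iterate_dzM_comm j.succ 0 1 k A
      rw [Function.iterate_one, hA0, iterate_map_zero] at h2
      exact h2
    exact congrFun (congrArg Subtype.val (congrFun (congrFun h1 p) q)) x
  · filter_upwards [Ω'.isOpen.mem_nhds w.2] with w' hw' hwV
    rw [← evalMat_apply, ← iterate_dz_of_represents hA]
    exact extendZero_apply (fun w : Ω' => (dz 0)^[k] (fun y => s.trans t y p q) (zPoint hZ w))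
      ⟨w', hw'⟩

/-- Contact of order `n` gives an isometry along the hypersurface that intertwines the covariant
derivatives of the curvature. -/
theorem exists_isometry_of_contact (hc : HasContactAlong hZ n h h') (hn : 1 ≤ n) :
    ∃ Ψ : ∀ w : Ω', E (zPoint hZ w) ≃ₗ[ℂ] E' (zPoint hZ w),
      IsHolIsometry hZ h h' Ψ ∧
      (∀ r t : ℕ, r ≤ n - 1 → t ≤ n - 1 → IntertwinesCovCurv hZ h h' Ψ 0 r t) ∧
      (∀ r : ℕ, r ≤ n - 1 → ∀ j : Fin (m + 1), j ≠ 0 →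
        IntertwinesCovCurv hZ h h' Ψ j r 0) := by
  obtain ⟨Φ, hΦ, hP⟩ := hc
  choose t ht1 htΩ ht2 using exists_frame_of_jetIso hΦ hP
  let s₀ (w : Ω') : HolFrame l E := trivFrame l E (zPoint hZ w)
  let s₁ (w : Ω') : HolFrame l E' := trivFrame l E' (zPoint hZ w)
  have hs₀ (w : Ω') : zPoint hZ w ∈ (s₀ w).dom := mem_dom_trivFrame _
  have hs₁ (w : Ω') : zPoint hZ w ∈ (s₁ w).dom := mem_dom_trivFrame _
  choose ht₀ ht₀' using fun w => ht2 (s₀ w) (s₁ w) w (hs₀ w) (hs₁ w)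
  -- The definition uses, at each point separately, the partner of a trivialization frame; `hΨ`
  -- shows that every other frame and its partner give the same map.
  let Ψ (w : Ω') : E (zPoint hZ w) ≃ₗ[ℂ] E' (zPoint hZ w) :=
    ((s₀ w).basis (hs₀ w)).equiv ((t (s₀ w) (s₁ w)).basis (ht₀ w)) (Equiv.refl _)
  have hΨ₀ (w : Ω') (p) : Ψ w ((s₀ w).sec p (zPoint hZ w)) =
      (t (s₀ w) (s₁ w)).sec p (zPoint hZ w) := by
    rw [← HolFrame.basis_apply _ (hs₀ w), ← HolFrame.basis_apply _ (ht₀ w)]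
    exact Module.Basis.equiv_apply _ _ _ _
  have hΨ (s : HolFrame l E) (s' : HolFrame l E') (w : Ω') (hs : zPoint hZ w ∈ s.dom)
      (hs' : zPoint hZ w ∈ s'.dom) (p) :
      Ψ w (s.sec p (zPoint hZ w)) = (t s s').sec p (zPoint hZ w) := by
    obtain ⟨ht, hst⟩ := ht2 s s' w hs hs'
    have h1 := trans_eq_of_jetTrans_eq
      (jetTrans_eq_of_jetCoord_eq hs (hs₀ w) ht (ht₀ w) hst (ht₀' w))
    rw [s.sec_eq_sum (s₀ w) (hs₀ w), (t s s').sec_eq_sum _ (ht₀ w), h1]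
    simp only [map_sum, map_smul, hΨ₀]
  have hgram (s : HolFrame l E) (s' : HolFrame l E') (w : Ω') (hs : zPoint hZ w ∈ s.dom)
      (hs' : zPoint hZ w ∈ s'.dom) :
      h.jetGram n s (zPoint hZ w) = h'.jetGram n (t s s') (zPoint hZ w) := by
    obtain ⟨ht, hst⟩ := ht2 s s' w hs hs'
    exact jetGram_eq_of_jetCoord_eq hΦ hs ht hst
  have hinter (s : HolFrame l E) (s' : HolFrame l E') (w : Ω') (hs : zPoint hZ w ∈ s.dom)
      (hs' : zPoint hZ w ∈ s'.dom) :
      (∀ r k : ℕ, r < n → k < n →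
        h.covCurvMat s 0 r k (zPoint hZ w) = h'.covCurvMat (t s s') 0 r k (zPoint hZ w)) ∧
      (∀ r : ℕ, r < n → ∀ j : Fin m,
        h.covCurvMat s j.succ r 0 (zPoint hZ w) =
          h'.covCurvMat (t s s') j.succ r 0 (zPoint hZ w)) := by
    obtain ⟨ht, hst⟩ := ht2 s s' w hs hs'
    let V : Opens (Fin (m + 1) → ℂ) := s.domain ⊓ (t s s').domain
    have hV : ∀ y ∈ V, y ∈ Ω := fun y hy => s.domain_le hy.1
    have hx : (zPoint hZ w).1 ∈ V := ⟨HolFrame.mem_domain.2 hs, HolFrame.mem_domain.2 ht⟩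
    obtain ⟨D⟩ := exists_gramOn h s hV fun y hy => hy.1
    obtain ⟨D'⟩ := exists_gramOn h' (t s s') hV fun y hy => hy.2
    -- Contact is known only over `Ω'`. Points of `V` with `z_1 = 0` lie over `Ω'` because the
    -- domain of the partner frame was confined there.
    have hjets := (jetGram_eq_iff (n := n) D D').1 fun x hx0 => by
      have h1 := hgram s s' ⟨Fin.tail x.1, htΩ s s' x.1 x.2.2⟩
      have h2 : zPoint hZ ⟨Fin.tail x.1, htΩ s s' x.1 x.2.2⟩ = ⟨x.1, hV _ x.2⟩ := by
        refine Subtype.ext ?_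
        change (Fin.cons 0 (Fin.tail x.1) : Fin (m + 1) → ℂ) = x.1
        rw [← hx0, Fin.cons_self_tail]
      rw [h2] at h1
      exact h1 (s.mem_dom x.2.1 _) (s'.mem_dom (ht1 s s' x.2.2) _)
    refine ⟨fun r k hr hk => ?_, fun r hr j => ?_⟩
    · exact (evalZ_represents (D.represents_covCurv 0 r k) (D'.represents_covCurv 0 r k)).1
        (evalZ_covCurv_zero_of_jets D D' hjets hr hk) ⟨_, hx⟩ rfl
    · exact (evalZ_represents (D.represents_covCurv _ r 0) (D'.represents_covCurv _ r 0)).1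
        (evalZ_covCurv_succ_of_jets D D' hjets hr j) ⟨_, hx⟩ rfl
  -- The arbitrary frame `s'` is exchanged for the partner of `s`; then `Ψ` maps frame to frame and
  -- the two endomorphisms have the same matrix.
  have hfinal (j r k) (hjrk : ∀ (s : HolFrame l E) (s' : HolFrame l E') (w : Ω'),
      zPoint hZ w ∈ s.dom → zPoint hZ w ∈ s'.dom →
      h.covCurvMat s j r k (zPoint hZ w) = h'.covCurvMat (t s s') j r k (zPoint hZ w)) :
      IntertwinesCovCurv hZ h h' Ψ j r k := by
    intro w s s' hs hs' v
    obtain ⟨ht, -⟩ := ht2 s s' w hs hs'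
    rw [covCurv_congr h' hs' ht]
    unfold HermMetric.covCurv
    rw [← hjrk s s' w hs hs']
    exact intertwines_of_matrix_eq hs ht (Ψ w).toLinearMap (hΨ s s' w hs hs') _ v
  refine ⟨Ψ, ⟨fun s s' p q => ?_, fun w u v => ?_⟩, fun r k hr hk => hfinal 0 r k
    fun s s' w hs hs' => (hinter s s' w hs hs').1 r k (by omega) (by omega), fun r hr j hj => ?_⟩
  · rintro _ ⟨w, ⟨hs, hs'⟩, rfl⟩
    obtain ⟨ht, -⟩ := ht2 s s' w hs hs'
    refine DifferentiableAt.differentiableWithinAt ?_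
    -- The matrix of `Ψ` with respect to `s` and `s'` is the transition matrix from the partner of
    -- `s` to `s'`.
    refine (differentiableAt_iterate_trans (hZ := hZ) (t s s') s' 0 p q w ht
      hs').congr_of_eventuallyEq ?_
    have hopen : IsOpen {w : Ω' | zPoint hZ w ∈ s.dom ∧ zPoint hZ w ∈ s'.dom} := by
      have hcont : Continuous (zPoint hZ) :=
        Continuous.subtype_mk ((consZero m).continuous.comp continuous_subtype_val) _
      exact (s.isOpen_dom.preimage hcont).inter (s'.isOpen_dom.preimage hcont)
    filter_upwards [(Ω'.isOpen.isOpenMap_subtype_val _ hopen).mem_nhds ⟨w, ⟨hs, hs'⟩, rfl⟩]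
    rintro _ ⟨w', ⟨hs, hs'⟩, rfl⟩
    rw [extendZero_apply, extendZero_apply, hΨ s s' w' hs hs']
    rfl
  · refine isometric_of_gram_eq (hs₀ w) (Ψ w).toLinearMap (hΨ₀ w) ?_ u v
    ext p q
    exact congrFun (congrFun (hgram (s₀ w) (s₁ w) w (hs₀ w) (hs₁ w)) (0, p)) (0, q)
  · obtain ⟨j, rfl⟩ := Fin.exists_succ_eq.2 hj
    exact hfinal _ r 0 fun s s' w hs hs' => (hinter s s' w hs hs').2 r (by omega) j

end Forward

/-! ### From the intertwining of curvatures to contact -/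

/-- The left factor `A` of a product `H = A K A'` is determined by `H`, `K` and `A'`. -/
theorem AgreeTo.of_mul_mul {S T : Type*} [Ring S] [Ring T] {D : S →+ S} {ev : S →+* T} {N : ℕ}
    (hD : IsDeriv D) {A A' H K G B B' F L M : S} (hH : H = A * K * A') (hF : F = B * L * B')
    (hA' : IsUnit A') (hB' : IsUnit B') (hKG : K * G = 1) (hGK : G * K = 1) (hLM : L * M = 1)
    (hML : M * L = 1) (h1 : AgreeTo D ev N A' B') (h2 : AgreeTo D ev N H F)
    (h3 : AgreeTo D ev N K L) : AgreeTo D ev N A B := by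
  obtain ⟨⟨A', C, hAC, hCA⟩, rfl⟩ := hA'
  obtain ⟨⟨B', C', hBC, hCB⟩, rfl⟩ := hB'
  simp only at hH hF h1
  have eA : H * C * G = A := by
    rw [hH, mul_assoc (A * K), hAC, mul_one, mul_assoc, hKG, mul_one]
  have eB : F * C' * M = B := by
    rw [hF, mul_assoc (B * L), hBC, mul_one, mul_assoc, hLM, mul_one]
  rw [← eA, ← eB]
  exact (h2.mul hD (h1.inv hD hAC hCA hBC hCB)).mul hD (h3.inv hD hKG hGK hLM hML)

section Backward

open Topology

variable {m : ℕ} {Ω : Opens (Fin (m + 1) → ℂ)} {Ω' : Opens (Fin m → ℂ)} {l : ℕ} {E : Ω → Type*}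
  [TopologicalSpace (TotalSpace (Fin l → ℂ) E)] [∀ x, TopologicalSpace (E x)]
  [∀ x, AddCommGroup (E x)] [∀ x, Module ℂ (E x)]
  [FiberBundle (Fin l → ℂ) E] {E' : Ω → Type*}
  [TopologicalSpace (TotalSpace (Fin l → ℂ) E')] [∀ x, TopologicalSpace (E' x)]
  [∀ x, AddCommGroup (E' x)] [∀ x, Module ℂ (E' x)]
  [FiberBundle (Fin l → ℂ) E']
  {hZ : ∀ w ∈ Ω', (Fin.cons 0 w : Fin (m + 1) → ℂ) ∈ Ω}
  {h : HermMetric l E} {h' : HermMetric l E'}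
  {Ψ : ∀ w : Ω', E (zPoint hZ w) ≃ₗ[ℂ] E' (zPoint hZ w)} {n : ℕ}

/-- The frame `s` restricted to a smaller open set. -/
def HolFrame.restrict (s : HolFrame l E) (U : Set Ω) (hU : IsOpen U) : HolFrame l E where
  dom := s.dom ∩ U
  isOpen_dom := s.isOpen_dom.inter hU
  sec := s.sec
  isFrame := s.isFrame.mono Set.inter_subset_left

theorem zPoint_eq_of_mem {x : Fin (m + 1) → ℂ} (hx : x ∈ Ω) (hx0 : x 0 = 0)
    (ht : Fin.tail x ∈ Ω') : zPoint hZ ⟨Fin.tail x, ht⟩ = ⟨x, hx⟩ := by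
  refine Subtype.ext ?_
  change (Fin.cons 0 (Fin.tail x) : Fin (m + 1) → ℂ) = x
  rw [← hx0, Fin.cons_self_tail]

/-- The map `Ψ` takes the frame `s` to the frame `t` along the hypersurface, where the derivatives
`∂_{z_1}^j H`, `j ≤ k`, of the Gram matrices agree. -/
structure IsAdapted (hZ : ∀ w ∈ Ω', (Fin.cons 0 w : Fin (m + 1) → ℂ) ∈ Ω)
    (h : HermMetric l E) (h' : HermMetric l E')
    (Ψ : ∀ w : Ω', E (zPoint hZ w) ≃ₗ[ℂ] E' (zPoint hZ w)) (k : ℕ) (s : HolFrame l E)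
    (t : HolFrame l E') : Prop where
  le : t.domain ≤ s.domain
  tail_mem : ∀ x ∈ t.domain, Fin.tail x ∈ Ω'
  map_sec : ∀ w, zPoint hZ w ∈ t.dom → ∀ p, Ψ w (s.sec p (zPoint hZ w)) = t.sec p (zPoint hZ w)
  gramDeriv_eq : ∀ j ≤ k, ∀ w, zPoint hZ w ∈ t.dom →
    h.gramDeriv s j (zPoint hZ w) = h'.gramDeriv t j (zPoint hZ w)

variable {s s₂ : HolFrame l E} {t t₂ : HolFrame l E'} {k : ℕ}

theorem IsAdapted.mem_dom (hst : IsAdapted hZ h h' Ψ k s t) {x : Ω} (hx : x ∈ t.dom) : x ∈ s.dom :=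
  HolFrame.mem_domain.1 (hst.le (HolFrame.mem_domain.2 hx))

/-- Matrix functions that agree along the hypersurface. -/
theorem IsAdapted.evalZ_eq (hst : IsAdapted hZ h h' Ψ k s t) {V : Opens (Fin (m + 1) → ℂ)}
    {hV : ∀ x ∈ V, x ∈ Ω} (hVt : V ≤ t.domain) {F F' : Ω → Matrix (Fin l) (Fin l) ℂ}
    {X X' : Matrix (Fin l) (Fin l) (smoothFun V)} (hF : Represents hV F X)
    (hF' : Represents hV F' X')
    (hFF' : ∀ w, zPoint hZ w ∈ t.dom → F (zPoint hZ w) = F' (zPoint hZ w)) :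
    evalZ V l X = evalZ V l X' := by
  refine (evalZ_represents hF hF').2 fun x hx0 => ?_
  have h1 := hFF' ⟨Fin.tail x.1, hst.tail_mem x.1 (hVt x.2)⟩
  rw [zPoint_eq_of_mem (hV _ x.2) hx0] at h1
  exact h1 (t.mem_dom (hVt x.2) _)

theorem IsAdapted.evalZ_gram_eq (hst : IsAdapted hZ h h' Ψ k s t) {V : Opens (Fin (m + 1) → ℂ)}
    {hV : ∀ x ∈ V, x ∈ Ω} (hVt : V ≤ t.domain) (D : GramOn h s hV) (D' : GramOn h' t hV) (j : ℕ)
    (hj : j ≤ k) : evalZ V l ((dzM 0)^[j] D.H) = evalZ V l ((dzM 0)^[j] D'.H) :=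
  hst.evalZ_eq hVt (D.represents_gramDeriv j) (D'.represents_gramDeriv j) (hst.gramDeriv_eq j hj)

theorem IsAdapted.covCurvMat_eq (hst : IsAdapted hZ h h' Ψ k s t) {j : Fin (m + 1)} {r q : ℕ}
    (hK : IntertwinesCovCurv hZ h h' Ψ j r q) (w : Ω') (ht : zPoint hZ w ∈ t.dom) :
    h.covCurvMat s j r q (zPoint hZ w) = h'.covCurvMat t j r q (zPoint hZ w) := by
  refine Matrix.ext_of_single_vecMul fun i => ?_
  have h1 := hK w s t (hst.mem_dom ht) ht (∑ p, (Pi.single i 1 : Fin l → ℂ) p • s.sec p (zPoint hZ w))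
  have h2 (c : Fin l → ℂ) : Ψ w (∑ p, c p • s.sec p (zPoint hZ w)) =
      ∑ p, c p • t.sec p (zPoint hZ w) := by
    simp only [map_sum, map_smul, hst.map_sec w ht]
  rw [HermMetric.covCurv, HermMetric.covCurv, s.toEnd_sum, h2, h2, t.toEnd_sum] at h1
  funext q'
  rw [← t.coeff_sum ht (Pi.single i 1 ᵥ* h.covCurvMat s j r q (zPoint hZ w)) q', h1, t.coeff_sum ht]

theorem IsAdapted.evalZ_covCurv_eq (hst : IsAdapted hZ h h' Ψ k s t) {V : Opens (Fin (m + 1) → ℂ)}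
    {hV : ∀ x ∈ V, x ∈ Ω} (hVt : V ≤ t.domain) (D : GramOn h s hV) (D' : GramOn h' t hV)
    {j : Fin (m + 1)} {r q : ℕ} (hK : IntertwinesCovCurv hZ h h' Ψ j r q) :
    evalZ V l (D.covCurv j r q) = evalZ V l (D'.covCurv j r q) :=
  hst.evalZ_eq hVt (D.represents_covCurv j r q) (D'.represents_covCurv j r q) (hst.covCurvMat_eq hK)

theorem gram_eq_of_isometric (hΨ : IsHolIsometry hZ h h' Ψ) {w : Ω'}
    (hst : ∀ p, Ψ w (s.sec p (zPoint hZ w)) = t.sec p (zPoint hZ w)) :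
    h.gram s (zPoint hZ w) = h'.gram t (zPoint hZ w) := by
  ext p q
  change h.form _ _ _ = h'.form _ _ _
  rw [← hst, ← hst, hΨ.isometric]

theorem IsAdapted.jetGram_eq (hst : IsAdapted hZ h h' Ψ n s t)
    (hK : ∀ r < n, ∀ q < n, IntertwinesCovCurv hZ h h' Ψ 0 r q) (w : Ω')
    (ht : zPoint hZ w ∈ t.dom) :
    h.jetGram n s (zPoint hZ w) = h'.jetGram n t (zPoint hZ w) := by
  have hV : ∀ x ∈ t.domain, x ∈ Ω := fun x hx => t.domain_le hx
  obtain ⟨D⟩ := exists_gramOn h s hV hst.le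
  obtain ⟨D'⟩ := exists_gramOn h' t hV le_rfl
  exact (jetGram_eq_iff D D').2 (jets_of_evalZ_covCurv D D'
    (fun j hj => hst.evalZ_gram_eq le_rfl D D' j hj)
    fun r hr q hq => hst.evalZ_covCurv_eq le_rfl D D' (hK r hr q hq))
    ⟨_, HolFrame.mem_domain.2 ht⟩ rfl

theorem IsAdapted.agreeTo_gram (hst : IsAdapted hZ h h' Ψ n s t) {V : Opens (Fin (m + 1) → ℂ)}
    {hV : ∀ x ∈ V, x ∈ Ω} (D : GramOn h s hV) (D' : GramOn h' t hV) (w : Ω')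
    (hw : (zPoint hZ w).1 ∈ V) (ht : zPoint hZ w ∈ t.dom) :
    AgreeTo (dzM 0) (evalMat ⟨(zPoint hZ w).1, hw⟩) n D.H D'.H := by
  intro k hk
  have h1 := D.represents_gramDeriv k ⟨_, hw⟩
  have h2 := D'.represents_gramDeriv k ⟨_, hw⟩
  rw [← h1, ← h2]
  exact hst.gramDeriv_eq k hk w ht

theorem IsAdapted.trans_eq (hst : IsAdapted hZ h h' Ψ n s t)
    (hst₂ : IsAdapted hZ h h' Ψ n s₂ t₂) (w : Ω') (ht : zPoint hZ w ∈ t.dom)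
    (ht₂ : zPoint hZ w ∈ t₂.dom) :
    s.trans s₂ (zPoint hZ w) = t.trans t₂ (zPoint hZ w) := by
  ext p q
  change _ = t₂.isFrame.coeff q (zPoint hZ w) (t.sec p (zPoint hZ w))
  rw [← hst.map_sec w ht, s.sec_eq_sum s₂ (hst₂.mem_dom ht₂), map_sum]
  simp only [map_smul, hst₂.map_sec w ht₂]
  exact (t₂.coeff_sum ht₂ _ q).symm

section VectorBundle

variable [VectorBundle ℂ (Fin l → ℂ) E']
  [ContMDiffVectorBundle ω (Fin l → ℂ) E' 𝓘(ℂ, Fin (m + 1) → ℂ)]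

/-- The defect `X = Γ_{k+1} - Γ'_{k+1}` is holomorphic along the hypersurface, by the curvature
expansion and condition (ii) up to order `k`. A change of frame with `A = 1 + z_1^{k+1} X / (k+1)!`
adds `X H'` to `∂_{z_1}^{k+1} H'` there and leaves the lower derivatives and the frame itself
unchanged on the hypersurface. -/
theorem IsAdapted.exists_succ (hst : IsAdapted hZ h h' Ψ k s t)
    (hK : ∀ r ≤ k, ∀ j : Fin (m + 1), j ≠ 0 → IntertwinesCovCurv hZ h h' Ψ j r 0) (w₀ : Ω')
    (hw₀ : zPoint hZ w₀ ∈ t.dom) :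
    ∃ u, zPoint hZ w₀ ∈ u.dom ∧ IsAdapted hZ h h' Ψ (k + 1) s u := by
  let V := t.domain
  have hV : ∀ x ∈ V, x ∈ Ω := fun x hx => t.domain_le hx
  obtain ⟨D⟩ := exists_gramOn h s hV hst.le
  obtain ⟨D'⟩ := exists_gramOn h' t hV le_rfl
  let X := (dzM 0)^[k + 1] D.H * D.G - (dzM 0)^[k + 1] D'.H * D'.G
  have hX (i : Fin m) (x : V) (hx0 : x.1 0 = 0) : evalMat x (dzbarM i.succ X) = 0 := by
    have h1 := evalZ_dzbarM_connection D D' (k := k)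
      (fun j hj => hst.evalZ_gram_eq le_rfl D D' j hj) i
      fun r hr => hst.evalZ_covCurv_eq le_rfl D D' (hK r hr _ (Fin.succ_ne_zero i))
    rw [evalZ_eq_iff] at h1
    rw [map_sub, map_sub, h1 x hx0, sub_self]
  let W := sliceZ V
  let g (w : Fin m → ℂ) : Matrix (Fin l) (Fin l) ℂ :=
    open Classical in if hw : w ∈ W then evalMat ⟨Fin.cons 0 w, hw⟩ X else 0
  let c (j : ℕ) (w : Fin m → ℂ) : Matrix (Fin l) (Fin l) ℂ :=
    if j = 0 then 1 else if j = k + 1 then g w else 0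
  have hg (p q) : DifferentiableOn ℂ (fun w => g w p q) W := fun w hw => by
    refine (differentiableAt_along_hypersurface (f := X p q) (fun i x hx0 => ?_) hw
      (Filter.Eventually.of_forall fun w' hw' => ?_)).differentiableWithinAt
    · exact congrFun (congrFun (hX i x hx0) p) q
    · have h1 : g w' = evalMat ⟨Fin.cons 0 w', hw'⟩ X := dif_pos hw'
      exact congrFun (congrFun h1 p) q
  have hc (j p q) : DifferentiableOn ℂ (fun w => c j w p q) W := by
    by_cases hj0 : j = 0
    · simp only [c, if_pos hj0]
      exact differentiableOn_const _
    by_cases hj1 : j = k + 1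
    · simp only [c, if_neg hj0, if_pos hj1]
      exact hg p q
    · simp only [c, if_neg hj0, if_neg hj1]
      exact differentiableOn_const _
  obtain ⟨u, hu1, hu2, hu3, A, hA, hAc⟩ :=
    exists_frame_of_taylor t (k + 1) W (fun w hw => hw) c hc fun w _ => isUnit_one
  have htrans (w) (hu : zPoint hZ w ∈ u.dom) : u.trans t (zPoint hZ w) = 1 :=
    (hA ⟨_, HolFrame.mem_domain.2 hu⟩).trans (hAc ⟨_, HolFrame.mem_domain.2 hu⟩ rfl 0 (Nat.zero_le _))
  have hdom (w) (hu : zPoint hZ w ∈ u.dom) : zPoint hZ w ∈ t.dom :=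
    HolFrame.mem_domain.1 (hu1 (HolFrame.mem_domain.2 hu))
  refine ⟨u, HolFrame.mem_domain.1 (hu2 w₀.1 (HolFrame.mem_domain.2 hw₀)),
    fun x hx => hst.le (hu1 hx), fun x hx => hst.tail_mem x (hu1 hx), fun w hu p => ?_,
    fun j hj w hu => ?_⟩
  · rw [hst.map_sec w (hdom w hu), u.sec_eq_sum t (hdom w hu), htrans w hu]
    simp [Matrix.one_apply]
  · obtain ⟨A', hA', -, hA0'⟩ := exists_conjTranspose A
    have hVu : ∀ x ∈ u.domain, x ∈ Ω := fun _ => u.domain_le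
    obtain ⟨Ds⟩ := exists_gramOn h s hVu fun x hx => hst.le (hu1 hx)
    obtain ⟨Dt⟩ := exists_gramOn h' t hVu hu1
    obtain ⟨Du⟩ := exists_gramOn h' u hVu le_rfl
    have hA0 : dzbarM 0 A = 0 := by
      obtain ⟨B, hB, hB0⟩ := exists_transOn (s := u) (t := t) hVu le_rfl hu1
      have : A = B := ext_evalMat fun y => by rw [← hA y, ← hB y]
      rw [this, hB0]
    have hH : Du.H = A * Dt.H * A' := ext_evalMat fun y => by
      rw [map_mul, map_mul, hA', ← hA y, ← Du.rep y, ← Dt.rep y]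
      exact u.gram_eq h' (t.mem_dom (hu1 y.2) _)
    let x : u.domain := ⟨(zPoint hZ w).1, HolFrame.mem_domain.2 hu⟩
    let y : V := ⟨(zPoint hZ w).1, HolFrame.mem_domain.2 (hdom w hu)⟩
    have hx1 : evalMat x A = 1 := hAc x rfl 0 (Nat.zero_le _)
    have hs (i : ℕ) : evalMat x ((dzM 0)^[i] Ds.H) = h.gramDeriv s i (zPoint hZ w) :=
      (Ds.represents_gramDeriv i x).symm
    have ht (i : ℕ) : evalMat x ((dzM 0)^[i] Dt.H) = h'.gramDeriv t i (zPoint hZ w) :=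
      (Dt.represents_gramDeriv i x).symm
    have hs' (i : ℕ) : evalMat y ((dzM 0)^[i] D.H) = h.gramDeriv s i (zPoint hZ w) :=
      (D.represents_gramDeriv i y).symm
    have ht' (i : ℕ) : evalMat y ((dzM 0)^[i] D'.H) = h'.gramDeriv t i (zPoint hZ w) :=
      (D'.represents_gramDeriv i y).symm
    -- The right factor `A'` is constant for `∂_{z_1}` and equals `1` on the hypersurface, so only
    -- `A` contributes.
    have e1 : h'.gramDeriv u j (zPoint hZ w) = evalMat x ((dzM 0)^[j] (A * Dt.H)) := by
      have e0 : h'.gramDeriv u j (zPoint hZ w) = evalMat x ((dzM 0)^[j] Du.H) :=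
        Du.represents_gramDeriv j x
      rw [e0, hH, (isDeriv_dzM 0).iterate_mul_of_right (hA0' 0 hA0), map_mul, hA', hx1,
        Matrix.conjTranspose_one, mul_one]
    have e2 : evalMat x ((dzM 0)^[j] (A * Dt.H)) = ∑ b ∈ Finset.range (j + 1),
        j.choose b • (c (j - b) w.1 * h'.gramDeriv t b (zPoint hZ w)) := by
      rw [(isDeriv_dzM 0).iterate_mul, map_sum]
      refine Finset.sum_congr rfl fun b _ => ?_
      rw [map_nsmul, map_mul, ht, hAc x rfl _ (by omega)]
      rfl
    rw [e1, e2, Finset.sum_range_succ, Nat.sub_self, Nat.choose_self, one_smul]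
    have hc00 : c 0 w.1 = 1 := rfl
    rw [hc00, one_mul]
    rcases Nat.lt_or_ge j (k + 1) with hjk | hjk
    · rw [Finset.sum_eq_zero, zero_add, hst.gramDeriv_eq j (by omega) w (hdom w hu)]
      intro b hb
      have hb' := Finset.mem_range.1 hb
      have : c (j - b) w.1 = 0 := by
        simp only [c]
        rw [if_neg (by omega), if_neg (by omega)]
      rw [this, zero_mul, smul_zero]
    · obtain rfl : j = k + 1 := by omega
      -- With the summand `b = k + 1` already split off, only `b = 0` survives, where all
      -- derivatives fall on `A`; it contributes the correction `X * H'`.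
      rw [Finset.sum_eq_single 0]
      · have hcg : c (k + 1) w.1 = evalMat y X := by
          have hwW : w.1 ∈ W := y.2
          have h1 : c (k + 1) w.1 = g w.1 := by simp [c]
          exact h1.trans (dif_pos hwW)
        have h0 : evalMat y D.H = evalMat y D'.H :=
          (hs' 0).trans ((hst.gramDeriv_eq 0 (Nat.zero_le _) w (hdom w hu)).trans (ht' 0).symm)
        have hX1 : evalMat y X * evalMat y D'.H =
            h.gramDeriv s (k + 1) (zPoint hZ w) - h'.gramDeriv t (k + 1) (zPoint hZ w) := by
          have h1 : evalMat y X = evalMat y ((dzM 0)^[k + 1] D.H) * evalMat y D.G -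
              evalMat y ((dzM 0)^[k + 1] D'.H) * evalMat y D'.G := by
            rw [map_sub, map_mul, map_mul]
          have h2 : evalMat y D.G * evalMat y D.H = 1 := by rw [← map_mul, D.inv_mul, map_one]
          have h3 : evalMat y D'.G * evalMat y D'.H = 1 := by rw [← map_mul, D'.inv_mul, map_one]
          rw [h1, sub_mul, mul_assoc, mul_assoc, h3, ← h0, h2, hs', ht', mul_one, mul_one]
        have h4 : h'.gramDeriv t 0 (zPoint hZ w) = evalMat y D'.H := (ht' 0).symm
        rw [Nat.sub_zero, hcg, h4, hX1, Nat.choose_zero_right, one_smul, sub_add_cancel]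
      · intro b hb hb0
        have hb' := Finset.mem_range.1 hb
        have : c (k + 1 - b) w.1 = 0 := by
          simp only [c]
          rw [if_neg (by omega), if_neg (by omega)]
        rw [this, zero_mul, smul_zero]
      · intro h0
        exact absurd (Finset.mem_range.2 (Nat.succ_pos k)) h0

variable [VectorBundle ℂ (Fin l → ℂ) E]
  [ContMDiffVectorBundle ω (Fin l → ℂ) E 𝓘(ℂ, Fin (m + 1) → ℂ)]

/-- The matrix of `Ψ` in trivialization frames, extended constantly in `z_1`, turns the frame of
`E'` into an extension of the image of `s`; isometry gives equal Gram matrices on the hypersurface.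
-/
theorem exists_isAdapted_zero (hΨ : IsHolIsometry hZ h h' Ψ) (w₀ : Ω') :
    ∃ s t, zPoint hZ w₀ ∈ t.dom ∧ IsAdapted hZ h h' Ψ 0 s t := by
  let s : HolFrame l E := trivFrame l E (zPoint hZ w₀)
  -- The restriction guarantees that the domain of the final frame `t` lies in that of `s`.
  let s' : HolFrame l E' := (trivFrame l E' (zPoint hZ w₀)).restrict s.dom s.isOpen_dom
  let W : Opens (Fin m → ℂ) := sliceZ s'.domain ⊓ Ω'
  have hWs' (w : Ω') (hw : w.1 ∈ W) : zPoint hZ w ∈ s'.dom := HolFrame.mem_domain.1 hw.1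
  have hWs (w : Ω') (hw : w.1 ∈ W) : zPoint hZ w ∈ s.dom := (hWs' w hw).2
  let g (p q : Fin l) (w : Ω') : ℂ :=
    s'.isFrame.coeff q (zPoint hZ w) (Ψ w (s.sec p (zPoint hZ w)))
  let c (j : ℕ) (w : Fin m → ℂ) : Matrix (Fin l) (Fin l) ℂ := Matrix.of fun p q =>
    if j = 0 then extendZero (g p q) w else 0
  have hc (j p q) : DifferentiableOn ℂ (fun w => c j w p q) W := by
    by_cases hj : j = 0
    · simp only [c, Matrix.of_apply, if_pos hj]
      exact (hΨ.holomorphic s s' p q).mono fun w hw =>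
        ⟨⟨w, hw.2⟩, ⟨hWs ⟨w, hw.2⟩ hw, hWs' ⟨w, hw.2⟩ hw⟩, rfl⟩
    · simp only [c, Matrix.of_apply, if_neg hj]
      exact differentiableOn_const 0
  have hcΨ (w : Ω') (hw : w.1 ∈ W) (v : Fin l → ℂ) : Ψ w (∑ p, v p • s.sec p (zPoint hZ w)) =
      ∑ q, (v ᵥ* c 0 w.1) q • s'.sec q (zPoint hZ w) := by
    have h1 (p : Fin l) : Ψ w (s.sec p (zPoint hZ w)) =
        ∑ q, c 0 w.1 p q • s'.sec q (zPoint hZ w) := by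
      simp only [c, Matrix.of_apply, if_true, extendZero_apply]
      exact (s'.sum_coeff (hWs' w hw) _).symm
    simp only [map_sum, map_smul, h1, Matrix.vecMul, dotProduct, Finset.sum_smul,
      Finset.smul_sum, smul_smul]
    rw [Finset.sum_comm]
  have hc0 (w) (hw : w ∈ W) : IsUnit (c 0 w) := by
    rw [← Matrix.vecMul_injective_iff_isUnit]
    refine (injective_iff_map_eq_zero (Matrix.vecMulLinear (c 0 w)).toAddMonoidHom).2 ?_
    intro v hv
    have hv' : v ᵥ* c 0 w = 0 := hv
    have h1 := hcΨ ⟨w, hw.2⟩ hw v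
    simp only [hv', Pi.zero_apply, zero_smul, Finset.sum_const_zero] at h1
    rw [LinearEquiv.map_eq_zero_iff] at h1
    funext p
    rw [← s.coeff_sum (hWs ⟨w, hw.2⟩ hw) v p, h1, map_zero]
    rfl
  obtain ⟨t, ht1, ht2, ht3, A, hA, hAc⟩ :=
    exists_frame_of_taylor s' 0 W (fun w hw => hw.1) c hc hc0
  have hmap (w) (ht : zPoint hZ w ∈ t.dom) (p) :
      Ψ w (s.sec p (zPoint hZ w)) = t.sec p (zPoint hZ w) := by
    have hx : (zPoint hZ w).1 ∈ t.domain := HolFrame.mem_domain.2 ht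
    have hw : w.1 ∈ W := ht3 _ hx
    have h2 : t.trans s' (zPoint hZ w) = c 0 w.1 :=
      (hA ⟨_, hx⟩).trans (hAc ⟨_, hx⟩ rfl 0 le_rfl)
    rw [t.sec_eq_sum s' (hWs' w hw), h2]
    simp only [c, Matrix.of_apply, if_true, extendZero_apply]
    exact (s'.sum_coeff (hWs' w hw) _).symm
  refine ⟨s, t, HolFrame.mem_domain.1 (ht2 w₀.1 ⟨?_, w₀.2⟩), fun x hx => ?_,
    fun x hx => (ht3 x hx).2, hmap, fun j hj w ht => ?_⟩
  · have h1 : zPoint hZ w₀ ∈ s'.dom := ⟨mem_dom_trivFrame _, mem_dom_trivFrame _⟩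
    exact HolFrame.mem_domain.2 h1
  · have hx' := s'.mem_dom (ht1 hx) (t.domain_le hx)
    exact HolFrame.mem_domain.2 hx'.2
  · obtain rfl := Nat.le_zero.1 hj
    exact gram_eq_of_isometric hΨ (hmap w ht)

theorem exists_isAdapted (hΨ : IsHolIsometry hZ h h' Ψ) (n : ℕ)
    (hK : ∀ r < n, ∀ j : Fin (m + 1), j ≠ 0 → IntertwinesCovCurv hZ h h' Ψ j r 0) (w₀ : Ω') :
    ∃ s t, zPoint hZ w₀ ∈ t.dom ∧ IsAdapted hZ h h' Ψ n s t := by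
  induction n with
  | zero => exact exists_isAdapted_zero hΨ w₀
  | succ n ih =>
    obtain ⟨s, t, ht, hst⟩ := ih fun r hr => hK r (by omega)
    obtain ⟨u, hu, hsu⟩ := hst.exists_succ (fun r hr => hK r (by omega)) w₀ ht
    exact ⟨s, u, hu, hsu⟩

/-- The jets of an adapted frame are determined by the map `Ψ`. -/
theorem IsAdapted.jetTrans_eq (hst : IsAdapted hZ h h' Ψ n s t)
    (hst₂ : IsAdapted hZ h h' Ψ n s₂ t₂) (w : Ω') (ht : zPoint hZ w ∈ t.dom)
    (ht₂ : zPoint hZ w ∈ t₂.dom) :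
    s.jetTrans n s₂ (zPoint hZ w) = t.jetTrans n t₂ (zPoint hZ w) := by
  let V : Opens (Fin (m + 1) → ℂ) := t.domain ⊓ t₂.domain
  have hV : ∀ y ∈ V, y ∈ Ω := fun y hy => t.domain_le hy.1
  let x : V := ⟨(zPoint hZ w).1, HolFrame.mem_domain.2 ht, HolFrame.mem_domain.2 ht₂⟩
  obtain ⟨A, hA, hA0⟩ := exists_transOn (s := s) (t := s₂) hV (fun y hy => hst.le hy.1)
    fun y hy => hst₂.le hy.2
  obtain ⟨B, hB, hB0⟩ := exists_transOn (s := t) (t := t₂) hV (fun y hy => hy.1) fun y hy => hy.2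
  obtain ⟨A', hA', -, hA0'⟩ := exists_conjTranspose A
  obtain ⟨B', hB', -, hB0'⟩ := exists_conjTranspose B
  obtain ⟨D⟩ := exists_gramOn h s hV fun y hy => hst.le hy.1
  obtain ⟨D₂⟩ := exists_gramOn h s₂ hV fun y hy => hst₂.le hy.2
  obtain ⟨F⟩ := exists_gramOn h' t hV fun y hy => hy.1
  obtain ⟨F₂⟩ := exists_gramOn h' t₂ hV fun y hy => hy.2
  have hD : D.H = A * D₂.H * A' := ext_evalMat fun y => by
    rw [map_mul, map_mul, hA', ← hA y, ← D.rep y, ← D₂.rep y]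
    exact s.gram_eq h (s₂.mem_dom (hst₂.le y.2.2) _)
  have hF : F.H = B * F₂.H * B' := ext_evalMat fun y => by
    rw [map_mul, map_mul, hB', ← hB y, ← F.rep y, ← F₂.rep y]
    exact t.gram_eq h' (t₂.mem_dom y.2.2 _)
  have hAB : evalMat x A = evalMat x B :=
    (hA x).symm.trans ((hst.trans_eq hst₂ w ht ht₂).trans (hB x))
  have hAu : IsUnit A' := isUnit_of_evalMat fun y => by
    rw [hA', Matrix.isUnit_conjTranspose, ← hA y]
    exact HolFrame.isUnit_trans (s.mem_dom (hst.le y.2.1) _) (s₂.mem_dom (hst₂.le y.2.2) _)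
  have hBu : IsUnit B' := isUnit_of_evalMat fun y => by
    rw [hB', Matrix.isUnit_conjTranspose, ← hB y]
    exact HolFrame.isUnit_trans (t.mem_dom y.2.1 _) (t₂.mem_dom y.2.2 _)
  -- The conjugate transposes are antiholomorphic: their values at `x` agree with those of each
  -- other because `A = B` there, and all their positive `∂_{z_1}`-derivatives vanish.
  have h1 : AgreeTo (dzM 0) (evalMat x) n A' B' := by
    intro k _
    cases k with
    | zero =>
      change evalMat x A' = evalMat x B'
      rw [hA', hB', hAB]
    | succ k =>
      rw [Function.iterate_succ_apply, Function.iterate_succ_apply, hA0' 0 (hA0 0),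
        hB0' 0 (hB0 0)]
  have h2 := hst.agreeTo_gram D F w x.2 ht
  have h3 := hst₂.agreeTo_gram D₂ F₂ w x.2 ht₂
  -- Solving `H = A K A'` for `A` expresses the `z_1`-jet of the transition matrix through data on
  -- which both sides agree.
  have h4 := AgreeTo.of_mul_mul (isDeriv_dzM 0) hD hF hAu hBu D₂.mul_inv D₂.inv_mul F₂.mul_inv
    F₂.inv_mul h1 h2 h3
  have e1 := jetTrans_eq_ofBlocks hA n x
  have e2 := jetTrans_eq_ofBlocks hB n x
  refine e1.trans (Eq.trans ?_ e2.symm)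
  congr 1
  funext a b
  rw [map_nsmul, map_nsmul, h4 _ (by omega)]

end VectorBundle

end Backward

/-! ### The jet isometry assembled from adapted frames, and the comparison of ranks. -/

section Contact

variable {m : ℕ} {Ω : Opens (Fin (m + 1) → ℂ)} {Ω' : Opens (Fin m → ℂ)} {l : ℕ} {E : Ω → Type*}
  [TopologicalSpace (TotalSpace (Fin l → ℂ) E)] [∀ x, TopologicalSpace (E x)]
  [∀ x, AddCommGroup (E x)] [∀ x, Module ℂ (E x)]
  [FiberBundle (Fin l → ℂ) E] [VectorBundle ℂ (Fin l → ℂ) E]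
  [ContMDiffVectorBundle ω (Fin l → ℂ) E 𝓘(ℂ, Fin (m + 1) → ℂ)] {n : ℕ}
  {hZ : ∀ w ∈ Ω', (Fin.cons 0 w : Fin (m + 1) → ℂ) ∈ Ω}

theorem continuous_zPoint : Continuous (zPoint hZ) :=
  Continuous.subtype_mk ((consZero m).continuous.comp continuous_subtype_val) _

theorem isOpen_image_zPoint_preimage {U : Set Ω} (hU : IsOpen U) :
    IsOpen (Subtype.val '' {w : Ω' | zPoint hZ w ∈ U}) :=
  Ω'.isOpen.isOpenMap_subtype_val _ (hU.preimage continuous_zPoint)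

/-- Transition matrices of jet bundles are holomorphic along the hypersurface. -/
theorem differentiableAt_jetTrans (s t : HolFrame l E) (w : Ω') (hs : zPoint hZ w ∈ s.dom)
    (ht : zPoint hZ w ∈ t.dom) (a b : Fin (n + 1) × Fin l) :
    DifferentiableAt ℂ (extendZero fun w : Ω' => s.jetTrans n t (zPoint hZ w) a b) w.1 := by
  refine ((differentiableAt_iterate_trans (hZ := hZ) s t ((a.1 : ℕ) - b.1) a.2 b.2 w hs
    ht).const_mul ((a.1 : ℕ).choose b.1 : ℂ)).congr_of_eventuallyEq ?_
  filter_upwards [Ω'.isOpen.mem_nhds w.2] with w' hw'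
  have e1 := extendZero_apply (fun w : Ω' => s.jetTrans n t (zPoint hZ w) a b) ⟨w', hw'⟩
  have e2 := extendZero_apply (fun w : Ω' =>
    (dz 0)^[(a.1 : ℕ) - b.1] (fun y => s.trans t y a.2 b.2) (zPoint hZ w)) ⟨w', hw'⟩
  simp only at e1 e2
  rw [e1, e2]
  rfl

variable {E' : Ω → Type*}
  [TopologicalSpace (TotalSpace (Fin l → ℂ) E')] [∀ x, TopologicalSpace (E' x)]
  [∀ x, AddCommGroup (E' x)] [∀ x, Module ℂ (E' x)]
  [FiberBundle (Fin l → ℂ) E'] [VectorBundle ℂ (Fin l → ℂ) E']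
  [ContMDiffVectorBundle ω (Fin l → ℂ) E' 𝓘(ℂ, Fin (m + 1) → ℂ)]
  {h : HermMetric l E} {h' : HermMetric l E'}
  {Ψ : ∀ w : Ω', E (zPoint hZ w) ≃ₗ[ℂ] E' (zPoint hZ w)}

/-- An isometry along the hypersurface that intertwines the covariant derivatives of the curvature
gives contact of order `n`. -/
theorem contact_of_isometry (hΨ : IsHolIsometry hZ h h' Ψ)
    (hK : ∀ r < n, ∀ q < n, IntertwinesCovCurv hZ h h' Ψ 0 r q)
    (hK' : ∀ r < n, ∀ j : Fin (m + 1), j ≠ 0 → IntertwinesCovCurv hZ h h' Ψ j r 0) :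
    HasContactAlong hZ n h h' := by
  choose s t ht hst using exists_isAdapted hΨ n hK'
  have hs (w) : zPoint hZ w ∈ (s w).dom := (hst w).mem_dom (ht w)
  -- Each `w` uses the adapted pair chosen for that point, with no continuity in the choice.
  let Φ (w : Ω') : JetFibre l E n (zPoint hZ w) ≃ₗ[ℂ] JetFibre l E' n (zPoint hZ w) :=
    (jetCoord n (s w) (hs w)).trans (jetCoord n (t w) (ht w)).symm
  have hΦ (w v) : jetCoord n (t w) (ht w) (Φ w v) = jetCoord n (s w) (hs w) v :=
    (jetCoord n (t w) (ht w)).apply_symm_apply _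
  refine ⟨Φ, ⟨fun u u' => ⟨fun w => u.jetTrans n (s w) (zPoint hZ w) *
    (t w).jetTrans n u' (zPoint hZ w), fun a b => ?_, fun w hu hu' v => ?_⟩,
    fun w u u' v₁ v₂ => ?_⟩, fun w v => ?_⟩
  · rintro _ ⟨w₀, ⟨hu, hu'⟩, rfl⟩
    refine DifferentiableAt.differentiableWithinAt ?_
    have h1 : DifferentiableAt ℂ (fun w => ∑ c,
        extendZero (fun w : Ω' => u.jetTrans n (s w₀) (zPoint hZ w) a c) w *
          extendZero (fun w : Ω' => (t w₀).jetTrans n u' (zPoint hZ w) c b) w) w₀.1 :=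
      DifferentiableAt.fun_sum fun c _ =>
        (differentiableAt_jetTrans u (s w₀) w₀ hu (hs w₀) a c).mul
          (differentiableAt_jetTrans (t w₀) u' w₀ (ht w₀) hu' c b)
    refine h1.congr_of_eventuallyEq ?_
    filter_upwards [(isOpen_image_zPoint_preimage ((u.isOpen_dom.inter u'.isOpen_dom).inter
      (t w₀).isOpen_dom)).mem_nhds ⟨w₀, ⟨⟨hu, hu'⟩, ht w₀⟩, rfl⟩]
    rintro _ ⟨w, ⟨⟨hu, hu'⟩, htw⟩, rfl⟩
    have hsw := (hst w₀).mem_dom htw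
    simp only [extendZero_apply]
    -- Near `w₀` the pair chosen at `w` may be replaced by the fixed pair chosen at `w₀`, since
    -- adapted pairs have equal jet transitions. The matrix of `Φ` is then a product of two
    -- holomorphic ones.
    rw [← Matrix.mul_apply, ← jetTrans_mul_jetTrans n hu hsw (hs w), mul_assoc,
      (hst w₀).jetTrans_eq (hst w) w htw (ht w), jetTrans_mul_jetTrans n htw (ht w) hu']
  · change jetCoord n u' hu' (Φ w v) = jetCoord n u hu v ᵥ* _
    rw [jetCoord_change n (ht w) hu', hΦ, jetCoord_change n hu (hs w), Matrix.vecMul_vecMul]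
  · rw [jetForm_eq n u' ⟨t w, ht w⟩, jetForm_eq n u ⟨s w, hs w⟩, HermMetric.jetForm,
      HermMetric.jetForm, ← (hst w).jetGram_eq hK w (ht w)]
    change jetCoord n (t w) (ht w) (Φ w v₁) ⬝ᵥ
      (_ *ᵥ star (jetCoord n (t w) (ht w) (Φ w v₂))) = _
    rw [hΦ, hΦ]
    rfl
  · refine (jetCoord n (t w) (ht w)).injective ?_
    rw [hΦ, jetCoord_pascalMap, jetCoord_pascalMap, hΦ]

/-! ### Ranks -/

theorem finrank_fibre (x : Ω) : Module.finrank ℂ (E x) = l := by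
  rw [Module.finrank_eq_card_basis ((trivFrame l E x).basis (mem_dom_trivFrame x)),
    Fintype.card_fin]

theorem finrank_jetFibre (x : Ω) : Module.finrank ℂ (JetFibre l E n x) = (n + 1) * l := by
  rw [(jetCoord n (trivFrame l E x) (mem_dom_trivFrame x)).finrank_eq, Module.finrank_fintype_fun_eq_card,
    Fintype.card_prod, Fintype.card_fin, Fintype.card_fin]

end Contact

end

/-! ### The equivalence, for bundles whose ranks are not assumed equal. -/

theorem mainTheorem1 {m n l l' : ℕ} (hn : 1 ≤ n)
    (Ω : TopologicalSpace.Opens (Fin (m + 1) → ℂ)) (Ω' : TopologicalSpace.Opens (Fin m → ℂ))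
    (hZ : ∀ w ∈ Ω', (Fin.cons 0 w : Fin (m + 1) → ℂ) ∈ Ω)
    (E : Ω → Type*)
    [TopologicalSpace (Bundle.TotalSpace (Fin l → ℂ) E)] [∀ x, TopologicalSpace (E x)]
    [∀ x, AddCommGroup (E x)] [∀ x, Module ℂ (E x)]
    [FiberBundle (Fin l → ℂ) E] [VectorBundle ℂ (Fin l → ℂ) E]
    [ContMDiffVectorBundle ω (Fin l → ℂ) E 𝓘(ℂ, Fin (m + 1) → ℂ)]
    (E' : Ω → Type*)
    [TopologicalSpace (Bundle.TotalSpace (Fin l' → ℂ) E')] [∀ x, TopologicalSpace (E' x)]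
    [∀ x, AddCommGroup (E' x)] [∀ x, Module ℂ (E' x)]
    [FiberBundle (Fin l' → ℂ) E'] [VectorBundle ℂ (Fin l' → ℂ) E']
    [ContMDiffVectorBundle ω (Fin l' → ℂ) E' 𝓘(ℂ, Fin (m + 1) → ℂ)]
    (h : HermMetric l E) (h' : HermMetric l' E') :
    HasContactAlong hZ n h h' ↔
      ∃ Ψ : ∀ w : Ω', E (zPoint hZ w) ≃ₗ[ℂ] E' (zPoint hZ w),
        IsHolIsometry hZ h h' Ψ ∧
        (∀ r t : ℕ, r ≤ n - 1 → t ≤ n - 1 → IntertwinesCovCurv hZ h h' Ψ 0 r t) ∧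
        (∀ r : ℕ, r ≤ n - 1 → ∀ j : Fin (m + 1), j ≠ 0 →
          IntertwinesCovCurv hZ h h' Ψ j r 0) := by
  -- Over an empty hypersurface both sides hold vacuously, whatever the ranks. Otherwise the
  -- isomorphism on a single fibre forces `l = l'`, so the preceding results apply.
  rcases isEmpty_or_nonempty Ω' with hΩ' | ⟨⟨w₀⟩⟩
  · have hhol {f : Ω' → ℂ} {U : Set Ω'} : HolomorphicOn f U := by
      rintro _ ⟨w, -, -⟩
      exact isEmptyElim w
    exact ⟨fun _ => ⟨fun w => isEmptyElim w, ⟨fun _ _ _ _ => hhol, fun w => isEmptyElim w⟩,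
      fun _ _ _ _ w => isEmptyElim w, fun _ _ _ _ w => isEmptyElim w⟩,
      fun _ => ⟨fun w => isEmptyElim w, ⟨fun _ _ => ⟨0, fun _ _ => hhol, fun w => isEmptyElim w⟩,
        fun w => isEmptyElim w⟩, fun w => isEmptyElim w⟩⟩
  constructor
  · rintro ⟨Φ, hΦ⟩
    obtain rfl : l = l' := by
      have h1 := (Φ w₀).finrank_eq
      rw [finrank_jetFibre, finrank_jetFibre] at h1
      exact Nat.eq_of_mul_eq_mul_left n.succ_pos h1
    -- The bound `1 ≤ n` makes `r ≤ n - 1` mean `r < n`; with truncated subtraction, `n = 0` would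
    -- still ask for the case `r = 0`.
    exact exists_isometry_of_contact ⟨Φ, hΦ⟩ hn
  · rintro ⟨Ψ, hΨ, hK, hK'⟩
    obtain rfl : l = l' := by
      have h1 := (Ψ w₀).finrank_eq
      rwa [finrank_fibre (l := l), finrank_fibre (l := l')] at h1
    exact contact_of_isometry hΨ (fun r hr q hq => hK r q (by omega) (by omega))
      fun r hr => hK' r (by omega)
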